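/- All vector spaces, algebras (unital) and unadorned tensor products are over $\mathbb{C}$. Let $A$ be a Hopf $*$-algebra: a Hopf algebra with a $*$-algebra structure for which $\Delta$ is a $*$-homomorphism; its antipode $S$ is then invertible with $S^{-1}(a)=S(a^*)^*$. An $A$-covariant differential calculus is a differential graded algebra $(\Omega^\bullet=\bigoplus_{k\ge 0}\Omega^k,\wedge,d)$ which is generated by $B:=\Omega^0$ and $dB$, together with a coaction $\delta:\Omega^\bullet\to A\otimes\Omega^\bullet$, $\delta(\omega)=\omega_{(-1)}\otimes\omega_{(0)}$, making it a left $A$-comodule algebra such that each $\Omega^k$ is a subcomodule and $d$ is covariant. It is an $A$-covariant $*$-differential calculus if there is a conjugate linear involution $*$ on $\Omega^\bullet$ with $*(\Omega^k)\subseteq\Omega^k$, $(d\omega)^*=d(\omega^*)$, $(\omega\wedge\nu)^*=(-1)^{kl}\nu^*\wedge\omega^*$ for $\omega\in\Omega^k,\nu\in\Omega^l$, and $\delta(\omega^*)=\omega_{(-1)}^*\otimes\omega_{(0)}^*$. A metric is a pair $(g,(\ ,\ ))$ with $g\in\Omega^1\otimes_B\Omega^1$ and a $B$-bilinear map $(\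 ,\ ):\Omega^1\otimes_B\Omega^1\to B$ such that $((\omega,\cdot)\otimes_B\mathrm{id})g=\omega=(\mathrm{id}\otimes_B(\cdot,\omega))g$ for all $\omega\in\Omega^1$. It is $A$-covariant if $(\ ,\ )$ and the map $B\to\Omega^1\otimes_B\Omega^1$, $b\mapsto bg$, are $A$-comodule maps. It is real if, writing $g=\sum_i\omega_i\otimes_B\eta_i$, one has $g=\sum_i\eta_i^*\otimes_B\omega_i^*$. A (unital) $2$-cocycle on $A$ is a convolution invertible linear map $\gamma:A\otimes A\to\mathbb{C}$, with convolution inverse $\bar\gamma$, such that $\gamma(f_{(1)}\otimes h_{(1)})\gamma(f_{(2)}h_{(2)}\otimes k)=\gamma(h_{(1)}\otimes k_{(1)})\gamma(f\otimes h_{(2)}k_{(2)})$ for all $f,h,k\in A$ and $\gamma(h\otimes 1)=\varepsilon(h)=\gamma(1\otimes h)$; it is unitary if $\overline{\gamma(a\otimes b)}=\bar\gamma(S(a)^*\otimes S(b)^*)$. Put $V(k)=\gamma(S^{-1}(k_{(2)})\otimes k_{(1)})$ and $\bar V(k)=\bar\gamma(k_{(2)}\otimes S^{-1}(k_{(1)}))$.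 The twist $A_\gamma$ is the coalgebra $A$ with product $h\cdot_\gamma k=\gamma(h_{(1)}\otimes k_{(1)})h_{(2)}k_{(2)}\bar\gamma(h_{(3)}\otimes k_{(3)})$ and $h^{*_\gamma}=\bar V(h_{(1)}^*)h_{(2)}^*V(h_{(3)}^*)$. The deformed calculus $(\Omega^\bullet_\gamma,\wedge_\gamma,d_\gamma)$ is $(\Omega^\bullet,d)$ with the same coaction, the product $\omega\wedge_\gamma\eta=\gamma(\omega_{(-1)}\otimes\eta_{(-1)})\,\omega_{(0)}\wedge\eta_{(0)}$ and $\omega^{*_\gamma}=\bar V(\omega_{(-1)}^*)\,\omega_{(0)}^*$; its degree $0$ part is denoted $B_\gamma$. Let $\varphi:\Omega^1_\gamma\otimes_{B_\gamma}\Omega^1_\gamma\to\Omega^1\otimes_B\Omega^1$ be the map $\omega\otimes\eta\mapsto\gamma(\omega_{(-1)}\otimes\eta_{(-1)})\,\omega_{(0)}\otimes_B\eta_{(0)}$, with inverse $\omega\otimes_B\eta\mapsto\bar\gamma(\omega_{(-1)}\otimes\eta_{(-1)})\,\omega_{(0)}\otimes_{B_\gamma}\eta_{(0)}$. **Proposition.**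 Let $(\Omega^\bullet,\wedge,d)$ be an $A$-covariant $*$-differential calculus, $(g,(\ ,\ ))$ a real $A$-covariant metric on $\Omega^1$, and $\gamma$ a unitary $2$-cocycle on $A$. Then $(\Omega^\bullet_\gamma,\wedge_\gamma,d_\gamma)$ with $*_\gamma$ is an $A_\gamma$-covariant $*$-differential calculus, and the cocycle-deformed metric $(g_\gamma,(\ ,\ )_\gamma):=(\varphi^{-1}(g),(\ ,\ )\circ\varphi)$ is a real $A_\gamma$-covariant metric on $\Omega^1_\gamma$. -/

import Mathlib

noncomputable section

open scoped TensorProduct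
open TensorProduct WithConv Coalgebra

/-- Left comodules over a complex coalgebra. -/
class LeftComodule (C M : Type*) [AddCommGroup C] [Module ℂ C] [Coalgebra ℂ C]
    [AddCommGroup M] [Module ℂ M] where
  coact : M →ₗ[ℂ] C ⊗[ℂ] M
  coassoc : ∀ m, TensorProduct.assoc ℂ C C M ((comul (R := ℂ)).rTensor M (coact m)) =
    coact.lTensor C (coact m)
  counit_coact : ∀ m, TensorProduct.lid ℂ M ((counit (R := ℂ)).rTensor M (coact m)) = m

open LeftComodule

section Act
variable {C D M N : Type*} [AddCommGroup C] [Module ℂ C] [Coalgebra ℂ C]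
  [AddCommGroup D] [Module ℂ D] [Coalgebra ℂ D]
  [AddCommGroup M] [Module ℂ M] [AddCommGroup N] [Module ℂ N]

/-- The linear functionals on a coalgebra, with the convolution product. -/
abbrev Conv (C : Type*) [AddCommGroup C] [Module ℂ C] [Coalgebra ℂ C] := WithConv (C →ₗ[ℂ] ℂ)

/-- `m ↦ φ(m₍₋₁₎) m₍₀₎`. -/
def act [LeftComodule C M] (φ : Conv C) : M →ₗ[ℂ] M :=
  (TensorProduct.lid ℂ M).toLinearMap ∘ₗ φ.ofConv.rTensor M ∘ₗ coact

theorem act_one [LeftComodule C M] : act (1 : Conv C) = (LinearMap.id : M →ₗ[ℂ] M) := by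
  ext m; simpa [act, LinearMap.convOne_def] using counit_coact (C := C) m

theorem act_mul [LeftComodule C M] (φ ψ : Conv C) (m : M) :
    act (φ * ψ) m = act ψ (act φ m) := by
  let F : C ⊗[ℂ] (C ⊗[ℂ] M) →ₗ[ℂ] M := (TensorProduct.lid ℂ M).toLinearMap ∘ₗ
    TensorProduct.map φ.ofConv ((TensorProduct.lid ℂ M).toLinearMap ∘ₗ ψ.ofConv.rTensor M)
  have h := congr(F $(LeftComodule.coassoc (C := C) m))
  convert! h using 1
  · simp only [act, LinearMap.comp_apply, LinearEquiv.coe_coe]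
    hopf_tensor_induction coact (C := C) m with c n
    simp only [LinearMap.rTensor_tmul, LinearMap.convMul_def, LinearMap.comp_apply,
      TensorProduct.lid_tmul]
    generalize comul (R := ℂ) c = z
    induction z with
    | zero => simp
    | add x y hx hy => simp only [map_add, add_smul, TensorProduct.add_tmul, hx, hy]
    | tmul c₁ c₂ => simp [F, mul_smul, smul_comm (ψ.ofConv c₂)]
  · simp only [act, LinearMap.comp_apply, LinearEquiv.coe_coe]
    hopf_tensor_induction coact (C := C) m with c n
    simp only [LinearMap.rTensor_tmul, LinearMap.lTensor_tmul, TensorProduct.lid_tmul, map_smul]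
    simp [F]

/-- Naturality of the action along a map of comodules that lies over a linear map `h`. -/
theorem act_nat [LeftComodule C M] [LeftComodule D N] (h : C →ₗ[ℂ] D) (f : M →ₗ[ℂ] N)
    (hf : ∀ m, coact (C := D) (f m) = TensorProduct.map h f (coact (C := C) m)) (φ : Conv D) (m : M) :
    act φ (f m) = f (act (toConv (φ.ofConv ∘ₗ h)) m) := by
  simp only [act, LinearMap.comp_apply, hf, LinearEquiv.coe_coe]
  hopf_tensor_induction coact (C := C) m with c n
  simp

/-- The tensor product of comodules, over the tensor product of the coalgebras. -/
instance tensorComodule [LeftComodule C M] [LeftComodule D N] :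
    LeftComodule (C ⊗[ℂ] D) (M ⊗[ℂ] N) where
  coact := (TensorProduct.tensorTensorTensorComm ℂ C M D N).toLinearMap ∘ₗ
    TensorProduct.map coact coact
  coassoc x := by
    induction x with
    | zero => simp
    | add x y hx hy => simp only [map_add, hx, hy]
    | tmul m n =>
      let F : (C ⊗[ℂ] (C ⊗[ℂ] M)) ⊗[ℂ] (D ⊗[ℂ] (D ⊗[ℂ] N)) →ₗ[ℂ]
          (C ⊗[ℂ] D) ⊗[ℂ] ((C ⊗[ℂ] D) ⊗[ℂ] (M ⊗[ℂ] N)) :=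
        (TensorProduct.map LinearMap.id
          (TensorProduct.tensorTensorTensorComm ℂ C M D N).toLinearMap) ∘ₗ
        (TensorProduct.tensorTensorTensorComm ℂ C (C ⊗[ℂ] M) D (D ⊗[ℂ] N)).toLinearMap
      convert! congr(F ($(LeftComodule.coassoc (C := C) m) ⊗ₜ[ℂ]
        $(LeftComodule.coassoc (C := D) n))) using 1
      · simp only [LinearMap.comp_apply, TensorProduct.map_tmul, LinearEquiv.coe_coe]
        hopf_tensor_induction coact (C := C) m with c m'
        hopf_tensor_induction coact (C := D) n with d n'
        simp only [LinearMap.rTensor_tmul, TensorProduct.tensorTensorTensorComm_tmul,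
          TensorProduct.comul_tmul]
        hopf_tensor_induction comul (R := ℂ) c with c₁ c₂
        hopf_tensor_induction comul (R := ℂ) d with d₁ d₂
        simp [F]
      · simp only [LinearMap.comp_apply, TensorProduct.map_tmul, LinearEquiv.coe_coe]
        hopf_tensor_induction coact (C := C) m with c m'
        hopf_tensor_induction coact (C := D) n with d n'
        simp [F]
  counit_coact x := by
    induction x with
    | zero => simp
    | add x y hx hy => simp only [map_add, hx, hy]
    | tmul m n =>
      conv_rhs => rw [← LeftComodule.counit_coact (C := C) m, ← LeftComodule.counit_coact (C := D) n]
      simp only [LinearMap.comp_apply, TensorProduct.map_tmul, LinearEquiv.coe_coe]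
      hopf_tensor_induction coact (C := C) m with c m'
      hopf_tensor_induction coact (C := D) n with d n'
      simp [TensorProduct.smul_tmul', TensorProduct.tmul_smul, smul_smul]

/-- The functional `φ ⊗ ψ`. -/
def tens (φ : Conv C) (ψ : Conv D) : Conv (C ⊗[ℂ] D) :=
  toConv ((TensorProduct.lid ℂ ℂ).toLinearMap ∘ₗ TensorProduct.map φ.ofConv ψ.ofConv)

theorem act_tens [LeftComodule C M] [LeftComodule D N] (φ : Conv C) (ψ : Conv D) (m : M) (n : N) :
    act (tens φ ψ) (m ⊗ₜ[ℂ] n) = act φ m ⊗ₜ[ℂ] act ψ n := by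
  simp only [act, LinearMap.comp_apply, LinearEquiv.coe_coe, coact, TensorProduct.map_tmul]
  hopf_tensor_induction coact (C := C) m with c m'
  hopf_tensor_induction coact (C := D) n with d n'
  simp [tens, TensorProduct.smul_tmul', TensorProduct.tmul_smul, smul_smul, mul_comm]

theorem tens_mul (φ φ' : Conv C) (ψ ψ' : Conv D) :
    tens φ ψ * tens φ' ψ' = tens (φ * φ') (ψ * ψ') := by
  ext c d
  simp only [tens, LinearMap.convMul_def, LinearMap.comp_apply, TensorProduct.comul_tmul,
    TensorProduct.AlgebraTensorModule.curry_apply, LinearMap.restrictScalars_self,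
    TensorProduct.curry_apply, TensorProduct.map_tmul, LinearEquiv.coe_coe]
  hopf_tensor_induction comul (R := ℂ) c with c₁ c₂
  hopf_tensor_induction comul (R := ℂ) d with d₁ d₂
  simp; ring

theorem tens_one : tens (1 : Conv C) (1 : Conv D) = 1 := by
  ext c d
  simp [tens, LinearMap.convOne_def, mul_comm]

end Act

section LR
variable {C D M : Type*} [AddCommGroup C] [Module ℂ C] [Coalgebra ℂ C]
  [AddCommGroup D] [Module ℂ D] [Coalgebra ℂ D] [AddCommGroup M] [Module ℂ M]

/-- `c ↦ φ(c₍₁₎) c₍₂₎`. -/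
def convL (φ : Conv C) : C →ₗ[ℂ] C :=
  (TensorProduct.lid ℂ C).toLinearMap ∘ₗ φ.ofConv.rTensor C ∘ₗ comul

/-- `c ↦ c₍₁₎ φ(c₍₂₎)`. -/
def convR (φ : Conv C) : C →ₗ[ℂ] C :=
  (TensorProduct.rid ℂ C).toLinearMap ∘ₗ φ.ofConv.lTensor C ∘ₗ comul

theorem coact_act [LeftComodule C M] (φ : Conv C) (m : M) :
    coact (C := C) (act φ m) = (convL φ).rTensor M (coact (C := C) m) := by
  let F : C ⊗[ℂ] (C ⊗[ℂ] M) →ₗ[ℂ] C ⊗[ℂ] M := (TensorProduct.lid ℂ _).toLinearMap ∘ₗ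
    φ.ofConv.rTensor _
  convert! congr(F $((LeftComodule.coassoc (C := C) m).symm)) using 1
  · simp only [act, LinearMap.comp_apply, LinearEquiv.coe_coe]
    hopf_tensor_induction coact (C := C) m with c n
    simp [F]
  · hopf_tensor_induction coact (C := C) m with c n
    simp only [LinearMap.rTensor_tmul, convL, LinearMap.comp_apply, LinearEquiv.coe_coe]
    hopf_tensor_induction comul (R := ℂ) c with c₁ c₂
    simp [F, TensorProduct.smul_tmul']

theorem convR_coact [LeftComodule C M] (φ : Conv C) (m : M) :
    (convR φ).rTensor M (coact (C := C) m) = (act φ).lTensor C (coact (C := C) m) := by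
  let F : C ⊗[ℂ] (C ⊗[ℂ] M) →ₗ[ℂ] C ⊗[ℂ] M := LinearMap.lTensor C
    ((TensorProduct.lid ℂ _).toLinearMap ∘ₗ φ.ofConv.rTensor _)
  convert! congr(F $((LeftComodule.coassoc (C := C) m))) using 1
  · hopf_tensor_induction coact (C := C) m with c n
    simp only [LinearMap.rTensor_tmul, convR, LinearMap.comp_apply, LinearEquiv.coe_coe]
    hopf_tensor_induction comul (R := ℂ) c with c₁ c₂
    simp [F, TensorProduct.smul_tmul]
  · hopf_tensor_induction coact (C := C) m with c n
    simp [F, act]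

variable (C) in
/-- A coalgebra as a left comodule over itself. -/
@[reducible] def selfComodule : LeftComodule C C where
  coact := comul
  coassoc := Coalgebra.coassoc_apply
  counit_coact c := by simp

theorem convL_one : convL (1 : Conv C) = LinearMap.id :=
  letI := selfComodule C
  act_one (C := C) (M := C)

theorem convL_mul (φ ψ : Conv C) (c : C) : convL (φ * ψ) c = convL ψ (convL φ c) :=
  letI := selfComodule C
  act_mul (C := C) (M := C) φ ψ c

theorem comul_convL (φ : Conv C) (c : C) :
    comul (R := ℂ) (convL φ c) = (convL φ).rTensor C (comul (R := ℂ) c) :=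
  letI := selfComodule C
  coact_act (C := C) (M := C) φ c

theorem convR_comul (φ : Conv C) (c : C) :
    (convR φ).rTensor C (comul (R := ℂ) c) = (convL φ).lTensor C (comul (R := ℂ) c) :=
  letI := selfComodule C
  convR_coact (C := C) (M := C) φ c

theorem convL_nat (h : C →ₗc[ℂ] D) (φ : Conv D) (c : C) :
    convL φ (h c) = h (convL (toConv (φ.ofConv ∘ₗ h.toLinearMap)) c) :=
  letI := selfComodule C
  letI := selfComodule D
  act_nat (C := C) (D := D) (M := C) (N := D) h.toLinearMap h.toLinearMap
    (fun m => (CoalgHomClass.map_comp_comul_apply h m).symm) φ c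

theorem convR_nat (h : C →ₗc[ℂ] D) (φ : Conv D) (c : C) :
    convR φ (h c) = h (convR (toConv (φ.ofConv ∘ₗ h.toLinearMap)) c) := by
  simp only [convR, LinearMap.comp_apply, LinearEquiv.coe_coe,
    ← CoalgHomClass.map_comp_comul_apply]
  generalize comul (R := ℂ) c = z
  induction z with
  | zero => simp
  | add x y hx hy => simp only [map_add, hx, hy]
  | tmul c₁ c₂ => simp

theorem convR_one : convR (1 : Conv C) = LinearMap.id := by
  ext m
  simp [convR, LinearMap.convOne_def]

theorem comul_convR (φ : Conv C) (c : C) :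
    comul (R := ℂ) (convR φ c) = (convR φ).lTensor C (comul (R := ℂ) c) := by
  let F : C ⊗[ℂ] (C ⊗[ℂ] C) →ₗ[ℂ] C ⊗[ℂ] C := LinearMap.lTensor C
    ((TensorProduct.rid ℂ _).toLinearMap ∘ₗ φ.ofConv.lTensor _)
  convert! congr(F $((Coalgebra.coassoc_apply (R := ℂ) c))) using 1
  · simp only [convR, LinearMap.comp_apply, LinearEquiv.coe_coe]
    hopf_tensor_induction comul (R := ℂ) c with c n
    simp only [LinearMap.lTensor_tmul, LinearMap.rTensor_tmul, TensorProduct.rid_tmul, map_smul]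
    generalize comul (R := ℂ) c = z
    induction z with
    | zero => simp
    | add x y hx hy => simp only [map_add, smul_add, TensorProduct.add_tmul, hx, hy]
    | tmul c₁ c₂ => simp [F, TensorProduct.tmul_smul]
  · hopf_tensor_induction comul (R := ℂ) c with c n
    simp [F, convR]

theorem conv_apply (φ ψ : Conv C) (c : C) :
    (φ * ψ).ofConv c = φ.ofConv (convR ψ c) := by
  simp only [LinearMap.convMul_def, convR, LinearMap.comp_apply, LinearEquiv.coe_coe]
  hopf_tensor_induction comul (R := ℂ) c with c₁ c₂
  simp [mul_comm]

theorem convR_mul (φ ψ : Conv C) (c : C) : convR (φ * ψ) c = convR φ (convR ψ c) := by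
  conv_rhs => rw [convR]
  simp only [LinearMap.comp_apply, comul_convR]
  rw [convR]
  simp only [LinearMap.comp_apply, LinearEquiv.coe_coe]
  hopf_tensor_induction comul (R := ℂ) c with c₁ c₂
  simp only [LinearMap.lTensor_tmul, conv_apply]

theorem convL_convR (φ ψ : Conv C) (c : C) : convL φ (convR ψ c) = convR ψ (convL φ c) := by
  conv_lhs => rw [convL]
  conv_rhs => rw [convL]
  simp only [LinearMap.comp_apply, comul_convR, LinearEquiv.coe_coe]
  hopf_tensor_induction comul (R := ℂ) c with c₁ c₂
  simp

theorem convL_tens (φ : Conv C) (ψ : Conv D) (c : C) (d : D) :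
    convL (tens φ ψ) (c ⊗ₜ[ℂ] d) = convL φ c ⊗ₜ[ℂ] convL ψ d := by
  simp only [convL, LinearMap.comp_apply, LinearEquiv.coe_coe, TensorProduct.comul_tmul]
  hopf_tensor_induction comul (R := ℂ) c with c₁ c₂
  hopf_tensor_induction comul (R := ℂ) d with d₁ d₂
  simp [tens, TensorProduct.smul_tmul', TensorProduct.tmul_smul, smul_smul, mul_comm]

theorem convR_tens (φ : Conv C) (ψ : Conv D) (c : C) (d : D) :
    convR (tens φ ψ) (c ⊗ₜ[ℂ] d) = convR φ c ⊗ₜ[ℂ] convR ψ d := by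
  simp only [convR, LinearMap.comp_apply, LinearEquiv.coe_coe, TensorProduct.comul_tmul]
  hopf_tensor_induction comul (R := ℂ) c with c₁ c₂
  hopf_tensor_induction comul (R := ℂ) d with d₁ d₂
  simp [tens, TensorProduct.smul_tmul', TensorProduct.tmul_smul, smul_smul, mul_comm]

theorem conv_apply' (φ ψ : Conv C) (c : C) :
    (φ * ψ).ofConv c = ψ.ofConv (convL φ c) := by
  simp only [LinearMap.convMul_def, convL, LinearMap.comp_apply, LinearEquiv.coe_coe]
  hopf_tensor_induction comul (R := ℂ) c with c₁ c₂
  simp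

/-- Pulling functionals back along a morphism of coalgebras is multiplicative. -/
def pull (h : C →ₗc[ℂ] D) : Conv D →* Conv C where
  toFun φ := toConv (φ.ofConv ∘ₗ h.toLinearMap)
  map_one' := by ext c; simp [LinearMap.convOne_def]
  map_mul' φ ψ := congrArg toConv (LinearMap.convMul_comp_coalgHom_distrib φ ψ h)

end LR

section Cocycle
variable (A : Type*) [Ring A] [Bialgebra ℂ A]

/-- A (unital) `2`-cocycle on a bialgebra: a convolution invertible functional `γ` on `A ⊗ A` with
`γ(g₍₁₎ ⊗ h₍₁₎) γ(g₍₂₎h₍₂₎ ⊗ k) = γ(h₍₁₎ ⊗ k₍₁₎) γ(g ⊗ h₍₂₎k₍₂₎)` and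
`γ(h ⊗ 1) = ε(h) = γ(1 ⊗ h)`. -/
structure TwoCocycle where
  toUnit : (Conv (A ⊗[ℂ] A))ˣ
  cocycle : ∀ g h k : A,
    (toUnit.val *
        toConv (toUnit.val.ofConv ∘ₗ (TensorProduct.mk ℂ A A).flip k ∘ₗ LinearMap.mul' ℂ A)).ofConv
      (g ⊗ₜ[ℂ] h) =
    (toUnit.val *
        toConv (toUnit.val.ofConv ∘ₗ TensorProduct.mk ℂ A A g ∘ₗ LinearMap.mul' ℂ A)).ofConv
      (h ⊗ₜ[ℂ] k)
  unital_right : ∀ h : A, toUnit.val.ofConv (h ⊗ₜ[ℂ] 1) = counit (R := ℂ) h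
  unital_left : ∀ h : A, toUnit.val.ofConv (1 ⊗ₜ[ℂ] h) = counit (R := ℂ) h

variable {A}
/-- The functional `γ`. -/
def TwoCocycle.fn (γ : TwoCocycle A) : Conv (A ⊗[ℂ] A) := γ.toUnit.val

/-- The convolution inverse of `γ`. -/
def TwoCocycle.inv (γ : TwoCocycle A) : Conv (A ⊗[ℂ] A) := γ.toUnit⁻¹.val

variable (γ : TwoCocycle A)

theorem TwoCocycle.fn_inv : γ.fn * γ.inv = 1 := γ.toUnit.mul_inv
theorem TwoCocycle.inv_fn : γ.inv * γ.fn = 1 := γ.toUnit.inv_mul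

open Bialgebra in
/-- The cocycle condition as an identity in the convolution algebra of `A ⊗ A ⊗ A`. -/
theorem TwoCocycle.conv_cocycle :
    tens γ.fn 1 * pull (Coalgebra.TensorProduct.map (mulCoalgHom ℂ A) (CoalgHom.id ℂ A)) γ.fn =
    pull (Coalgebra.TensorProduct.assoc ℂ ℂ A A A : (A ⊗[ℂ] A) ⊗[ℂ] A →ₗc[ℂ] A ⊗[ℂ] (A ⊗[ℂ] A))
      (tens 1 γ.fn *
        pull (Coalgebra.TensorProduct.map (CoalgHom.id ℂ A) (mulCoalgHom ℂ A)) γ.fn) := by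
  ext g h k
  have := γ.cocycle g h k
  rw [conv_apply', conv_apply'] at this
  simp only [TensorProduct.AlgebraTensorModule.curry_apply, LinearMap.restrictScalars_self,
    TensorProduct.curry_apply]
  rw [conv_apply', convL_tens, convL_one]
  change _ = (_ * _ : Conv _).ofConv (g ⊗ₜ[ℂ] (h ⊗ₜ[ℂ] k))
  rw [conv_apply', convL_tens, convL_one]
  exact this

open Bialgebra in
theorem TwoCocycle.conv_cocycle_inv :
    pull (Coalgebra.TensorProduct.map (mulCoalgHom ℂ A) (CoalgHom.id ℂ A)) γ.inv * tens γ.inv 1 =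
    pull (Coalgebra.TensorProduct.assoc ℂ ℂ A A A : (A ⊗[ℂ] A) ⊗[ℂ] A →ₗc[ℂ] A ⊗[ℂ] (A ⊗[ℂ] A))
      (pull (Coalgebra.TensorProduct.map (CoalgHom.id ℂ A) (mulCoalgHom ℂ A)) γ.inv *
        tens 1 γ.inv) := by
  refine left_inv_eq_right_inv (a := tens γ.fn 1 *
    pull (Coalgebra.TensorProduct.map (mulCoalgHom ℂ A) (CoalgHom.id ℂ A)) γ.fn) ?_ ?_
  · rw [mul_assoc, ← mul_assoc (tens γ.inv 1), tens_mul, γ.inv_fn, one_mul, tens_one, one_mul,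
      ← map_mul, γ.inv_fn, map_one]
  · rw [γ.conv_cocycle, ← map_mul, mul_assoc, ← mul_assoc _ _ (tens 1 γ.inv), ← map_mul, γ.fn_inv,
      map_one, one_mul, tens_mul, γ.fn_inv, one_mul, tens_one, map_one]

variable (A) in
/-- The coalgebra map `h ↦ h ⊗ 1`. -/
def inclLeft : A →ₗc[ℂ] A ⊗[ℂ] A where
  toLinearMap := (TensorProduct.mk ℂ A A).flip 1
  counit_comp := by ext; simp
  map_comp_comul := by
    ext h
    simp only [LinearMap.comp_apply, LinearMap.flip_apply, TensorProduct.mk_apply,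
      TensorProduct.comul_tmul, Bialgebra.comul_one]
    hopf_tensor_induction comul (R := ℂ) h with c₁ c₂
    simp [Algebra.TensorProduct.one_def]

variable (A) in
/-- The coalgebra map `h ↦ 1 ⊗ h`. -/
def inclRight : A →ₗc[ℂ] A ⊗[ℂ] A where
  toLinearMap := TensorProduct.mk ℂ A A 1
  counit_comp := by ext; simp
  map_comp_comul := by
    ext h
    simp only [LinearMap.comp_apply, TensorProduct.mk_apply,
      TensorProduct.comul_tmul, Bialgebra.comul_one]
    hopf_tensor_induction comul (R := ℂ) h with c₁ c₂
    simp [Algebra.TensorProduct.one_def]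

theorem TwoCocycle.pull_inclLeft : pull (inclLeft A) γ.fn = 1 := by
  ext h
  change γ.toUnit.val.ofConv (h ⊗ₜ[ℂ] 1) = _
  rw [γ.unital_right h]; rfl

theorem TwoCocycle.pull_inclRight : pull (inclRight A) γ.fn = 1 := by
  ext h
  change γ.toUnit.val.ofConv (1 ⊗ₜ[ℂ] h) = _
  rw [γ.unital_left h]; rfl

theorem TwoCocycle.pull_inclLeft_inv : pull (inclLeft A) γ.inv = 1 := by
  have := congr(pull (inclLeft A) $(γ.fn_inv))
  rwa [map_mul, γ.pull_inclLeft, one_mul, map_one] at this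

theorem TwoCocycle.pull_inclRight_inv : pull (inclRight A) γ.inv = 1 := by
  have := congr(pull (inclRight A) $(γ.fn_inv))
  rwa [map_mul, γ.pull_inclRight, one_mul, map_one] at this

end Cocycle

theorem map_rTensor_apply {M M' N P Q : Type*} [AddCommGroup M] [Module ℂ M] [AddCommGroup M']
    [Module ℂ M'] [AddCommGroup N] [Module ℂ N] [AddCommGroup P] [Module ℂ P] [AddCommGroup Q]
    [Module ℂ Q] (f : M →ₗ[ℂ] P) (g : N →ₗ[ℂ] Q) (k : M' →ₗ[ℂ] M) (z : M' ⊗[ℂ] N) :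
    TensorProduct.map f g (k.rTensor N z) = TensorProduct.map (f ∘ₗ k) g z := by
  rw [← LinearMap.map_comp_rTensor]; rfl

theorem map_lTensor_apply {M M' N P Q : Type*} [AddCommGroup M] [Module ℂ M] [AddCommGroup M']
    [Module ℂ M'] [AddCommGroup N] [Module ℂ N] [AddCommGroup P] [Module ℂ P] [AddCommGroup Q]
    [Module ℂ Q] (f : N →ₗ[ℂ] Q) (g : M →ₗ[ℂ] P) (k : M' →ₗ[ℂ] M) (z : N ⊗[ℂ] M') :
    TensorProduct.map f g (k.lTensor N z) = TensorProduct.map f (g ∘ₗ k) z := by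
  rw [← LinearMap.map_comp_lTensor]; rfl

/-- Left comodule algebras: the coaction is a unital algebra map. -/
class ComoduleAlgebra (A X : Type*) [Ring A] [Bialgebra ℂ A] [Ring X] [Algebra ℂ X]
    extends LeftComodule A X where
  coact_one : coact (1 : X) = 1
  coact_mul : ∀ x y : X, coact (x * y) = coact x * coact y

section HopfTwist
variable {A : Type*} [Ring A] [Bialgebra ℂ A] (γ : TwoCocycle A)

/-- The `2`-cocycle twist `A_γ` of a bialgebra `A`: the coalgebra `A` with the product
`h ·_γ k = γ(h₍₁₎ ⊗ k₍₁₎) h₍₂₎k₍₂₎ γ⁻¹(h₍₃₎ ⊗ k₍₃₎)`. -/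
def HopfTwist (_ : TwoCocycle A) : Type _ := A

namespace HopfTwist

instance : AddCommGroup (HopfTwist γ) := inferInstanceAs (AddCommGroup A)
instance : Module ℂ (HopfTwist γ) := inferInstanceAs (Module ℂ A)
instance : Coalgebra ℂ (HopfTwist γ) := inferInstanceAs (Coalgebra ℂ A)

/-- The twisted product, as a linear map on `A ⊗ A`. -/
def mulMap : A ⊗[ℂ] A →ₗ[ℂ] A := LinearMap.mul' ℂ A ∘ₗ convL γ.fn ∘ₗ convR γ.inv

theorem mulMap_one (h : A) : mulMap γ (h ⊗ₜ[ℂ] 1) = h := by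
  have h1 := convR_nat (inclLeft A) γ.inv h
  have h2 := convL_nat (inclLeft A) γ.fn h
  change convR γ.inv (h ⊗ₜ[ℂ] 1) = (convR (pull (inclLeft A) γ.inv) h) ⊗ₜ[ℂ] 1 at h1
  change convL γ.fn (h ⊗ₜ[ℂ] 1) = (convL (pull (inclLeft A) γ.fn) h) ⊗ₜ[ℂ] 1 at h2
  rw [γ.pull_inclLeft_inv, convR_one] at h1
  rw [γ.pull_inclLeft, convL_one] at h2
  simp [mulMap, h1, h2]

theorem one_mulMap (h : A) : mulMap γ (1 ⊗ₜ[ℂ] h) = h := by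
  have h1 := convR_nat (inclRight A) γ.inv h
  have h2 := convL_nat (inclRight A) γ.fn h
  change convR γ.inv (1 ⊗ₜ[ℂ] h) = 1 ⊗ₜ[ℂ] (convR (pull (inclRight A) γ.inv) h) at h1
  change convL γ.fn (1 ⊗ₜ[ℂ] h) = 1 ⊗ₜ[ℂ] (convL (pull (inclRight A) γ.fn) h) at h2
  rw [γ.pull_inclRight_inv, convR_one] at h1
  rw [γ.pull_inclRight, convL_one] at h2
  simp [mulMap, h1, h2]

open Bialgebra in
theorem mulMap_assoc (x y z : A) :
    mulMap γ (mulMap γ (x ⊗ₜ[ℂ] y) ⊗ₜ[ℂ] z) = mulMap γ (x ⊗ₜ[ℂ] mulMap γ (y ⊗ₜ[ℂ] z)) := by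
  let m12 : (A ⊗[ℂ] A) ⊗[ℂ] A →ₗc[ℂ] A ⊗[ℂ] A :=
    Coalgebra.TensorProduct.map (mulCoalgHom ℂ A) (CoalgHom.id ℂ A)
  let m23 : A ⊗[ℂ] (A ⊗[ℂ] A) →ₗc[ℂ] A ⊗[ℂ] A :=
    Coalgebra.TensorProduct.map (CoalgHom.id ℂ A) (mulCoalgHom ℂ A)
  let a : (A ⊗[ℂ] A) ⊗[ℂ] A →ₗc[ℂ] A ⊗[ℂ] (A ⊗[ℂ] A) := Coalgebra.TensorProduct.assoc ℂ ℂ A A A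
  let t := (x ⊗ₜ[ℂ] y) ⊗ₜ[ℂ] z
  have e1 : mulMap γ (x ⊗ₜ[ℂ] y) ⊗ₜ[ℂ] z =
      m12 (convL (tens γ.fn 1) (convR (tens γ.inv 1) t)) := by
    rw [convR_tens, convL_tens, convL_one, convR_one]; rfl
  have e2 : x ⊗ₜ[ℂ] mulMap γ (y ⊗ₜ[ℂ] z) =
      m23 (convL (tens 1 γ.fn) (convR (tens 1 γ.inv) (a t))) := by
    change _ = m23 (convL (tens 1 γ.fn) (convR (tens 1 γ.inv) (x ⊗ₜ[ℂ] (y ⊗ₜ[ℂ] z))))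
    rw [convR_tens, convL_tens, convL_one, convR_one]; rfl
  have hm : ∀ u, LinearMap.mul' ℂ A (m12 u) = LinearMap.mul' ℂ A (m23 (a u)) := by
    intro u
    have : (LinearMap.mul' ℂ A ∘ₗ m12.toLinearMap) =
        (LinearMap.mul' ℂ A ∘ₗ m23.toLinearMap ∘ₗ a.toLinearMap) := by
      ext p q r; exact mul_assoc p q r
    exact congr($this u)
  have L1 : ∀ u, convL γ.fn (convR γ.inv (m12 (convL (tens γ.fn 1) (convR (tens γ.inv 1) u)))) =
      m12 (convL (tens γ.fn 1 * pull m12 γ.fn) (convR (pull m12 γ.inv * tens γ.inv 1) u)) := by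
    intro u
    rw [convR_nat, convL_nat]
    change m12 (convL (pull m12 γ.fn) (convR (pull m12 γ.inv) _)) = _
    rw [← convL_convR (tens γ.fn 1), convL_mul, convR_mul]
  have L2 : ∀ u, convL γ.fn (convR γ.inv (m23 (convL (tens 1 γ.fn) (convR (tens 1 γ.inv) u)))) =
      m23 (convL (tens 1 γ.fn * pull m23 γ.fn) (convR (pull m23 γ.inv * tens 1 γ.inv) u)) := by
    intro u
    rw [convR_nat, convL_nat]
    change m23 (convL (pull m23 γ.fn) (convR (pull m23 γ.inv) _)) = _
    rw [← convL_convR (tens 1 γ.fn), convL_mul, convR_mul]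
  rw [e1, e2]
  simp only [mulMap, LinearMap.comp_apply]
  rw [L1, L2, hm]
  have c1 : tens γ.fn 1 * pull m12 γ.fn = pull a (tens 1 γ.fn * pull m23 γ.fn) := γ.conv_cocycle
  have c2 : pull m12 γ.inv * tens γ.inv 1 = pull a (pull m23 γ.inv * tens 1 γ.inv) :=
    γ.conv_cocycle_inv
  rw [c1, c2, convR_nat a, convL_nat a]
  rfl

instance : Ring (HopfTwist γ) where
  __ := (inferInstance : AddCommGroup (HopfTwist γ))
  mul h k := mulMap γ ((show A from h) ⊗ₜ[ℂ] (show A from k))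
  one := (1 : A)
  zero_mul h := by
    change mulMap γ ((0 : A) ⊗ₜ[ℂ] (show A from h)) = (0 : A)
    rw [TensorProduct.zero_tmul, map_zero]
  mul_zero h := by
    change mulMap γ ((show A from h) ⊗ₜ[ℂ] (0 : A)) = (0 : A)
    rw [TensorProduct.tmul_zero, map_zero]
  left_distrib h k l := by
    change mulMap γ ((show A from h) ⊗ₜ[ℂ] ((show A from k) + (show A from l))) = (_ : A)
    rw [TensorProduct.tmul_add, map_add]; rfl
  right_distrib h k l := by
    change mulMap γ (((show A from h) + (show A from k)) ⊗ₜ[ℂ] (show A from l)) = (_ : A)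
    rw [TensorProduct.add_tmul, map_add]; rfl
  mul_assoc h k l := mulMap_assoc γ h k l
  one_mul h := one_mulMap γ h
  mul_one h := mulMap_one γ h

instance : Algebra ℂ (HopfTwist γ) := Algebra.ofModule
  (fun r h k => by
    change mulMap γ ((r • (show A from h)) ⊗ₜ[ℂ] (show A from k)) = (_ : A)
    rw [← TensorProduct.smul_tmul', map_smul]; rfl)
  (fun r h k => by
    change mulMap γ ((show A from h) ⊗ₜ[ℂ] (r • (show A from k))) = (_ : A)
    rw [TensorProduct.tmul_smul, map_smul]; rfl)

/-- The identity map `A → A_γ`. -/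
def of : A ≃ₗ[ℂ] HopfTwist γ := LinearEquiv.refl ℂ A

theorem of_mul (h k : A) : of γ h * of γ k = of γ (mulMap γ (h ⊗ₜ[ℂ] k)) := rfl

theorem of_one : of γ 1 = 1 := rfl

theorem comul_mulMap (z : A ⊗[ℂ] A) :
    comul (R := ℂ) (mulMap γ z) =
      TensorProduct.map (mulMap γ) (mulMap γ) (comul (R := ℂ) z) := by
  have h1 : ∀ w : A ⊗[ℂ] A, comul (R := ℂ) (LinearMap.mul' ℂ A w) =
      TensorProduct.map (LinearMap.mul' ℂ A) (LinearMap.mul' ℂ A) (comul (R := ℂ) w) := fun w =>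
    (CoalgHomClass.map_comp_comul_apply (Bialgebra.mulCoalgHom ℂ A) w).symm
  have h2 : TensorProduct.map (mulMap γ) (mulMap γ) (comul (R := ℂ) z) =
      TensorProduct.map (LinearMap.mul' ℂ A ∘ₗ convL γ.fn) (mulMap γ)
        ((convR γ.inv).rTensor _ (comul (R := ℂ) z)) := by
    rw [map_rTensor_apply]; rfl
  have h3 : mulMap γ ∘ₗ convL γ.inv = LinearMap.mul' ℂ A ∘ₗ convR γ.inv := by
    ext x y
    simp only [mulMap, LinearMap.comp_apply, TensorProduct.AlgebraTensorModule.curry_apply,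
      LinearMap.restrictScalars_self, TensorProduct.curry_apply]
    rw [convL_convR, ← convL_mul, γ.inv_fn, convL_one]; rfl
  rw [h2, convR_comul, map_lTensor_apply, h3]
  simp only [mulMap, LinearMap.comp_apply, h1, comul_convL, comul_convR]
  hopf_tensor_induction comul (R := ℂ) z with u v
  simp

theorem counit_mulMap (z : A ⊗[ℂ] A) : counit (R := ℂ) (mulMap γ z) = counit (R := ℂ) z := by
  have h1 : ∀ w : A ⊗[ℂ] A, counit (R := ℂ) (LinearMap.mul' ℂ A w) = counit (R := ℂ) w := fun w =>
    CoalgHomClass.counit_comp_apply (Bialgebra.mulCoalgHom ℂ A) w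
  have h2 := conv_apply' γ.fn 1 (convR γ.inv z)
  rw [mul_one, ← conv_apply, γ.fn_inv] at h2
  simp only [mulMap, LinearMap.comp_apply, h1]
  exact h2.symm

theorem tensor_mul (s t : HopfTwist γ ⊗[ℂ] HopfTwist γ) : s * t =
    TensorProduct.map (mulMap γ) (mulMap γ)
      (TensorProduct.tensorTensorTensorComm ℂ A A A A (s ⊗ₜ[ℂ] t)) := by
  let F := (TensorProduct.mk ℂ (A ⊗[ℂ] A) (A ⊗[ℂ] A)).compr₂
    (TensorProduct.map (mulMap γ) (mulMap γ) ∘ₗ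
      (TensorProduct.tensorTensorTensorComm ℂ A A A A).toLinearMap)
  change s * t = F s t
  induction s with
  | zero => exact (zero_mul t).trans (LinearMap.map_zero₂ F t).symm
  | add x y hx hy =>
    exact (add_mul x y t).trans ((congrArg₂ (· + ·) hx hy).trans (LinearMap.map_add₂ F x y t).symm)
  | tmul a b =>
    induction t with
    | zero => exact (mul_zero _).trans (F _).map_zero.symm
    | add x y hx hy =>
      exact (mul_add _ x y).trans ((congrArg₂ (· + ·) hx hy).trans ((F _).map_add x y).symm)
    | tmul c d => exact Algebra.TensorProduct.tmul_mul_tmul (R := ℂ) a c b d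

instance : Bialgebra ℂ (HopfTwist γ) := Bialgebra.mk' ℂ (HopfTwist γ)
  (Bialgebra.counit_one (R := ℂ) (A := A))
  (fun {h k} => by
    refine (counit_mulMap γ ((show A from h) ⊗ₜ[ℂ] (show A from k))).trans ?_
    rw [TensorProduct.counit_tmul, smul_eq_mul, mul_comm]; rfl)
  (Bialgebra.comul_one (R := ℂ) (A := A))
  (fun {h k} => by
    refine (comul_mulMap γ ((show A from h) ⊗ₜ[ℂ] (show A from k))).trans ?_
    exact (tensor_mul γ _ _).symm)

end HopfTwist
end HopfTwist

section Deform
variable {A : Type*} [Ring A] [Bialgebra ℂ A] (γ : TwoCocycle A)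
  {X : Type*} [Ring X] [Algebra ℂ X] [ComoduleAlgebra A X]

/-- The cocycle deformation `X_γ` of a left comodule algebra `X`: the comodule `X` with the product
`x ·_γ y = γ(x₍₋₁₎ ⊗ y₍₋₁₎) x₍₀₎y₍₀₎`. -/
def Deform (_ : TwoCocycle A) (X : Type*) : Type _ := X

theorem coact_mul' (z : X ⊗[ℂ] X) : coact (C := A) (LinearMap.mul' ℂ X z) =
    TensorProduct.map (LinearMap.mul' ℂ A) (LinearMap.mul' ℂ X) (coact (C := A ⊗[ℂ] A) z) := by
  induction z with
  | zero => simp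
  | add x y hx hy => simp only [map_add, hx, hy]
  | tmul x y =>
    simp only [LinearMap.mul'_apply, ComoduleAlgebra.coact_mul, coact, LinearMap.comp_apply,
      TensorProduct.map_tmul, LinearEquiv.coe_coe]
    hopf_tensor_induction coact (C := A) x with a x'
    hopf_tensor_induction coact (C := A) y with b y'
    simp

theorem coact_rTensor_mul (w : (X ⊗[ℂ] X) ⊗[ℂ] X) :
    coact (C := A ⊗[ℂ] A) ((LinearMap.mul' ℂ X).rTensor X w) =
      TensorProduct.map ((LinearMap.mul' ℂ A).rTensor A) ((LinearMap.mul' ℂ X).rTensor X)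
        (coact (C := (A ⊗[ℂ] A) ⊗[ℂ] A) w) := by
  induction w with
  | zero => simp
  | add x y hx hy => simp only [map_add, hx, hy]
  | tmul u z =>
    have hu := coact_mul' (A := A) u
    simp only [coact, LinearMap.comp_apply, LinearMap.rTensor_tmul,
      TensorProduct.map_tmul, LinearEquiv.coe_coe] at hu ⊢
    rw [hu]
    hopf_tensor_induction coact (C := A) z with c z'
    generalize TensorProduct.tensorTensorTensorComm ℂ A X A X
      (TensorProduct.map (coact (C := A)) (coact (C := A)) u) = v
    hopf_tensor_induction v with a x'
    simp

theorem coact_lTensor_mul (w : X ⊗[ℂ] (X ⊗[ℂ] X)) :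
    coact (C := A ⊗[ℂ] A) ((LinearMap.mul' ℂ X).lTensor X w) =
      TensorProduct.map ((LinearMap.mul' ℂ A).lTensor A) ((LinearMap.mul' ℂ X).lTensor X)
        (coact (C := A ⊗[ℂ] (A ⊗[ℂ] A)) w) := by
  induction w with
  | zero => simp
  | add x y hx hy => simp only [map_add, hx, hy]
  | tmul z u =>
    have hu := coact_mul' (A := A) u
    simp only [coact, LinearMap.comp_apply, LinearMap.lTensor_tmul,
      TensorProduct.map_tmul, LinearEquiv.coe_coe] at hu ⊢
    rw [hu]
    hopf_tensor_induction coact (C := A) z with c z'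
    generalize TensorProduct.tensorTensorTensorComm ℂ A X A X
      (TensorProduct.map (coact (C := A)) (coact (C := A)) u) = v
    hopf_tensor_induction v with a x'
    simp

theorem coact_assoc {C M N P : Type*} [AddCommGroup C] [Module ℂ C] [Coalgebra ℂ C]
    [AddCommGroup M] [Module ℂ M] [AddCommGroup N] [Module ℂ N] [AddCommGroup P] [Module ℂ P]
    [LeftComodule C M] [LeftComodule C N] [LeftComodule C P] (w : (M ⊗[ℂ] N) ⊗[ℂ] P) :
    coact (C := C ⊗[ℂ] (C ⊗[ℂ] C)) (TensorProduct.assoc ℂ M N P w) =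
      TensorProduct.map (TensorProduct.assoc ℂ C C C).toLinearMap
        (TensorProduct.assoc ℂ M N P).toLinearMap (coact (C := (C ⊗[ℂ] C) ⊗[ℂ] C) w) := by
  induction w with
  | zero => simp
  | add x y hx hy => simp only [map_add, hx, hy]
  | tmul u z =>
    induction u with
    | zero => simp
    | add x y hx hy => simp only [map_add, TensorProduct.add_tmul, hx, hy]
    | tmul x y =>
      simp only [TensorProduct.assoc_tmul, coact, LinearMap.comp_apply,
        TensorProduct.map_tmul, LinearEquiv.coe_coe]
      hopf_tensor_induction coact (C := C) x with a x'
      hopf_tensor_induction coact (C := C) y with b y'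
      hopf_tensor_induction coact (C := C) z with c z'
      simp

namespace Deform

instance {X : Type*} [AddCommGroup X] : AddCommGroup (Deform γ X) := inferInstanceAs (AddCommGroup X)
instance {X : Type*} [AddCommGroup X] [Module ℂ X] : Module ℂ (Deform γ X) :=
  inferInstanceAs (Module ℂ X)
instance {X : Type*} [AddCommGroup X] [Module ℂ X] [LeftComodule A X] :
    LeftComodule (HopfTwist γ) (Deform γ X) :=
  inferInstanceAs (LeftComodule A X)

/-- The deformed product, as a linear map on `X ⊗ X`. -/
def mulMap : X ⊗[ℂ] X →ₗ[ℂ] X := LinearMap.mul' ℂ X ∘ₗ act γ.fn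

theorem mulMap_one (x : X) : mulMap γ (x ⊗ₜ[ℂ] 1) = x := by
  have h := act_nat (C := A) (D := A ⊗[ℂ] A) (M := X) (N := X ⊗[ℂ] X) (inclLeft A).toLinearMap
    ((TensorProduct.mk ℂ X X).flip 1) (fun m => by
      simp only [LinearMap.flip_apply, TensorProduct.mk_apply, coact, LinearMap.comp_apply,
        TensorProduct.map_tmul, ComoduleAlgebra.coact_one, Algebra.TensorProduct.one_def,
        LinearEquiv.coe_coe]
      hopf_tensor_induction coact (C := A) m with c m'
      simp [inclLeft]) γ.fn x
  change act γ.fn (x ⊗ₜ[ℂ] 1) = act (pull (inclLeft A) γ.fn) x ⊗ₜ[ℂ] 1 at h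
  rw [γ.pull_inclLeft, act_one] at h
  simp [mulMap, h]

theorem one_mulMap (x : X) : mulMap γ (1 ⊗ₜ[ℂ] x) = x := by
  have h := act_nat (C := A) (D := A ⊗[ℂ] A) (M := X) (N := X ⊗[ℂ] X) (inclRight A).toLinearMap
    (TensorProduct.mk ℂ X X 1) (fun m => by
      simp only [TensorProduct.mk_apply, coact, LinearMap.comp_apply,
        TensorProduct.map_tmul, ComoduleAlgebra.coact_one, Algebra.TensorProduct.one_def,
        LinearEquiv.coe_coe]
      hopf_tensor_induction coact (C := A) m with c m'
      simp [inclRight]) γ.fn x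
  change act γ.fn (1 ⊗ₜ[ℂ] x) = 1 ⊗ₜ[ℂ] act (pull (inclRight A) γ.fn) x at h
  rw [γ.pull_inclRight, act_one] at h
  simp [mulMap, h]

open Bialgebra in
theorem mulMap_assoc (x y z : X) :
    mulMap γ (mulMap γ (x ⊗ₜ[ℂ] y) ⊗ₜ[ℂ] z) = mulMap γ (x ⊗ₜ[ℂ] mulMap γ (y ⊗ₜ[ℂ] z)) := by
  let m12 : (A ⊗[ℂ] A) ⊗[ℂ] A →ₗc[ℂ] A ⊗[ℂ] A :=
    Coalgebra.TensorProduct.map (mulCoalgHom ℂ A) (CoalgHom.id ℂ A)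
  let m23 : A ⊗[ℂ] (A ⊗[ℂ] A) →ₗc[ℂ] A ⊗[ℂ] A :=
    Coalgebra.TensorProduct.map (CoalgHom.id ℂ A) (mulCoalgHom ℂ A)
  let a : (A ⊗[ℂ] A) ⊗[ℂ] A →ₗc[ℂ] A ⊗[ℂ] (A ⊗[ℂ] A) := Coalgebra.TensorProduct.assoc ℂ ℂ A A A
  let n12 : (X ⊗[ℂ] X) ⊗[ℂ] X →ₗ[ℂ] X ⊗[ℂ] X := (LinearMap.mul' ℂ X).rTensor X
  let n23 : X ⊗[ℂ] (X ⊗[ℂ] X) →ₗ[ℂ] X ⊗[ℂ] X := (LinearMap.mul' ℂ X).lTensor X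
  let b : (X ⊗[ℂ] X) ⊗[ℂ] X →ₗ[ℂ] X ⊗[ℂ] (X ⊗[ℂ] X) := (TensorProduct.assoc ℂ X X X).toLinearMap
  let t := (x ⊗ₜ[ℂ] y) ⊗ₜ[ℂ] z
  have e1 : mulMap γ (x ⊗ₜ[ℂ] y) ⊗ₜ[ℂ] z = n12 (act (tens γ.fn (1 : Conv A)) t) := by
    rw [act_tens, act_one]; rfl
  have e2 : x ⊗ₜ[ℂ] mulMap γ (y ⊗ₜ[ℂ] z) = n23 (act (tens (1 : Conv A) γ.fn) (b t)) := by
    change _ = n23 (act (tens (1 : Conv A) γ.fn) (x ⊗ₜ[ℂ] (y ⊗ₜ[ℂ] z)))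
    rw [act_tens, act_one]; rfl
  have h12 : ∀ u, act γ.fn (n12 u) = n12 (act (pull m12 γ.fn) u) := fun u =>
    act_nat m12.toLinearMap n12 (fun w => coact_rTensor_mul w) γ.fn u
  have h23 : ∀ u, act γ.fn (n23 u) = n23 (act (pull m23 γ.fn) u) := fun u =>
    act_nat m23.toLinearMap n23 (fun w => coact_lTensor_mul w) γ.fn u
  have ha : ∀ φ u, act φ (b u) = b (act (pull a φ) u) := fun φ u =>
    act_nat a.toLinearMap b (fun w => coact_assoc w) φ u
  have hm : ∀ u, LinearMap.mul' ℂ X (n12 u) = LinearMap.mul' ℂ X (n23 (b u)) := by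
    intro u
    have : (LinearMap.mul' ℂ X ∘ₗ n12) = (LinearMap.mul' ℂ X ∘ₗ n23 ∘ₗ b) := by
      ext p q r; exact mul_assoc p q r
    exact congr($this u)
  have c1 : tens γ.fn 1 * pull m12 γ.fn = pull a (tens (1 : Conv A) γ.fn * pull m23 γ.fn) :=
    γ.conv_cocycle
  rw [e1, e2]
  simp only [mulMap, LinearMap.comp_apply]
  rw [h12, h23, ← act_mul, ← act_mul, ha, hm, c1]

instance : Ring (Deform γ X) where
  __ := (inferInstance : AddCommGroup (Deform γ X))
  mul x y := mulMap (X := X) γ ((show X from x) ⊗ₜ[ℂ] (show X from y))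
  one := (1 : X)
  zero_mul h := by
    change mulMap (X := X) γ ((0 : X) ⊗ₜ[ℂ] (show X from h)) = (0 : X)
    rw [TensorProduct.zero_tmul, map_zero]
  mul_zero h := by
    change mulMap (X := X) γ ((show X from h) ⊗ₜ[ℂ] (0 : X)) = (0 : X)
    rw [TensorProduct.tmul_zero, map_zero]
  left_distrib h k l := by
    change mulMap (X := X) γ ((show X from h) ⊗ₜ[ℂ] ((show X from k) + (show X from l))) = (_ : X)
    rw [TensorProduct.tmul_add, map_add]; rfl
  right_distrib h k l := by
    change mulMap (X := X) γ (((show X from h) + (show X from k)) ⊗ₜ[ℂ] (show X from l)) = (_ : X)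
    rw [TensorProduct.add_tmul, map_add]; rfl
  mul_assoc h k l := mulMap_assoc (X := X) γ h k l
  one_mul h := one_mulMap (X := X) γ h
  mul_one h := mulMap_one (X := X) γ h

instance : Algebra ℂ (Deform γ X) := Algebra.ofModule
  (fun r h k => by
    change mulMap (X := X) γ ((r • (show X from h)) ⊗ₜ[ℂ] (show X from k)) = (_ : X)
    rw [← TensorProduct.smul_tmul', map_smul]; rfl)
  (fun r h k => by
    change mulMap (X := X) γ ((show X from h) ⊗ₜ[ℂ] (r • (show X from k))) = (_ : X)
    rw [TensorProduct.tmul_smul, map_smul]; rfl)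

theorem tensor_mul (s t : HopfTwist γ ⊗[ℂ] Deform γ X) : s * t =
    TensorProduct.map (HopfTwist.mulMap γ) (mulMap (X := X) γ)
      (TensorProduct.tensorTensorTensorComm ℂ A X A X (s ⊗ₜ[ℂ] t)) := by
  let F := (TensorProduct.mk ℂ (A ⊗[ℂ] X) (A ⊗[ℂ] X)).compr₂
    (TensorProduct.map (HopfTwist.mulMap γ) (mulMap (X := X) γ) ∘ₗ
      (TensorProduct.tensorTensorTensorComm ℂ A X A X).toLinearMap)
  change s * t = F s t
  induction s with
  | zero => exact (zero_mul t).trans (LinearMap.map_zero₂ F t).symm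
  | add x y hx hy =>
    exact (add_mul x y t).trans ((congrArg₂ (· + ·) hx hy).trans (LinearMap.map_add₂ F x y t).symm)
  | tmul a b =>
    induction t with
    | zero => exact (mul_zero _).trans (F _).map_zero.symm
    | add x y hx hy =>
      exact (mul_add _ x y).trans ((congrArg₂ (· + ·) hx hy).trans ((F _).map_add x y).symm)
    | tmul c d => exact Algebra.TensorProduct.tmul_mul_tmul (R := ℂ) a c b d

/-- Moving `γ⁻¹` across the coaction. -/
theorem map_mulMap_coact {C M N : Type*} [AddCommGroup C] [Module ℂ C] [Coalgebra ℂ C]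
    [AddCommGroup M] [Module ℂ M] [AddCommGroup N] [Module ℂ N] [LeftComodule C M]
    {E : Type*} [AddCommGroup E] [Module ℂ E] (f : C →ₗ[ℂ] E) (g : M →ₗ[ℂ] N)
    (φ ψ : Conv C) (h : φ * ψ = 1) (m : M) :
    TensorProduct.map (f ∘ₗ convL ψ ∘ₗ convR φ) (g ∘ₗ act ψ) (coact (C := C) m) =
      TensorProduct.map f g (coact (C := C) (act ψ m)) := by
  have h2 : TensorProduct.map (f ∘ₗ convL ψ ∘ₗ convR φ) (g ∘ₗ act ψ) (coact (C := C) m) =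
      TensorProduct.map (f ∘ₗ convL ψ) (g ∘ₗ act ψ) ((convR φ).rTensor _ (coact (C := C) m)) := by
    rw [map_rTensor_apply]; rfl
  rw [h2, convR_coact, coact_act]
  hopf_tensor_induction coact (C := C) m with c n
  simp only [LinearMap.lTensor_tmul, LinearMap.rTensor_tmul, TensorProduct.map_tmul,
    LinearMap.comp_apply]
  rw [← act_mul, h, act_one]; rfl

instance : ComoduleAlgebra (HopfTwist γ) (Deform γ X) where
  coact_one := ComoduleAlgebra.coact_one (A := A) (X := X)
  coact_mul x y := by
    refine Eq.trans ?_ (tensor_mul (X := X) γ _ _).symm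
    change coact (C := A) (LinearMap.mul' ℂ X (act γ.fn ((show X from x) ⊗ₜ[ℂ] (show X from y)))) = _
    rw [coact_mul', ← map_mulMap_coact _ _ _ _ γ.inv_fn]
    rfl

end Deform
end Deform

section Subcomodule
variable {C M : Type*} [AddCommGroup C] [Module ℂ C] [Coalgebra ℂ C]
  [AddCommGroup M] [Module ℂ M] [LeftComodule C M]

variable (C) in
/-- A subspace `U` is a subcomodule if the coaction maps `U` into `C ⊗ U`. -/
def IsSubcomodule (U : Submodule ℂ M) : Prop :=
  ∀ x ∈ U, coact (C := C) x ∈ LinearMap.range (U.subtype.lTensor C)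

theorem lTensor_subtype_injective (U : Submodule ℂ M) :
    Function.Injective (U.subtype.lTensor C) :=
  Module.Flat.lTensor_preserves_injective_linearMap _ U.subtype_injective

/-- The restriction of the coaction to a subcomodule. -/
def subCoact (U : Submodule ℂ M) (h : IsSubcomodule C U) : U →ₗ[ℂ] C ⊗[ℂ] U :=
  (LinearEquiv.ofInjective _ (lTensor_subtype_injective (C := C) U)).symm.toLinearMap ∘ₗ
    (coact (C := C) ∘ₗ U.subtype).codRestrict _ (fun x => h x.1 x.2)

theorem lTensor_subCoact (U : Submodule ℂ M) (h : IsSubcomodule C U) (x : U) :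
    U.subtype.lTensor C (subCoact U h x) = coact (C := C) (x : M) := by
  exact congrArg Subtype.val ((LinearEquiv.ofInjective _
    (lTensor_subtype_injective (C := C) U)).apply_symm_apply _)

/-- A subcomodule is a comodule. -/
@[reducible] def subComodule (U : Submodule ℂ M) (h : IsSubcomodule C U) : LeftComodule C U where
  coact := subCoact U h
  coassoc m := by
    apply Module.Flat.lTensor_preserves_injective_linearMap (M := C) (U.subtype.lTensor C)
      (lTensor_subtype_injective (C := C) U)
    have h1 : ∀ z : C ⊗[ℂ] U, (U.subtype.lTensor C).lTensor C
        (TensorProduct.assoc ℂ C C U ((comul (R := ℂ)).rTensor U z)) =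
        TensorProduct.assoc ℂ C C M ((comul (R := ℂ)).rTensor M (U.subtype.lTensor C z)) := by
      intro z
      hopf_tensor_induction z with c u
      simp only [LinearMap.rTensor_tmul, LinearMap.lTensor_tmul]
      generalize comul (R := ℂ) c = w
      induction w with
      | zero => simp
      | add x y hx hy => simp only [map_add, TensorProduct.add_tmul, hx, hy]
      | tmul c₁ c₂ => simp
    have h2 : ∀ z : C ⊗[ℂ] U, (U.subtype.lTensor C).lTensor C ((subCoact U h).lTensor C z) =
        (coact (C := C)).lTensor C (U.subtype.lTensor C z) := by
      intro z
      hopf_tensor_induction z with c u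
      simp only [LinearMap.lTensor_tmul, lTensor_subCoact, Submodule.subtype_apply]
    rw [h1, h2, lTensor_subCoact, LeftComodule.coassoc]
  counit_coact m := by
    apply U.subtype_injective
    have h1 : ∀ z : C ⊗[ℂ] U, U.subtype (TensorProduct.lid ℂ U ((counit (R := ℂ)).rTensor U z)) =
        TensorProduct.lid ℂ M ((counit (R := ℂ)).rTensor M (U.subtype.lTensor C z)) := by
      intro z
      hopf_tensor_induction z with c u
      simp
    rw [h1, lTensor_subCoact, LeftComodule.counit_coact]; rfl

theorem IsSubcomodule.map {N : Type*} [AddCommGroup N] [Module ℂ N] [LeftComodule C N]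
    {U : Submodule ℂ M} (hU : IsSubcomodule C U) (f : M →ₗ[ℂ] N)
    (hf : ∀ m, coact (C := C) (f m) = f.lTensor C (coact (C := C) m)) :
    IsSubcomodule C (U.map f) := by
  rintro _ ⟨x, hx, rfl⟩
  obtain ⟨z, hz⟩ := hU x hx
  rw [hf, ← hz]
  refine ⟨(f.submoduleMap U).lTensor C z, ?_⟩
  rw [← LinearMap.comp_apply, ← LinearMap.comp_apply, ← LinearMap.lTensor_comp,
    ← LinearMap.lTensor_comp]
  rfl

theorem range_lTensor_mono {U W : Submodule ℂ M} (h : U ≤ W) :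
    LinearMap.range (U.subtype.lTensor C) ≤ LinearMap.range (W.subtype.lTensor C) := by
  rintro _ ⟨z, rfl⟩
  refine ⟨(Submodule.inclusion h).lTensor C z, ?_⟩
  rw [← LinearMap.comp_apply, ← LinearMap.lTensor_comp]
  rfl

theorem IsSubcomodule.sup {U W : Submodule ℂ M} (hU : IsSubcomodule C U)
    (hW : IsSubcomodule C W) : IsSubcomodule C (U ⊔ W) := by
  intro x hx
  obtain ⟨u, hu, w, hw, rfl⟩ := Submodule.mem_sup.1 hx
  rw [map_add]
  exact add_mem (range_lTensor_mono le_sup_left (hU u hu)) (range_lTensor_mono le_sup_right (hW w hw))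

theorem act_tmul_mem {D N : Type*} [AddCommGroup D] [Module ℂ D] [Coalgebra ℂ D]
    [AddCommGroup N] [Module ℂ N] [LeftComodule D N] {U : Submodule ℂ M} {W : Submodule ℂ N}
    (hU : IsSubcomodule C U) (hW : IsSubcomodule D W) (φ : Conv (C ⊗[ℂ] D)) {x : M} {y : N}
    (hx : x ∈ U) (hy : y ∈ W) :
    act φ (x ⊗ₜ[ℂ] y) ∈ LinearMap.range (TensorProduct.map U.subtype W.subtype) := by
  let _ := subComodule U hU
  let _ := subComodule W hW
  refine ⟨act φ ((⟨x, hx⟩ : U) ⊗ₜ[ℂ] (⟨y, hy⟩ : W)), ?_⟩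
  have := act_nat (C := C ⊗[ℂ] D) (D := C ⊗[ℂ] D) (M := U ⊗[ℂ] W) (N := M ⊗[ℂ] N) LinearMap.id
    (TensorProduct.map U.subtype W.subtype) (fun m => by
      induction m with
      | zero => simp
      | add a b ha hb => simp only [map_add, ha, hb]
      | tmul u w =>
        simp only [coact, TensorProduct.map_tmul, LinearMap.comp_apply, LinearEquiv.coe_coe]
        have hu := lTensor_subCoact U hU u
        have hw := lTensor_subCoact W hW w
        simp only [Submodule.subtype_apply]
        change TensorProduct.tensorTensorTensorComm ℂ C M D N
          (coact (C := C) (u : M) ⊗ₜ[ℂ] coact (C := D) (w : N)) = _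
        rw [← hu, ← hw]
        hopf_tensor_induction subCoact U hU u with c u'
        hopf_tensor_induction subCoact W hW w with d w'
        simp) φ ((⟨x, hx⟩ : U) ⊗ₜ[ℂ] (⟨y, hy⟩ : W))
  exact this.symm

theorem act_mem {U : Submodule ℂ M} (hU : IsSubcomodule C U) (φ : Conv C) {x : M} (hx : x ∈ U) :
    act φ x ∈ U := by
  obtain ⟨z, hz⟩ := hU x hx
  simp only [act, LinearMap.comp_apply, ← hz, LinearEquiv.coe_coe]
  clear hz
  induction z with
  | zero => simp
  | add a b ha hb => simpa only [map_add] using add_mem ha hb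
  | tmul c u => simpa using U.smul_mem _ u.2

theorem isSubcomodule_top : IsSubcomodule C (⊤ : Submodule ℂ M) := by
  intro x _
  refine ⟨(Submodule.topEquiv.symm.toLinearMap).lTensor C (coact x), ?_⟩
  rw [← LinearMap.comp_apply, ← LinearMap.lTensor_comp]
  exact congr($(LinearMap.lTensor_id C M) _)

end Subcomodule

/-- An `A`-covariant differential calculus `(Ω, ∧, d)`: a differential graded algebra
`Ω = ⨁ₖ Ωᵏ` which is a left `A`-comodule algebra, such that every `Ωᵏ` is a subcomodule, `d` is
covariant, and `Ω` is generated by `B = Ω⁰` and `dB`. The comodule algebra `B` on which the calculus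
lives is the degree zero part. -/
structure CovariantCalculus (A Ω : Type*) [Ring A] [Bialgebra ℂ A] [Ring Ω] [Algebra ℂ Ω]
    [ComoduleAlgebra A Ω] where
  deg : ℕ → Submodule ℂ Ω
  d : Ω →ₗ[ℂ] Ω
  isInternal : DirectSum.IsInternal deg
  one_mem : (1 : Ω) ∈ deg 0
  mul_mem : ∀ {i j : ℕ} {x y : Ω}, x ∈ deg i → y ∈ deg j → x * y ∈ deg (i + j)
  d_mem : ∀ {i : ℕ} {x : Ω}, x ∈ deg i → d x ∈ deg (i + 1)
  d_d : ∀ x, d (d x) = 0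
  leibniz : ∀ {i : ℕ} {x : Ω} (y : Ω), x ∈ deg i → d (x * y) = d x * y + (-1 : ℂ) ^ i • (x * d y)
  generated : Algebra.adjoin ℂ ((deg 0 : Set Ω) ∪ d '' (deg 0 : Set Ω)) = ⊤
  isSubcomodule : ∀ i, IsSubcomodule A (deg i)
  coact_d : ∀ x, coact (C := A) (d x) = d.lTensor A (coact (C := A) x)

namespace CovariantCalculus
variable {A Ω : Type*} [Ring A] [Bialgebra ℂ A] [Ring Ω] [Algebra ℂ Ω] [ComoduleAlgebra A Ω]
  (C : CovariantCalculus A Ω) (γ : TwoCocycle A)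

section Twist

theorem mulMap_tmul_mem {U W P : Submodule ℂ Ω} (hU : IsSubcomodule A U) (hW : IsSubcomodule A W)
    (h : ∀ x ∈ U, ∀ y ∈ W, x * y ∈ P) {x y : Ω} (hx : x ∈ U) (hy : y ∈ W) :
    Deform.mulMap γ (x ⊗ₜ[ℂ] y) ∈ P := by
  obtain ⟨z, hz⟩ := act_tmul_mem hU hW γ.fn hx hy
  rw [Deform.mulMap, LinearMap.comp_apply, ← hz]
  clear hz
  induction z with
  | zero => simp
  | add a b ha hb => simpa only [map_add] using add_mem ha hb
  | tmul a b => exact h _ a.2 _ b.2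

theorem isSubcomodule_mul {U W : Submodule ℂ Ω} (hU : IsSubcomodule A U)
    (hW : IsSubcomodule A W) : IsSubcomodule A (U * W) := by
  intro x hx
  refine Submodule.mul_induction_on hx (fun u hu w hw => ?_) (fun a b ha hb => ?_)
  · obtain ⟨a, ha⟩ := hU u hu
    obtain ⟨b, hb⟩ := hW w hw
    rw [ComoduleAlgebra.coact_mul, ← ha, ← hb]
    clear ha hb
    induction a with
    | zero => simp
    | add a a' ha ha' => simpa only [map_add, add_mul] using add_mem ha ha'
    | tmul c u' =>
      induction b with
      | zero => simp
      | add b b' hb hb' => simpa only [map_add, mul_add] using add_mem hb hb'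
      | tmul e w' =>
        exact ⟨(c * e) ⊗ₜ[ℂ] (⟨u'.1 * w'.1, Submodule.mul_mem_mul u'.2 w'.2⟩ : ↥(U * W)), by simp⟩
  · rw [map_add]; exact add_mem ha hb

theorem isSubcomodule_one : IsSubcomodule A (1 : Submodule ℂ Ω) := by
  intro x hx
  obtain ⟨r, rfl⟩ := Submodule.mem_one.1 hx
  refine ⟨(1 : A) ⊗ₜ[ℂ] (⟨algebraMap ℂ Ω r, hx⟩ : (1 : Submodule ℂ Ω)), ?_⟩
  have h : coact (C := A) (algebraMap ℂ Ω r) = r • (1 : A ⊗[ℂ] Ω) := by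
    rw [Algebra.algebraMap_eq_smul_one, map_smul, ComoduleAlgebra.coact_one]
  rw [h, Algebra.TensorProduct.one_def]
  simp [Algebra.algebraMap_eq_smul_one]

theorem isSubcomodule_pow {U : Submodule ℂ Ω} (hU : IsSubcomodule A U) (n : ℕ) :
    IsSubcomodule A (U ^ n) := by
  induction n with
  | zero => rw [pow_zero]; exact isSubcomodule_one
  | succ n ih => rw [pow_succ]; exact isSubcomodule_mul ih hU

/-- The cocycle deformation of a generating set spanning a subcomodule is generating. -/
theorem adjoin_twist (s : Set Ω) (hs : IsSubcomodule A (Submodule.span ℂ s))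
    (h : Algebra.adjoin ℂ s = ⊤) :
    Algebra.adjoin ℂ (A := Deform γ Ω) s = ⊤ := by
  let S : Submodule ℂ Ω :=
    (Subalgebra.toSubmodule (A := Deform γ Ω) (Algebra.adjoin ℂ (A := Deform γ Ω) s) :
      Submodule ℂ (Deform γ Ω))
  have hS1 : (1 : Ω) ∈ S := Subalgebra.one_mem (Algebra.adjoin ℂ (A := Deform γ Ω) s)
  have hSm : ∀ x ∈ S, ∀ y ∈ S, Deform.mulMap γ (x ⊗ₜ[ℂ] y) ∈ S := fun x hx y hy =>
    (Algebra.adjoin ℂ (A := Deform γ Ω) s).mul_mem hx hy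
  have hP : Submodule.span ℂ s ≤ S := Submodule.span_le.2 fun x hx =>
    Algebra.subset_adjoin (R := ℂ) (A := Deform γ Ω) hx
  have hpow : ∀ n, Submodule.span ℂ s ^ n ≤ S := by
    intro n
    induction n with
    | zero =>
      rw [pow_zero]
      exact Submodule.one_le.2 hS1
    | succ n ih =>
      rw [pow_succ, Submodule.mul_le]
      intro x hx y hy
      have h1 : x * y = Deform.mulMap γ (act γ.inv (x ⊗ₜ[ℂ] y)) := by
        rw [Deform.mulMap, LinearMap.comp_apply, ← act_mul, γ.inv_fn, act_one]; simp
      rw [h1]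
      obtain ⟨z, hz⟩ := act_tmul_mem (isSubcomodule_pow hs n) hs γ.inv hx hy
      rw [← hz]
      clear hz
      induction z with
      | zero => simp
      | add a b ha hb => simpa only [map_add] using add_mem ha hb
      | tmul a b => exact hSm _ (ih a.2) _ (hP b.2)
  have htop : ∀ x : Ω, x ∈ S := by
    intro x
    have hx : x ∈ Algebra.adjoin ℂ s := h ▸ Algebra.mem_top
    rw [← Subalgebra.mem_toSubmodule, Algebra.adjoin_eq_span] at hx
    have hle : Submodule.span ℂ (Submonoid.closure s : Set Ω) ≤ S := by
      refine Submodule.span_le.2 fun y hy => ?_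
      obtain ⟨n, hn⟩ : ∃ n, y ∈ Submodule.span ℂ s ^ n := by
        induction hy using Submonoid.closure_induction_right with
        | one => exact ⟨0, by rw [pow_zero]; exact Submodule.one_le.1 le_rfl⟩
        | mul_right a _ b hb ih =>
          obtain ⟨n, hn⟩ := ih
          exact ⟨n + 1, by
            rw [pow_succ]; exact Submodule.mul_mem_mul hn (Submodule.subset_span hb)⟩
      exact hpow n hn
    exact hle hx
  exact eq_top_iff.2 fun x _ => htop x

/-- The cocycle deformation `(Ω_γ, ∧_γ, d_γ)`: the same complex of comodules, with the deformed
product. -/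
def twist : CovariantCalculus (HopfTwist γ) (Deform γ Ω) where
  deg := C.deg
  d := C.d
  isInternal := C.isInternal
  one_mem := C.one_mem
  mul_mem {i j x y} hx hy := mulMap_tmul_mem (P := C.deg (i + j)) γ (C.isSubcomodule i)
    (C.isSubcomodule j) (fun _ hu _ hw => C.mul_mem hu hw) (x := x) (y := y) hx hy
  d_mem := C.d_mem
  d_d := C.d_d
  leibniz {i x} y hx := by
    have key : ∀ z ∈ LinearMap.range (TensorProduct.map (C.deg i).subtype
        (⊤ : Submodule ℂ Ω).subtype), C.d (LinearMap.mul' ℂ Ω z) =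
        LinearMap.mul' ℂ Ω (C.d.rTensor Ω z) +
          (-1 : ℂ) ^ i • LinearMap.mul' ℂ Ω (C.d.lTensor Ω z) := by
      rintro _ ⟨z, rfl⟩
      induction z with
      | zero => simp
      | add a b ha hb => simp only [map_add, ha, hb, smul_add]; abel
      | tmul a b => simpa using C.leibniz b.1 a.2
    have h1 : ∀ z, act γ.fn (C.d.rTensor Ω z) = C.d.rTensor Ω (act γ.fn z) := fun z =>
      act_nat (C := A ⊗[ℂ] A) LinearMap.id (C.d.rTensor Ω) (fun m => by
        induction m with
        | zero => simp
        | add a b ha hb => simp only [map_add, ha, hb]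
        | tmul u w =>
          simp only [coact, LinearMap.comp_apply, LinearMap.rTensor_tmul, TensorProduct.map_tmul,
            LinearEquiv.coe_coe, C.coact_d]
          hopf_tensor_induction coact (C := A) u with a u'
          hopf_tensor_induction coact (C := A) w with b w'
          simp) γ.fn z
    have h2 : ∀ z, act γ.fn (C.d.lTensor Ω z) = C.d.lTensor Ω (act γ.fn z) := fun z =>
      act_nat (C := A ⊗[ℂ] A) LinearMap.id (C.d.lTensor Ω) (fun m => by
        induction m with
        | zero => simp
        | add a b ha hb => simp only [map_add, ha, hb]
        | tmul u w =>
          simp only [coact, LinearMap.comp_apply, LinearMap.lTensor_tmul, TensorProduct.map_tmul,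
            LinearEquiv.coe_coe, C.coact_d]
          hopf_tensor_induction coact (C := A) u with a u'
          hopf_tensor_induction coact (C := A) w with b w'
          simp) γ.fn z
    have h3 := key _ (act_tmul_mem (C.isSubcomodule i) isSubcomodule_top γ.fn hx
      (Submodule.mem_top (x := (show Ω from y))))
    rw [← h1, ← h2] at h3
    exact h3
  generated := by
    have h := (C.isSubcomodule 0).sup ((C.isSubcomodule 0).map C.d C.coact_d)
    suffices h' : IsSubcomodule A (Submodule.span ℂ ((C.deg 0 : Set Ω) ∪ C.d '' (C.deg 0 : Set Ω)))
      from adjoin_twist (Ω := Ω) γ _ h' C.generated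
    convert! h using 1
    rw [Submodule.span_union, Submodule.span_eq, ← Submodule.map_coe, Submodule.span_eq]
  isSubcomodule := C.isSubcomodule
  coact_d := C.coact_d

end Twist
end CovariantCalculus

section Generic
variable {C D E M N P : Type*} [AddCommGroup C] [Module ℂ C] [Coalgebra ℂ C]
  [AddCommGroup D] [Module ℂ D] [Coalgebra ℂ D] [AddCommGroup E] [Module ℂ E] [Coalgebra ℂ E]
  [AddCommGroup M] [Module ℂ M] [AddCommGroup N] [Module ℂ N] [AddCommGroup P] [Module ℂ P]
  [LeftComodule C M] [LeftComodule D N] [LeftComodule E P]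

theorem coact_rTensor (h : C →ₗ[ℂ] D) (f : M →ₗ[ℂ] N)
    (hf : ∀ m, coact (C := D) (f m) = TensorProduct.map h f (coact (C := C) m)) (w : M ⊗[ℂ] P) :
    coact (C := D ⊗[ℂ] E) (f.rTensor P w) =
      TensorProduct.map (h.rTensor E) (f.rTensor P) (coact (C := C ⊗[ℂ] E) w) := by
  induction w with
  | zero => simp
  | add x y hx hy => simp only [map_add, hx, hy]
  | tmul u z =>
    simp only [coact, LinearMap.comp_apply, LinearMap.rTensor_tmul,
      TensorProduct.map_tmul, LinearEquiv.coe_coe] at hf ⊢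
    rw [hf]
    hopf_tensor_induction coact (C := E) z with c z'
    hopf_tensor_induction coact (C := C) u with a x'
    simp

theorem coact_lTensor (h : C →ₗ[ℂ] D) (f : M →ₗ[ℂ] N)
    (hf : ∀ m, coact (C := D) (f m) = TensorProduct.map h f (coact (C := C) m)) (w : P ⊗[ℂ] M) :
    coact (C := E ⊗[ℂ] D) (f.lTensor P w) =
      TensorProduct.map (h.lTensor E) (f.lTensor P) (coact (C := E ⊗[ℂ] C) w) := by
  induction w with
  | zero => simp
  | add x y hx hy => simp only [map_add, hx, hy]
  | tmul z u =>
    simp only [coact, LinearMap.comp_apply, LinearMap.lTensor_tmul,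
      TensorProduct.map_tmul, LinearEquiv.coe_coe] at hf ⊢
    rw [hf]
    hopf_tensor_induction coact (C := E) z with c z'
    hopf_tensor_induction coact (C := C) u with a x'
    simp

end Generic

namespace CovariantCalculus
variable {A Ω : Type*} [Ring A] [Bialgebra ℂ A] [Ring Ω] [Algebra ℂ Ω] [ComoduleAlgebra A Ω]
  (C : CovariantCalculus A Ω)

/-- The space `Ωᵏ` of `k`-forms, as a vector space of its own. -/
def Form (k : ℕ) : Type _ := C.deg k

instance (k : ℕ) : AddCommGroup (C.Form k) := inferInstanceAs (AddCommGroup (C.deg k))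
instance (k : ℕ) : Module ℂ (C.Form k) := inferInstanceAs (Module ℂ (C.deg k))
instance (k : ℕ) : LeftComodule A (C.Form k) := subComodule (C.deg k) (C.isSubcomodule k)

/-- The inclusion of `Ωᵏ` into `Ω`. -/
def incl (k : ℕ) : C.Form k →ₗ[ℂ] Ω := (C.deg k).subtype

/-- An element of degree `k`, as an element of `Ωᵏ`. -/
def mkForm {k : ℕ} {x : Ω} (h : x ∈ C.deg k) : C.Form k := (⟨x, h⟩ : C.deg k)

theorem incl_mem {k : ℕ} (x : C.Form k) : C.incl k x ∈ C.deg k := x.2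

theorem incl_injective (k : ℕ) : Function.Injective (C.incl k) := (C.deg k).subtype_injective

theorem lTensor_incl_injective (k : ℕ) : Function.Injective ((C.incl k).lTensor A) :=
  Module.Flat.lTensor_preserves_injective_linearMap _ (C.incl_injective k)

theorem lTensor_incl_coact {k : ℕ} (x : C.Form k) :
    (C.incl k).lTensor A (coact (C := A) x) = coact (C := A) (C.incl k x) :=
  lTensor_subCoact _ _ x

/-- The product `Ωⁱ ⊗ Ωʲ → Ωᵏ`, where `i + j = k`. -/
def wedge (i j k : ℕ) (h : i + j = k) : C.Form i ⊗[ℂ] C.Form j →ₗ[ℂ] C.Form k :=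
  TensorProduct.lift (LinearMap.mk₂ ℂ (fun x y => C.mkForm (h ▸ C.mul_mem (C.incl_mem x) (C.incl_mem y) :
    C.incl i x * C.incl j y ∈ C.deg k))
    (fun _ _ _ => Subtype.ext (add_mul _ _ _)) (fun _ _ _ => Subtype.ext (smul_mul_assoc _ _ _))
    (fun _ _ _ => Subtype.ext (mul_add _ _ _)) (fun _ _ _ => Subtype.ext (mul_smul_comm _ _ _)))

theorem incl_wedge {i j k : ℕ} (h : i + j = k) (z : C.Form i ⊗[ℂ] C.Form j) :
    C.incl k (C.wedge i j k h z) =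
      LinearMap.mul' ℂ Ω (TensorProduct.map (C.incl i) (C.incl j) z) := by
  induction z with
  | zero => simp
  | add x y hx hy => simp only [map_add, hx, hy]
  | tmul x y => rfl

theorem coact_wedge {i j k : ℕ} (h : i + j = k) (z : C.Form i ⊗[ℂ] C.Form j) :
    coact (C := A) (C.wedge i j k h z) =
      TensorProduct.map (LinearMap.mul' ℂ A) (C.wedge i j k h) (coact (C := A ⊗[ℂ] A) z) := by
  induction z with
  | zero => simp
  | add x y hx hy => simp only [map_add, hx, hy]
  | tmul x y =>
    apply C.lTensor_incl_injective k
    rw [lTensor_incl_coact, incl_wedge]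
    simp only [TensorProduct.map_tmul, LinearMap.mul'_apply,
      ComoduleAlgebra.coact_mul]
    rw [← lTensor_incl_coact, ← lTensor_incl_coact]
    change _ = LinearMap.lTensor A (C.incl k) (TensorProduct.map _ _
      (TensorProduct.tensorTensorTensorComm ℂ A (C.Form i) A (C.Form j)
        (coact (C := A) x ⊗ₜ[ℂ] coact (C := A) y)))
    generalize coact (C := A) x = s
    generalize coact (C := A) y = t
    induction s with
    | zero => simp
    | add s s' hs hs' => simp only [map_add, TensorProduct.add_tmul, add_mul, hs, hs']
    | tmul a u =>
      induction t with
      | zero => simp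
      | add t t' ht ht' => simp only [map_add, TensorProduct.tmul_add, mul_add, ht, ht']
      | tmul b v => simp [incl_wedge]

/-- The map `(ω ⊗ b) ⊗ η ↦ ωb ⊗ η`. -/
def mulMid : (C.Form 1 ⊗[ℂ] C.Form 0) ⊗[ℂ] C.Form 1 →ₗ[ℂ] C.Form 1 ⊗[ℂ] C.Form 1 :=
  (C.wedge 1 0 1 rfl).rTensor (C.Form 1)

/-- The map `ω ⊗ (b ⊗ η) ↦ ω ⊗ bη`. -/
def midMul : C.Form 1 ⊗[ℂ] (C.Form 0 ⊗[ℂ] C.Form 1) →ₗ[ℂ] C.Form 1 ⊗[ℂ] C.Form 1 :=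
  (C.wedge 0 1 1 rfl).lTensor (C.Form 1)

/-- The span of the elements `ωb ⊗ η - ω ⊗ bη` with `ω, η ∈ Ω¹` and `b ∈ B`. -/
def balance : Submodule ℂ (C.Form 1 ⊗[ℂ] C.Form 1) :=
  LinearMap.range (C.mulMid -
    C.midMul ∘ₗ (TensorProduct.assoc ℂ (C.Form 1) (C.Form 0) (C.Form 1)).toLinearMap)

/-- The tensor product `Ω¹ ⊗_B Ω¹`. -/
abbrev FormTensor : Type _ := (C.Form 1 ⊗[ℂ] C.Form 1) ⧸ C.balance

/-- The class of `ω ⊗ η` in `Ω¹ ⊗_B Ω¹`. -/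
def tmul (ω η : C.Form 1) : C.FormTensor := C.balance.mkQ (ω ⊗ₜ[ℂ] η)

theorem mkQ_mulMid (w : (C.Form 1 ⊗[ℂ] C.Form 0) ⊗[ℂ] C.Form 1) :
    C.balance.mkQ (C.mulMid w) =
      C.balance.mkQ (C.midMul (TensorProduct.assoc ℂ (C.Form 1) (C.Form 0) (C.Form 1) w)) :=
  (Submodule.Quotient.eq _).2 ⟨w, rfl⟩

/-- Linear maps on `Ω¹ ⊗ Ω¹` that are balanced over `B` descend to `Ω¹ ⊗_B Ω¹`. -/
theorem balance_le_ker {N : Type*} [AddCommGroup N] [Module ℂ N]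
    (f : C.Form 1 ⊗[ℂ] C.Form 1 →ₗ[ℂ] N)
    (h : ∀ w, f (C.mulMid w) =
      f (C.midMul (TensorProduct.assoc ℂ (C.Form 1) (C.Form 0) (C.Form 1) w))) :
    C.balance ≤ LinearMap.ker f := by
  rintro _ ⟨w, rfl⟩
  rw [LinearMap.mem_ker, LinearMap.sub_apply, map_sub, h]
  exact sub_self _

theorem coact_mulMid (w : (C.Form 1 ⊗[ℂ] C.Form 0) ⊗[ℂ] C.Form 1) :
    coact (C := A ⊗[ℂ] A) (C.mulMid w) =
      TensorProduct.map ((LinearMap.mul' ℂ A).rTensor A) C.mulMid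
        (coact (C := (A ⊗[ℂ] A) ⊗[ℂ] A) w) :=
  coact_rTensor _ _ (C.coact_wedge _) w

theorem coact_midMul (w : C.Form 1 ⊗[ℂ] (C.Form 0 ⊗[ℂ] C.Form 1)) :
    coact (C := A ⊗[ℂ] A) (C.midMul w) =
      TensorProduct.map ((LinearMap.mul' ℂ A).lTensor A) C.midMul
        (coact (C := A ⊗[ℂ] (A ⊗[ℂ] A)) w) :=
  coact_lTensor _ _ (C.coact_wedge _) w

/-- The coaction `ω ⊗ η ↦ ω₍₋₁₎η₍₋₁₎ ⊗ (ω₍₀₎ ⊗ η₍₀₎)` of `A` on `Ω¹ ⊗_B Ω¹`. -/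
def coactForms : C.FormTensor →ₗ[ℂ] A ⊗[ℂ] C.FormTensor :=
  C.balance.liftQ
    (TensorProduct.map (LinearMap.mul' ℂ A) C.balance.mkQ ∘ₗ coact (C := A ⊗[ℂ] A))
    (C.balance_le_ker _ fun w => by
      simp only [LinearMap.comp_apply]
      rw [coact_mulMid, coact_midMul, coact_assoc (C := A)]
      hopf_tensor_induction coact (C := (A ⊗[ℂ] A) ⊗[ℂ] A) w with c v
      simp only [TensorProduct.map_tmul, LinearEquiv.coe_coe, mkQ_mulMid]
      congr 1
      hopf_tensor_induction c with c₁ c₂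
      hopf_tensor_induction c₁ with c₃ c₄
      simp [mul_assoc])

/-- The left multiplication by `b ∈ B` on `Ω¹ ⊗_B Ω¹`. -/
def leftMul (b : C.Form 0) : C.FormTensor →ₗ[ℂ] C.FormTensor :=
  C.balance.liftQ
    (C.balance.mkQ ∘ₗ
      (C.wedge 0 1 1 rfl ∘ₗ TensorProduct.mk ℂ (C.Form 0) (C.Form 1) b).rTensor (C.Form 1))
    (C.balance_le_ker _ fun w => by
      simp only [LinearMap.comp_apply]
      induction w with
      | zero => simp
      | add x y hx hy => simp only [map_add, hx, hy]
      | tmul u η =>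
        induction u with
        | zero => simp
        | add x y hx hy => simp only [map_add, TensorProduct.add_tmul, hx, hy]
        | tmul ω c =>
          have h := C.mkQ_mulMid ((C.wedge 0 1 1 rfl (b ⊗ₜ[ℂ] ω) ⊗ₜ[ℂ] c) ⊗ₜ[ℂ] η)
          refine Eq.trans ?_ h
          have h' : C.wedge 0 1 1 rfl (b ⊗ₜ[ℂ] C.wedge 1 0 1 rfl (ω ⊗ₜ[ℂ] c)) =
              C.wedge 1 0 1 rfl (C.wedge 0 1 1 rfl (b ⊗ₜ[ℂ] ω) ⊗ₜ[ℂ] c) :=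
            C.incl_injective 1 (mul_assoc (C.incl 0 b) (C.incl 1 ω) (C.incl 0 c)).symm
          exact congr(C.balance.mkQ ($h' ⊗ₜ[ℂ] η)))

/-- The map `coev_g : B → Ω¹ ⊗_B Ω¹`, `b ↦ bg`. -/
def coev (g : C.FormTensor) : C.Form 0 →ₗ[ℂ] C.FormTensor where
  toFun b := C.leftMul b g
  map_add' b c := by
    induction g using Submodule.Quotient.induction_on with | H z => ?_
    simp only [leftMul, Submodule.liftQ_apply, map_add, LinearMap.comp_add, LinearMap.rTensor_add,
      LinearMap.add_apply]
  map_smul' r b := by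
    induction g using Submodule.Quotient.induction_on with | H z => ?_
    simp only [leftMul, Submodule.liftQ_apply, map_smul, LinearMap.comp_smul,
      LinearMap.rTensor_smul, LinearMap.smul_apply, RingHom.id_apply]

end CovariantCalculus

namespace CovariantCalculus
variable {A Ω : Type*} [Ring A] [Bialgebra ℂ A] [Ring Ω] [Algebra ℂ Ω] [ComoduleAlgebra A Ω]
  (C : CovariantCalculus A Ω)

/-- The map `(ω, ·) ⊗ id : η ⊗ ζ ↦ (ω, η)ζ`. -/
def contractLeft (p : C.FormTensor →ₗ[ℂ] C.Form 0) (ω : C.Form 1) :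
    C.Form 1 ⊗[ℂ] C.Form 1 →ₗ[ℂ] C.Form 1 :=
  C.wedge 0 1 1 rfl ∘ₗ
    (p ∘ₗ C.balance.mkQ ∘ₗ TensorProduct.mk ℂ (C.Form 1) (C.Form 1) ω).rTensor (C.Form 1)

/-- The map `id ⊗ (·, ω) : η ⊗ ζ ↦ η(ζ, ω)`. -/
def contractRight (p : C.FormTensor →ₗ[ℂ] C.Form 0) (ω : C.Form 1) :
    C.Form 1 ⊗[ℂ] C.Form 1 →ₗ[ℂ] C.Form 1 :=
  C.wedge 1 0 1 rfl ∘ₗ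
    (p ∘ₗ C.balance.mkQ ∘ₗ (TensorProduct.mk ℂ (C.Form 1) (C.Form 1)).flip ω).lTensor (C.Form 1)

/-- A metric `(g, ( , ))` on `Ω¹`: the map `( , ) : Ω¹ ⊗_B Ω¹ → B` is `B`-bilinear, and
`((ω, ·) ⊗ id) g = ω = (id ⊗ (·, ω)) g` for every one-form `ω`. The contractions are evaluated on
any representative of `g` in `Ω¹ ⊗ Ω¹`. -/
structure IsMetric (g : C.FormTensor) (p : C.FormTensor →ₗ[ℂ] C.Form 0) : Prop where
  left_linear : ∀ (b : C.Form 0) (ω η : C.Form 1),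
    p (C.tmul (C.wedge 0 1 1 rfl (b ⊗ₜ[ℂ] ω)) η) = C.wedge 0 0 0 rfl (b ⊗ₜ[ℂ] p (C.tmul ω η))
  right_linear : ∀ (b : C.Form 0) (ω η : C.Form 1),
    p (C.tmul ω (C.wedge 1 0 1 rfl (η ⊗ₜ[ℂ] b))) = C.wedge 0 0 0 rfl (p (C.tmul ω η) ⊗ₜ[ℂ] b)
  contract_left : ∀ (t : C.Form 1 ⊗[ℂ] C.Form 1), C.balance.mkQ t = g →
    ∀ ω, C.contractLeft p ω t = ω
  contract_right : ∀ (t : C.Form 1 ⊗[ℂ] C.Form 1), C.balance.mkQ t = g →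
    ∀ ω, C.contractRight p ω t = ω

/-- A metric is `A`-covariant if `( , )` and `coev_g` are morphisms of `A`-comodules. -/
structure IsCovariantMetric (g : C.FormTensor) (p : C.FormTensor →ₗ[ℂ] C.Form 0) : Prop
    extends C.IsMetric g p where
  pairing_covariant : ∀ t, coact (C := A) (p t) = p.lTensor A (C.coactForms t)
  coev_covariant : ∀ b, C.coactForms (C.coev g b) = (C.coev g).lTensor A (coact (C := A) b)

/-- `Ω` with the operation `*` is a `*`-differential calculus: `*` is a conjugate linear involution
that preserves the degree, with `(dω)* = d(ω*)` and `(ω ∧ ν)* = (-1)^{kl} ν* ∧ ω*`, and the coaction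
`δ` satisfies `δ(ω*) = (* ⊗ *) δ(ω)`. -/
structure IsStarCalculus [Star A] [Star Ω] : Prop where
  star_add : ∀ x y : Ω, star (x + y) = star x + star y
  star_smul : ∀ (r : ℂ) (x : Ω), star (r • x) = (starRingEnd ℂ) r • star x
  star_star : ∀ x : Ω, star (star x) = x
  star_mem : ∀ {k : ℕ} {x : Ω}, x ∈ C.deg k → star x ∈ C.deg k
  star_d : ∀ x, star (C.d x) = C.d (star x)
  star_mul : ∀ {k l : ℕ} {x y : Ω}, x ∈ C.deg k → y ∈ C.deg l →
    star (x * y) = (-1 : ℂ) ^ (k * l) • (star y * star x)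
  coact_star : ∀ (x : Ω) (n : ℕ) (a : Fin n → A) (y : Fin n → Ω),
    coact (C := A) x = ∑ i, a i ⊗ₜ[ℂ] y i →
      coact (C := A) (star x) = ∑ i, star (a i) ⊗ₜ[ℂ] star (y i)

/-- An element `g = ∑ ωᵢ ⊗ ηᵢ` of `Ω¹ ⊗_B Ω¹` is real if `g = ∑ ηᵢ* ⊗ ωᵢ*`. This is required for
every way of writing `g` as such a sum, and the elements `ηᵢ*` and `ωᵢ*` are one-forms. -/
def IsReal [Star Ω] (g : C.FormTensor) : Prop :=
  ∀ (n : ℕ) (ω η : Fin n → C.Form 1), g = ∑ i, C.tmul (ω i) (η i) →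
    ∃ ω' η' : Fin n → C.Form 1, (∀ i, C.incl 1 (ω' i) = star (C.incl 1 (ω i))) ∧
      (∀ i, C.incl 1 (η' i) = star (C.incl 1 (η i))) ∧ g = ∑ i, C.tmul (η' i) (ω' i)

section Twist
variable (γ : TwoCocycle A)

/-- The identity map `Ωᵏ → Ωᵏ_γ`. -/
def toTwist (k : ℕ) : C.Form k ≃ₗ[ℂ] (C.twist γ).Form k := LinearEquiv.refl ℂ (C.Form k)

/-- The identity map `Ωⁱ ⊗ Ωʲ → Ωⁱ_γ ⊗ Ωʲ_γ`. -/
def toTwist₂ (i j : ℕ) : C.Form i ⊗[ℂ] C.Form j ≃ₗ[ℂ] (C.twist γ).Form i ⊗[ℂ] (C.twist γ).Form j :=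
  TensorProduct.congr (C.toTwist γ i) (C.toTwist γ j)

theorem act_map_incl {i j : ℕ} (φ : Conv (A ⊗[ℂ] A)) (z : C.Form i ⊗[ℂ] C.Form j) :
    act φ (TensorProduct.map (C.incl i) (C.incl j) z) =
      TensorProduct.map (C.incl i) (C.incl j) (act φ z) :=
  act_nat (C := A ⊗[ℂ] A) LinearMap.id (TensorProduct.map (C.incl i) (C.incl j)) (fun m => by
    induction m with
    | zero => simp
    | add a b ha hb => simp only [map_add, ha, hb]
    | tmul u w =>
      change TensorProduct.tensorTensorTensorComm ℂ A Ω A Ω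
        (coact (C := A) (C.incl i u) ⊗ₜ[ℂ] coact (C := A) (C.incl j w)) =
        TensorProduct.map LinearMap.id (TensorProduct.map (C.incl i) (C.incl j))
          (TensorProduct.tensorTensorTensorComm ℂ A (C.Form i) A (C.Form j)
            (coact (C := A) u ⊗ₜ[ℂ] coact (C := A) w))
      rw [← lTensor_incl_coact, ← lTensor_incl_coact]
      hopf_tensor_induction coact (C := A) u with a u'
      hopf_tensor_induction coact (C := A) w with b w'
      simp) φ z

/-- The product of the deformed calculus. -/
theorem twist_wedge {i j k : ℕ} (h : i + j = k) (z : C.Form i ⊗[ℂ] C.Form j) :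
    (C.twist γ).wedge i j k h (C.toTwist₂ γ i j z) =
      C.toTwist γ k (C.wedge i j k h (act γ.fn z)) := by
  induction z with
  | zero => simp
  | add x y hx hy => simp only [map_add, hx, hy]
  | tmul x y =>
    have h1 := C.incl_wedge h (act γ.fn (x ⊗ₜ[ℂ] y))
    rw [← act_map_incl, TensorProduct.map_tmul] at h1
    exact C.incl_injective k h1.symm

/-- The identity map `(Ω¹ ⊗ B) ⊗ Ω¹ → (Ω¹_γ ⊗ B_γ) ⊗ Ω¹_γ`. -/
def toTwist₃ : (C.Form 1 ⊗[ℂ] C.Form 0) ⊗[ℂ] C.Form 1 ≃ₗ[ℂ]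
    ((C.twist γ).Form 1 ⊗[ℂ] (C.twist γ).Form 0) ⊗[ℂ] (C.twist γ).Form 1 :=
  TensorProduct.congr (C.toTwist₂ γ 1 0) (C.toTwist γ 1)

theorem twist_mulMid (w : (C.Form 1 ⊗[ℂ] C.Form 0) ⊗[ℂ] C.Form 1) :
    (C.twist γ).mulMid (C.toTwist₃ γ w) =
      C.toTwist₂ γ 1 1 (C.mulMid (act (tens γ.fn (1 : Conv A)) w)) := by
  induction w with
  | zero => simp
  | add x y hx hy => simp only [map_add, hx, hy]
  | tmul u η =>
    rw [act_tens, act_one, toTwist₃, TensorProduct.congr_tmul, mulMid, LinearMap.rTensor_tmul,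
      twist_wedge]
    rfl

theorem twist_midMul (w : (C.Form 1 ⊗[ℂ] C.Form 0) ⊗[ℂ] C.Form 1) :
    (C.twist γ).midMul (TensorProduct.assoc ℂ _ _ _ (C.toTwist₃ γ w)) =
      C.toTwist₂ γ 1 1 (C.midMul (act (tens (1 : Conv A) γ.fn) (TensorProduct.assoc ℂ _ _ _ w))) := by
  induction w with
  | zero => simp
  | add x y hx hy => simp only [map_add, hx, hy]
  | tmul u η =>
    induction u with
    | zero => simp
    | add x y hx hy => simp only [map_add, TensorProduct.add_tmul, hx, hy]
    | tmul ω b =>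
      rw [TensorProduct.assoc_tmul, act_tens, act_one]
      have h := C.twist_wedge γ (zero_add 1) (b ⊗ₜ[ℂ] η)
      exact congrArg (fun z => C.toTwist γ 1 ω ⊗ₜ[ℂ] z) h

open Bialgebra in
theorem act_mulMid (φ : Conv (A ⊗[ℂ] A)) (w : (C.Form 1 ⊗[ℂ] C.Form 0) ⊗[ℂ] C.Form 1) :
    act φ (C.mulMid w) = C.mulMid (act (pull
      (Coalgebra.TensorProduct.map (mulCoalgHom ℂ A) (CoalgHom.id ℂ A)) φ) w) :=
  act_nat (C := (A ⊗[ℂ] A) ⊗[ℂ] A) (D := A ⊗[ℂ] A)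
    (Coalgebra.TensorProduct.map (mulCoalgHom ℂ A) (CoalgHom.id ℂ A)).toLinearMap C.mulMid
    (fun w => C.coact_mulMid w) φ w

open Bialgebra in
theorem act_midMul (φ : Conv (A ⊗[ℂ] A)) (w : C.Form 1 ⊗[ℂ] (C.Form 0 ⊗[ℂ] C.Form 1)) :
    act φ (C.midMul w) = C.midMul (act (pull
      (Coalgebra.TensorProduct.map (CoalgHom.id ℂ A) (mulCoalgHom ℂ A)) φ) w) :=
  act_nat (C := A ⊗[ℂ] (A ⊗[ℂ] A)) (D := A ⊗[ℂ] A)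
    (Coalgebra.TensorProduct.map (CoalgHom.id ℂ A) (mulCoalgHom ℂ A)).toLinearMap C.midMul
    (fun w => C.coact_midMul w) φ w

theorem act_assoc (φ : Conv (A ⊗[ℂ] (A ⊗[ℂ] A)))
    (w : (C.Form 1 ⊗[ℂ] C.Form 0) ⊗[ℂ] C.Form 1) :
    act φ (TensorProduct.assoc ℂ (C.Form 1) (C.Form 0) (C.Form 1) w) =
      TensorProduct.assoc ℂ (C.Form 1) (C.Form 0) (C.Form 1) (act (pull
        (Coalgebra.TensorProduct.assoc ℂ ℂ A A A :
          (A ⊗[ℂ] A) ⊗[ℂ] A →ₗc[ℂ] A ⊗[ℂ] (A ⊗[ℂ] A)) φ) w) :=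
  act_nat (C := (A ⊗[ℂ] A) ⊗[ℂ] A) (D := A ⊗[ℂ] (A ⊗[ℂ] A))
    (Coalgebra.TensorProduct.assoc ℂ ℂ A A A :
      (A ⊗[ℂ] A) ⊗[ℂ] A →ₗc[ℂ] A ⊗[ℂ] (A ⊗[ℂ] A)).toLinearMap
    (TensorProduct.assoc ℂ (C.Form 1) (C.Form 0) (C.Form 1)).toLinearMap
    (fun w => coact_assoc w) φ w

theorem mulMid_midMul_fn (w : (C.Form 1 ⊗[ℂ] C.Form 0) ⊗[ℂ] C.Form 1) :
    C.balance.mkQ (act γ.fn (C.mulMid (act (tens γ.fn (1 : Conv A)) w))) =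
      C.balance.mkQ (act γ.fn (C.midMul (act (tens (1 : Conv A) γ.fn)
        (TensorProduct.assoc ℂ _ _ _ w)))) := by
  rw [act_mulMid, act_midMul, ← act_mul, ← act_mul, act_assoc, ← γ.conv_cocycle, mkQ_mulMid]

/-- The map `φ : Ω¹_γ ⊗_{B_γ} Ω¹_γ → Ω¹ ⊗_B Ω¹`,
`ω ⊗ η ↦ γ(ω₍₋₁₎ ⊗ η₍₋₁₎) ω₍₀₎ ⊗ η₍₀₎`. -/
def untwistForms : (C.twist γ).FormTensor →ₗ[ℂ] C.FormTensor :=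
  (C.twist γ).balance.liftQ
    (C.balance.mkQ ∘ₗ act γ.fn ∘ₗ (C.toTwist₂ γ 1 1).symm.toLinearMap)
    ((C.twist γ).balance_le_ker _ fun w => by
      obtain ⟨w, rfl⟩ := (C.toTwist₃ γ).surjective w
      rw [twist_mulMid, twist_midMul]
      simp only [LinearMap.comp_apply, LinearEquiv.coe_coe, LinearEquiv.symm_apply_apply]
      exact C.mulMid_midMul_fn γ w)

theorem mulMid_midMul_inv (w : (C.Form 1 ⊗[ℂ] C.Form 0) ⊗[ℂ] C.Form 1) :
    (C.twist γ).balance.mkQ (C.toTwist₂ γ 1 1 (act γ.inv (C.mulMid w))) =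
      (C.twist γ).balance.mkQ (C.toTwist₂ γ 1 1 (act γ.inv (C.midMul
        (TensorProduct.assoc ℂ _ _ _ w)))) := by
  have h := (C.twist γ).mkQ_mulMid (C.toTwist₃ γ (act (pull (Coalgebra.TensorProduct.map
    (Bialgebra.mulCoalgHom ℂ A) (CoalgHom.id ℂ A)) γ.inv * tens γ.inv (1 : Conv A)) w))
  rw [twist_mulMid, twist_midMul, ← act_mul, mul_assoc, tens_mul, γ.inv_fn, one_mul, tens_one,
    mul_one, γ.conv_cocycle_inv, ← act_assoc, ← act_mul, mul_assoc, tens_mul, γ.inv_fn, one_mul,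
    tens_one, mul_one] at h
  rw [act_mulMid, act_midMul]
  exact h

/-- The inverse map `φ⁻¹ : Ω¹ ⊗_B Ω¹ → Ω¹_γ ⊗_{B_γ} Ω¹_γ`,
`ω ⊗ η ↦ γ⁻¹(ω₍₋₁₎ ⊗ η₍₋₁₎) ω₍₀₎ ⊗ η₍₀₎`. -/
def twistForms : C.FormTensor →ₗ[ℂ] (C.twist γ).FormTensor :=
  C.balance.liftQ
    ((C.twist γ).balance.mkQ ∘ₗ (C.toTwist₂ γ 1 1).toLinearMap ∘ₗ act γ.inv)
    (C.balance_le_ker _ fun w => C.mulMid_midMul_inv γ w)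

/-- The deformed metric tensor `g_γ = φ⁻¹(g)`. -/
def twistTensor (g : C.FormTensor) : (C.twist γ).FormTensor := C.twistForms γ g

/-- The deformed pairing `( , )_γ = ( , ) ∘ φ`. -/
def twistPairing (p : C.FormTensor →ₗ[ℂ] C.Form 0) :
    (C.twist γ).FormTensor →ₗ[ℂ] (C.twist γ).Form 0 :=
  (C.toTwist γ 0).toLinearMap ∘ₗ p ∘ₗ C.untwistForms γ

end Twist
end CovariantCalculus

section Star
variable {A : Type*} [Ring A] [HopfAlgebra ℂ A] [StarRing A] [StarModule ℂ A]

variable (A) in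
/-- A Hopf `*`-algebra: a Hopf algebra which is a `*`-algebra, such that the coproduct is a
`*`-homomorphism. -/
class HopfStarAlgebra : Prop where
  comul_star : ∀ a : A, comul (R := ℂ) (star a) = star (comul (R := ℂ) a)

variable (A) in
/-- The inverse `S⁻¹(a) = S(a*)*` of the antipode of a Hopf `*`-algebra. -/
def antipodeInv : A →ₗ[ℂ] A where
  toFun a := star (HopfAlgebra.antipode ℂ (star a))
  map_add' a b := by simp
  map_smul' r a := by simp

namespace TwoCocycle
variable (γ : TwoCocycle A)

/-- A `2`-cocycle is unitary if the complex conjugate of `γ(a ⊗ b)` is `γ⁻¹(S(a)* ⊗ S(b)*)`. -/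
def IsUnitary : Prop := ∀ a b : A, (starRingEnd ℂ) (γ.fn.ofConv (a ⊗ₜ[ℂ] b)) =
  γ.inv.ofConv (star (HopfAlgebra.antipode ℂ a) ⊗ₜ[ℂ] star (HopfAlgebra.antipode ℂ b))

/-- The functional `V(k) = γ(S⁻¹(k₍₂₎) ⊗ k₍₁₎)`. -/
def V : Conv A := toConv (γ.fn.ofConv ∘ₗ (antipodeInv A).rTensor A ∘ₗ
  (TensorProduct.comm ℂ A A).toLinearMap ∘ₗ comul)

/-- The functional `V⁻¹(k) = γ⁻¹(k₍₂₎ ⊗ S⁻¹(k₍₁₎))`. -/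
def Vinv : Conv A := toConv (γ.inv.ofConv ∘ₗ (antipodeInv A).lTensor A ∘ₗ
  (TensorProduct.comm ℂ A A).toLinearMap ∘ₗ comul)

/-- The operation `h ↦ V⁻¹(h₍₁₎*) h₍₂₎* V(h₍₃₎*)` on `A_γ`; since the coproduct is a `*`-homomorphism,
this is `V⁻¹(k₍₁₎) k₍₂₎ V(k₍₃₎)` for `k = h*`. -/
instance : Star (HopfTwist γ) where
  star h := HopfTwist.of γ (convR γ.V (convL γ.Vinv (star ((HopfTwist.of γ).symm h))))

/-- The identity map `X → X_γ`. -/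
def ofDeform (X : Type*) [AddCommGroup X] [Module ℂ X] : X ≃ₗ[ℂ] Deform γ X := LinearEquiv.refl ℂ X

/-- The operation `x ↦ V⁻¹(x₍₋₁₎*) x₍₀₎*` on the deformation of a comodule whose `*`-operation satisfies
`δ(x*) = (* ⊗ *) δ(x)`, so that the right hand side is `V⁻¹((x*)₍₋₁₎) (x*)₍₀₎`. -/
instance {X : Type*} [AddCommGroup X] [Module ℂ X] [LeftComodule A X] [Star X] :
    Star (Deform γ X) where
  star x := γ.ofDeform X (act γ.Vinv (star ((γ.ofDeform X).symm x)))

end TwoCocycle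
end Star

end

/-!
The deformed structures are obtained by letting functionals on `A` and on `A ⊗ A` act on comodules
(`act`), and `act` turns the convolution product into composition. Every assertion thus becomes an
identity between functionals.

*The `*`-structure.* For the unitary cocycle `γ`, conjugating the functional `V` gives `V⁻¹`
(`TwoCocycle.IsUnitary.conjStar_V`), and conjugating `γ` with its two arguments exchanged gives the
functional `γ⁻¹(S⁻¹(b) ⊗ S⁻¹(a))` (`TwoCocycle.IsUnitary.conjFlip_flipAntipode`). Therefore `*_γ`
is an involution compatible with the coaction of `A_γ` because `V * V⁻¹ = 1`
(`TwoCocycle.V_mul_Vinv`), and it is graded antimultiplicative because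
`γ⁻¹(S⁻¹(b₍₁₎) ⊗ S⁻¹(a₍₁₎)) V⁻¹(a₍₂₎b₍₂₎) = V⁻¹(a₍₁₎) V⁻¹(b₍₁₎) γ(a₍₂₎ ⊗ b₍₂₎)`
(`TwoCocycle.flipAntipode_mul_pull_Vinv`). Both identities follow from the cocycle condition by
cancelling `a₍₂₎S⁻¹(a₍₁₎)` and `S⁻¹(a₍₂₎)a₍₁₎`. These computations are carried out for matrix
coefficients `cᵢⱼ` of finite dimensional comodules, where iterated coproducts are matrix products;
such coefficients span every coalgebra (`exists_isCoefficientMatrix`).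

*The metric.* By the cocycle condition, a law `(m · n) · p = m · (n · p)` between covariant
operations survives the precomposition of all operations with `γ` (`TwoCocycle.deform_assoc`).
Bilinearity of the pairing, the two contraction identities and the formula for `coev` are laws of
this form. The remaining factor `γ` disappears because `coev` is covariant, so that `g` is
coinvariant (`CovariantCalculus.IsCovariantMetric.coact_tensor`). The map `φ` intertwines the
coactions, hence the deformed maps are covariant.

*Reality.* By the identity for `V⁻¹` on products, `φ` carries the `*_γ`-conjugate of `g_γ` to `V⁻¹`
acting on the conjugate of `g`, which is `g`, and `V⁻¹` acts trivially on the coinvariant element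
`g`.
-/

noncomputable section

open scoped TensorProduct
open TensorProduct WithConv Coalgebra
open LeftComodule

/-! ### Coefficient matrices in coalgebras -/

section MatrixCoefficients
variable {C M : Type*} [AddCommGroup C] [Module ℂ C] [Coalgebra ℂ C]
  [AddCommGroup M] [Module ℂ M]

/-- A square matrix of elements of a coalgebra with `Δ cᵢⱼ = ∑ₚ cᵢₚ ⊗ cₚⱼ` and `ε(cᵢⱼ) = δᵢⱼ`, that
is, the matrix of coefficients of a finite dimensional comodule with a chosen basis. -/
structure IsCoefficientMatrix {ι : Type*} [Fintype ι] [DecidableEq ι] (c : ι → ι → C) : Prop where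
  comul_eq : ∀ i j, comul (R := ℂ) (c i j) = ∑ p, c i p ⊗ₜ[ℂ] c p j
  counit_eq : ∀ i j, counit (R := ℂ) (c i j) = if i = j then 1 else 0

theorem exists_isCoefficientMatrix_of_basis [LeftComodule C M] {ι : Type*} [Fintype ι]
    [DecidableEq ι] (w : Module.Basis ι ℂ M) :
    ∃ c : ι → ι → C, IsCoefficientMatrix c ∧ ∀ j, coact (C := C) (w j) = ∑ i, c j i ⊗ₜ[ℂ] w i := by
  let c : ι → ι → C := fun j i => TensorProduct.rid ℂ C ((w.coord i).lTensor C (coact (w j)))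
  have hw : ∀ t : C ⊗[ℂ] M,
      t = ∑ i, (TensorProduct.rid ℂ C ((w.coord i).lTensor C t)) ⊗ₜ[ℂ] w i := by
    intro t
    induction t with
    | zero => simp
    | add x y hx hy =>
      conv_lhs => rw [hx, hy]
      simp only [map_add, TensorProduct.add_tmul, Finset.sum_add_distrib]
    | tmul a m =>
      conv_lhs => rw [← w.sum_repr m, TensorProduct.tmul_sum]
      simp [TensorProduct.smul_tmul]
  have hc : ∀ j, coact (C := C) (w j) = ∑ i, c j i ⊗ₜ[ℂ] w i := fun j => hw _
  refine ⟨c, ⟨fun i j => ?_, fun i j => ?_⟩, hc⟩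
  · have h := congr(TensorProduct.rid ℂ _ ((w.coord j).lTensor (C ⊗[ℂ] C)
      ((TensorProduct.assoc ℂ C C M).symm $(LeftComodule.coassoc (C := C) (w i)))))
    rw [LinearEquiv.symm_apply_apply, hc] at h
    simpa [hc, map_sum, TensorProduct.tmul_sum, Finsupp.single_apply, ite_smul] using h
  · have h := congr(w.coord j $(LeftComodule.counit_coact (C := C) (w i)))
    simpa [hc, map_sum, Finsupp.single_apply] using h

/-- The fundamental theorem of coalgebras: every element is a linear combination of matrix
coefficients of a finite dimensional comodule. -/
theorem exists_isCoefficientMatrix (a : C) :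
    ∃ (n : ℕ) (c : Fin n → Fin n → C), IsCoefficientMatrix c ∧
      a ∈ Submodule.span ℂ (Set.range fun x : Fin n × Fin n => c x.1 x.2) := by
  classical
  let _ := selfComodule C
  let f : (C →ₗ[ℂ] ℂ) →ₗ[ℂ] C :=
    { toFun := fun φ => convL (toConv φ) a
      map_add' := fun φ ψ => by simp [convL, LinearMap.rTensor_add]
      map_smul' := fun r φ => by simp [convL, LinearMap.rTensor_smul] }
  let W : Submodule ℂ C := LinearMap.range f
  -- the right legs of `Δ a`, with respect to a basis of `C` for the left legs, lie in `W`
  have hmem : comul (R := ℂ) a ∈ LinearMap.range (W.subtype.lTensor C) := by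
    let b := Module.Basis.ofVectorSpace ℂ C
    have h := (TensorProduct.equivFinsuppOfBasisLeft (N := C) b).symm_apply_apply
      (comul (R := ℂ) a)
    rw [TensorProduct.equivFinsuppOfBasisLeft_symm_apply] at h
    rw [← h]
    refine Submodule.sum_mem _ fun i _ => ?_
    exact ⟨b i ⊗ₜ[ℂ] ⟨TensorProduct.equivFinsuppOfBasisLeft (N := C) b (comul a) i, b.coord i,
      (TensorProduct.equivFinsuppOfBasisLeft_apply b _ i).symm⟩, rfl⟩
  have hW : IsSubcomodule C W := by
    rintro _ ⟨φ, rfl⟩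
    change comul (R := ℂ) (convL (toConv φ) a) ∈ _
    rw [comul_convL]
    obtain ⟨t, ht⟩ := hmem
    refine ⟨(convL (toConv φ)).rTensor W t, ?_⟩
    rw [← ht, ← LinearMap.comp_apply, ← LinearMap.comp_apply, LinearMap.lTensor_comp_rTensor,
      LinearMap.rTensor_comp_lTensor]
  have ha : a ∈ W := ⟨counit, by
    change convL (1 : Conv C) a = a
    rw [convL_one]; rfl⟩
  have : FiniteDimensional ℂ W := by
    obtain ⟨s, hs⟩ := TensorProduct.exists_finset (comul (R := ℂ) a)
    refine Submodule.finiteDimensional_of_le (S₂ := Submodule.span ℂ (s.image Prod.snd : Set C)) ?_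
    rintro _ ⟨φ, rfl⟩
    change convL (toConv φ) a ∈ _
    simp only [convL, LinearMap.comp_apply, hs, map_sum]
    refine Submodule.sum_mem _ fun i hi => ?_
    refine Submodule.smul_mem _ _ (Submodule.subset_span ?_)
    simpa using ⟨i.1, hi⟩
  let _ := subComodule W hW
  obtain ⟨c, hc, hw⟩ := exists_isCoefficientMatrix_of_basis (C := C) (Module.finBasis ℂ W)
  refine ⟨_, c, hc, ?_⟩
  have key : ∀ w : W, (w : C) ∈ Submodule.span ℂ (Set.range fun x : _ × _ => c x.1 x.2) := by
    intro w
    rw [← (Module.finBasis ℂ W).sum_repr w, AddSubmonoidClass.coe_finsetSum]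
    refine Submodule.sum_mem _ fun j _ => Submodule.smul_mem _ _ ?_
    have h := lTensor_subCoact W hW (Module.finBasis ℂ W j)
    change W.subtype.lTensor C (coact (C := C) (Module.finBasis ℂ W j)) =
      comul (R := ℂ) (Module.finBasis ℂ W j : C) at h
    have h2 := congr(TensorProduct.rid ℂ C ((counit (R := ℂ)).lTensor C $h))
    rw [Coalgebra.lTensor_counit_comul, hw] at h2
    simp only [map_sum, LinearMap.lTensor_tmul, TensorProduct.rid_tmul, one_smul] at h2
    rw [← h2]
    exact Submodule.sum_mem _ fun i _ =>
      Submodule.smul_mem _ _ (Submodule.subset_span ⟨(j, i), rfl⟩)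
  exact key ⟨a, ha⟩

end MatrixCoefficients

/-! ### Coefficient matrices and the antipode -/

section MatrixCoefficientsHopf

theorem antipodeInv_apply {A : Type*} [Ring A] [HopfAlgebra ℂ A] [StarRing A] [StarModule ℂ A]
    (a : A) : antipodeInv A a = star (HopfAlgebra.antipode ℂ (star a)) := rfl

variable {A : Type*} [Ring A] [HopfAlgebra ℂ A] {ι : Type*} [Fintype ι] [DecidableEq ι]
  {c : ι → ι → A}

namespace IsCoefficientMatrix

theorem sum_mul_antipode (h : IsCoefficientMatrix c) (i j : ι) :
    ∑ p, c i p * HopfAlgebra.antipode ℂ (c p j) = if i = j then 1 else 0 := by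
  have := HopfAlgebra.mul_antipode_lTensor_comul_apply (R := ℂ) (c i j)
  rw [h.comul_eq, h.counit_eq] at this
  simpa [map_sum, apply_ite (algebraMap ℂ A)] using this

theorem sum_antipode_mul (h : IsCoefficientMatrix c) (i j : ι) :
    ∑ p, HopfAlgebra.antipode ℂ (c i p) * c p j = if i = j then 1 else 0 := by
  have := HopfAlgebra.mul_antipode_rTensor_comul_apply (R := ℂ) (c i j)
  rw [h.comul_eq, h.counit_eq] at this
  simpa [map_sum, apply_ite (algebraMap ℂ A)] using this

/-- The antipode is anti-comultiplicative: `Δ(c) = (c ⊗ 1)(1 ⊗ c)` as matrices over `A ⊗ A`, and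
`Δ(S(c))` is the inverse of this matrix. -/
theorem antipode (h : IsCoefficientMatrix c) :
    IsCoefficientMatrix (fun i j => HopfAlgebra.antipode ℂ (c j i)) where
  comul_eq i j := by
    let X : Matrix ι ι (A ⊗[ℂ] A) := .of fun i j => comul (R := ℂ) (HopfAlgebra.antipode ℂ (c i j))
    let Y : Matrix ι ι (A ⊗[ℂ] A) := .of fun i j => comul (R := ℂ) (c i j)
    let Z : Matrix ι ι (A ⊗[ℂ] A) := .of fun i j =>
      ∑ p, HopfAlgebra.antipode ℂ (c p j) ⊗ₜ[ℂ] HopfAlgebra.antipode ℂ (c i p)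
    have h1 : X * Y = 1 := by
      ext i j
      simp only [X, Y, Matrix.mul_apply, Matrix.of_apply, ← Bialgebra.comul_mul, ← map_sum,
        h.sum_antipode_mul, Matrix.one_apply]
      split_ifs <;> simp
    have h2 : Y * Z = 1 := by
      ext i j
      simp only [Y, Z, Matrix.mul_apply, Matrix.of_apply, h.comul_eq, Finset.sum_mul_sum,
        Algebra.TensorProduct.tmul_mul_tmul]
      calc ∑ q, ∑ p, ∑ r, (c i p * HopfAlgebra.antipode ℂ (c r j)) ⊗ₜ[ℂ]
            (c p q * HopfAlgebra.antipode ℂ (c q r))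
          = ∑ p, ∑ r, (c i p * HopfAlgebra.antipode ℂ (c r j)) ⊗ₜ[ℂ]
            ∑ q, c p q * HopfAlgebra.antipode ℂ (c q r) := by
            rw [Finset.sum_comm]
            refine Finset.sum_congr rfl fun p _ => ?_
            rw [Finset.sum_comm]
            simp only [TensorProduct.tmul_sum]
        _ = (∑ p, c i p * HopfAlgebra.antipode ℂ (c p j)) ⊗ₜ[ℂ] 1 := by
            rw [TensorProduct.sum_tmul]
            simp [h.sum_mul_antipode, apply_ite (TensorProduct.tmul ℂ _)]
        _ = (1 : Matrix ι ι (A ⊗[ℂ] A)) i j := by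
            rw [h.sum_mul_antipode, Matrix.one_apply]
            split_ifs <;> simp [Algebra.TensorProduct.one_def]
    have h3 : X = Z := left_inv_eq_right_inv h1 h2
    exact congr($h3 j i)
  counit_eq i j := by simp [h.counit_eq, eq_comm]

variable [StarRing A] [StarModule ℂ A] [HopfStarAlgebra A]

/-- Since `Δ` is a `*`-homomorphism, the matrix of the elements `cᵢⱼ*` is again a coefficient
matrix. -/
theorem star (h : IsCoefficientMatrix c) : IsCoefficientMatrix (fun i j => star (c i j)) where
  comul_eq i j := by
    rw [HopfStarAlgebra.comul_star, h.comul_eq, star_sum]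
    rfl
  counit_eq i j := by
    -- `(ε ⊗ id) Δ = id` for `cᵢⱼ*`; applying `*` and then `ε` gives `ε(cᵢⱼ*) = δᵢⱼ`
    have h1 : ∀ i j, ∑ p, counit (R := ℂ) (Star.star (c i p)) • Star.star (c p j) =
        Star.star (c i j) := by
      intro i j
      have := congr(TensorProduct.lid ℂ A $(Coalgebra.rTensor_counit_comul (R := ℂ)
        (Star.star (c i j))))
      rw [HopfStarAlgebra.comul_star, h.comul_eq, star_sum] at this
      simpa [map_sum] using this
    have h2 := congr(Star.star (counit (R := ℂ) (Star.star $(h1 i j))))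
    simpa [star_sum, h.counit_eq, star_smul, apply_ite Star.star] using h2

/-- The contragredient matrix `(S⁻¹(cⱼᵢ))`. -/
theorem antipodeInv (h : IsCoefficientMatrix c) :
    IsCoefficientMatrix (fun i j => antipodeInv A (c j i)) :=
  h.star.antipode.star

theorem sum_antipodeInv_mul (h : IsCoefficientMatrix c) (i j : ι) :
    ∑ p, _root_.antipodeInv A (c p j) * c i p = if i = j then 1 else 0 := by
  have := congr(Star.star $(h.star.sum_mul_antipode i j))
  simpa [star_sum, apply_ite Star.star, antipodeInv_apply] using this

theorem sum_mul_antipodeInv (h : IsCoefficientMatrix c) (i j : ι) :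
    ∑ p, c p j * _root_.antipodeInv A (c i p) = if i = j then 1 else 0 := by
  have := congr(Star.star $(h.star.sum_antipode_mul i j))
  simpa [star_sum, apply_ite Star.star, antipodeInv_apply] using this

end IsCoefficientMatrix

variable [StarRing A] [StarModule ℂ A]

theorem antipodeInv_one : antipodeInv A 1 = 1 := by
  simp [antipodeInv_apply]

theorem antipodeInv_mul (a b : A) : antipodeInv A (a * b) = antipodeInv A b * antipodeInv A a := by
  simp [antipodeInv_apply, HopfAlgebra.antipode_mul_antidistrib]

theorem linearMap_ext_coefficient {C N : Type*} [AddCommGroup C] [Module ℂ C] [Coalgebra ℂ C]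
    [AddCommGroup N] [Module ℂ N] {f g : C →ₗ[ℂ] N}
    (h : ∀ (n : ℕ) (c : Fin n → Fin n → C), IsCoefficientMatrix c → ∀ i j, f (c i j) = g (c i j)) :
    f = g := by
  ext a
  obtain ⟨n, c, hc, ha⟩ := exists_isCoefficientMatrix a
  exact LinearMap.eqOn_span (fun x hx => by obtain ⟨y, rfl⟩ := hx; exact h n c hc _ _) ha

theorem antipodeInv_antipode [HopfStarAlgebra A] (a : A) :
    antipodeInv A (HopfAlgebra.antipode ℂ a) = a := by
  suffices antipodeInv A ∘ₗ HopfAlgebra.antipode ℂ = LinearMap.id from congr($this a)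
  refine linearMap_ext_coefficient fun n c hc i j => ?_
  -- the transposes of `(S⁻¹(S(cᵢⱼ)))` and of `c` are both inverse to the contragredient matrix
  let X : Matrix (Fin n) (Fin n) A := .of fun j i => antipodeInv A (HopfAlgebra.antipode ℂ (c i j))
  let Y : Matrix (Fin n) (Fin n) A := .of fun i j => antipodeInv A (c j i)
  let Z : Matrix (Fin n) (Fin n) A := .of fun j i => c i j
  have h1 : Y * X = 1 := by
    ext j i
    have := congr(antipodeInv A $(hc.sum_antipode_mul i j))
    simpa [X, Y, Matrix.mul_apply, antipodeInv_mul, Matrix.one_apply, apply_ite (antipodeInv A),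
      antipodeInv_one, eq_comm] using this
  have h2 : Z * Y = 1 := by
    ext j i
    have := hc.sum_mul_antipodeInv i j
    simpa [Y, Z, Matrix.mul_apply, Matrix.one_apply, eq_comm] using this
  exact congr($((left_inv_eq_right_inv h2 h1).symm) j i)

end MatrixCoefficientsHopf

/-! ### The cocycle condition for matrix coefficients -/

section CocycleCoefficients

namespace IsCoefficientMatrix
variable {C D : Type*} [AddCommGroup C] [Module ℂ C] [Coalgebra ℂ C]
  [AddCommGroup D] [Module ℂ D] [Coalgebra ℂ D] {ι κ : Type*} [Fintype ι] [DecidableEq ι]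
  [Fintype κ] [DecidableEq κ] {c : ι → ι → C} {d : κ → κ → D}

theorem conv_apply (h : IsCoefficientMatrix c) (φ ψ : Conv C) (i j : ι) :
    (φ * ψ).ofConv (c i j) = ∑ p, φ.ofConv (c i p) * ψ.ofConv (c p j) := by
  simp [LinearMap.convMul_def, h.comul_eq, map_sum]

theorem tmul (hc : IsCoefficientMatrix c) (hd : IsCoefficientMatrix d) :
    IsCoefficientMatrix (fun x y : ι × κ => c x.1 y.1 ⊗ₜ[ℂ] d x.2 y.2) where
  comul_eq x y := by
    simp only [TensorProduct.comul_tmul, hc.comul_eq, hd.comul_eq, Fintype.sum_prod_type,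
      TensorProduct.sum_tmul, TensorProduct.tmul_sum, map_sum]
    rw [Finset.sum_comm]
    rfl
  counit_eq x y := by
    simp only [TensorProduct.counit_tmul, hc.counit_eq, hd.counit_eq, Prod.ext_iff, ite_and]
    split_ifs <;> simp

theorem map (hc : IsCoefficientMatrix c) (f : C →ₗc[ℂ] D) :
    IsCoefficientMatrix (fun i j => f (c i j)) where
  comul_eq i j := by
    rw [← CoalgHomClass.map_comp_comul_apply, hc.comul_eq]
    simp [map_sum]
  counit_eq i j := by rw [CoalgHomClass.counit_comp_apply, hc.counit_eq]

theorem mul {A : Type*} [Ring A] [Bialgebra ℂ A] {c : ι → ι → A} {d : κ → κ → A}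
    (hc : IsCoefficientMatrix c) (hd : IsCoefficientMatrix d) :
    IsCoefficientMatrix (fun x y : ι × κ => c x.1 y.1 * d x.2 y.2) :=
  (hc.tmul hd).map (Bialgebra.mulCoalgHom ℂ A)

end IsCoefficientMatrix

namespace TwoCocycle
variable {A : Type*} [Ring A] [Bialgebra ℂ A] (γ : TwoCocycle A)

open Bialgebra in
/-- The cocycle condition with one factor moved to each side, as an identity in the convolution
algebra of `A ⊗ A ⊗ A`. -/
theorem conv_cocycle_mixed :
    tens γ.inv 1 * pull (Coalgebra.TensorProduct.assoc ℂ ℂ A A A :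
        (A ⊗[ℂ] A) ⊗[ℂ] A →ₗc[ℂ] A ⊗[ℂ] (A ⊗[ℂ] A)) (tens 1 γ.fn) =
    pull (Coalgebra.TensorProduct.map (mulCoalgHom ℂ A) (CoalgHom.id ℂ A)) γ.fn *
      pull (Coalgebra.TensorProduct.assoc ℂ ℂ A A A :
        (A ⊗[ℂ] A) ⊗[ℂ] A →ₗc[ℂ] A ⊗[ℂ] (A ⊗[ℂ] A))
        (pull (Coalgebra.TensorProduct.map (CoalgHom.id ℂ A) (mulCoalgHom ℂ A)) γ.inv) := by
  have h := congr(tens γ.inv 1 * $(γ.conv_cocycle) *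
    pull (Coalgebra.TensorProduct.assoc ℂ ℂ A A A :
        (A ⊗[ℂ] A) ⊗[ℂ] A →ₗc[ℂ] A ⊗[ℂ] (A ⊗[ℂ] A))
        (pull (Coalgebra.TensorProduct.map (CoalgHom.id ℂ A) (mulCoalgHom ℂ A)) γ.inv))
  rw [← mul_assoc (tens γ.inv 1) (tens γ.fn 1), tens_mul, γ.inv_fn, one_mul, tens_one, one_mul,
    map_mul, mul_assoc, mul_assoc, ← map_mul, ← map_mul _ γ.fn γ.inv, γ.fn_inv, map_one, map_one,
    mul_one] at h
  exact h.symm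

theorem fn_one_tmul (a : A) : γ.fn.ofConv (1 ⊗ₜ[ℂ] a) = counit (R := ℂ) a := γ.unital_left a

theorem fn_tmul_one (a : A) : γ.fn.ofConv (a ⊗ₜ[ℂ] 1) = counit (R := ℂ) a := γ.unital_right a

theorem inv_one_tmul (a : A) : γ.inv.ofConv (1 ⊗ₜ[ℂ] a) = counit (R := ℂ) a :=
  congr(($(γ.pull_inclRight_inv)).ofConv a)

theorem inv_tmul_one (a : A) : γ.inv.ofConv (a ⊗ₜ[ℂ] 1) = counit (R := ℂ) a :=
  congr(($(γ.pull_inclLeft_inv)).ofConv a)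

variable {ι κ μ : Type*} [Fintype ι] [DecidableEq ι] [Fintype κ] [DecidableEq κ] [Fintype μ]
  [DecidableEq μ] {c : ι → ι → A} {d : κ → κ → A} {e : μ → μ → A}

/-- The identity `γ⁻¹(f ⊗ g₍₁₎) γ(g₍₂₎ ⊗ k) = γ(f₍₁₎g₍₁₎ ⊗ k₍₁₎) γ⁻¹(f₍₂₎ ⊗ g₍₂₎k₍₂₎)` for matrix
coefficients. -/
theorem sum_inv_mul_fn (hc : IsCoefficientMatrix c) (hd : IsCoefficientMatrix d)
    (he : IsCoefficientMatrix e) (i j : ι) (k l : κ) (m n : μ) :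
    ∑ q, γ.inv.ofConv (c i j ⊗ₜ[ℂ] d k q) * γ.fn.ofConv (d q l ⊗ₜ[ℂ] e m n) =
    ∑ p, ∑ q, ∑ r, γ.fn.ofConv ((c i p * d k q) ⊗ₜ[ℂ] e m r) *
      γ.inv.ofConv (c p j ⊗ₜ[ℂ] (d q l * e r n)) := by
  have h := congr(($(γ.conv_cocycle_mixed)).ofConv ((c i j ⊗ₜ[ℂ] d k l) ⊗ₜ[ℂ] e m n))
  have hcde := (hc.tmul hd).tmul he
  rw [hcde.conv_apply _ _ ((i, k), m) ((j, l), n),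
    hcde.conv_apply _ _ ((i, k), m) ((j, l), n)] at h
  simp only [Fintype.sum_prod_type] at h
  refine Eq.trans ?_ h
  simp [tens, pull, LinearMap.convOne_def, hc.counit_eq, he.counit_eq]

/-- The identity `γ⁻¹(f₍₁₎g₍₁₎ ⊗ k) γ⁻¹(f₍₂₎ ⊗ g₍₂₎) = γ⁻¹(f ⊗ g₍₁₎k₍₁₎) γ⁻¹(g₍₂₎ ⊗ k₍₂₎)` for
matrix coefficients. -/
theorem sum_inv_mul_inv (hc : IsCoefficientMatrix c) (hd : IsCoefficientMatrix d)
    (he : IsCoefficientMatrix e) (i j : ι) (k l : κ) (m n : μ) :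
    ∑ p, ∑ q, γ.inv.ofConv ((c i p * d k q) ⊗ₜ[ℂ] e m n) * γ.inv.ofConv (c p j ⊗ₜ[ℂ] d q l) =
    ∑ q, ∑ r, γ.inv.ofConv (c i j ⊗ₜ[ℂ] (d k q * e m r)) * γ.inv.ofConv (d q l ⊗ₜ[ℂ] e r n) := by
  have h := congr(($(γ.conv_cocycle_inv)).ofConv ((c i j ⊗ₜ[ℂ] d k l) ⊗ₜ[ℂ] e m n))
  have hcde := (hc.tmul hd).tmul he
  rw [map_mul, hcde.conv_apply _ _ ((i, k), m) ((j, l), n),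
    hcde.conv_apply _ _ ((i, k), m) ((j, l), n)] at h
  simp only [Fintype.sum_prod_type] at h
  simpa [tens, pull, LinearMap.convOne_def, hc.counit_eq, he.counit_eq] using h

end TwoCocycle
end CocycleCoefficients

/-! ### The functionals `V` and `V⁻¹` -/

namespace TwoCocycle
variable {A : Type*} [Ring A] [HopfAlgebra ℂ A] [StarRing A] [StarModule ℂ A]
  (γ : TwoCocycle A) {ι κ : Type*} [Fintype ι] [DecidableEq ι] [Fintype κ] [DecidableEq κ]
  {c : ι → ι → A} {d : κ → κ → A}

theorem V_coefficient (hc : IsCoefficientMatrix c) (i j : ι) :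
    γ.V.ofConv (c i j) = ∑ p, γ.fn.ofConv (antipodeInv A (c p j) ⊗ₜ[ℂ] c i p) := by
  simp [V, hc.comul_eq, map_sum]

theorem Vinv_coefficient (hc : IsCoefficientMatrix c) (i j : ι) :
    γ.Vinv.ofConv (c i j) = ∑ p, γ.inv.ofConv (c p j ⊗ₜ[ℂ] antipodeInv A (c i p)) := by
  simp [Vinv, hc.comul_eq, map_sum]

/-- The functional `a ⊗ b ↦ γ⁻¹(S⁻¹(b) ⊗ S⁻¹(a))`. If `γ` is unitary, this is the complex conjugate
of `γ(b* ⊗ a*)`. -/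
def flipAntipode : Conv (A ⊗[ℂ] A) :=
  toConv (γ.inv.ofConv ∘ₗ TensorProduct.map (antipodeInv A) (antipodeInv A) ∘ₗ
    (TensorProduct.comm ℂ A A).toLinearMap)

variable [HopfStarAlgebra A]

/-- This is the identity `γ⁻¹(f ⊗ g₍₁₎) γ(g₍₂₎ ⊗ k) = γ(f₍₁₎g₍₁₎ ⊗ k₍₁₎) γ⁻¹(f₍₂₎ ⊗ g₍₂₎k₍₂₎)` for
`f ⊗ g ⊗ k = a₍₃₎ ⊗ S⁻¹(a₍₂₎) ⊗ a₍₁₎`, where the products on the right hand side cancel. -/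
theorem V_mul_Vinv : γ.V * γ.Vinv = 1 := by
  refine congrArg toConv (linearMap_ext_coefficient fun n c hc i j => ?_)
  have hd := hc.antipodeInv
  refine (hc.conv_apply γ.V γ.Vinv i j).trans ?_
  calc ∑ s, γ.V.ofConv (c i s) * γ.Vinv.ofConv (c s j)
      = ∑ s, ∑ p, ∑ q, γ.inv.ofConv (c q j ⊗ₜ[ℂ] antipodeInv A (c s q)) *
          γ.fn.ofConv (antipodeInv A (c p s) ⊗ₜ[ℂ] c i p) := by
        simp only [γ.V_coefficient hc, γ.Vinv_coefficient hc, Finset.sum_mul_sum]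
        exact Finset.sum_congr rfl fun s _ => Finset.sum_congr rfl fun p _ =>
          Finset.sum_congr rfl fun q _ => mul_comm _ _
    _ = ∑ p, ∑ q, ∑ s, γ.inv.ofConv (c q j ⊗ₜ[ℂ] antipodeInv A (c s q)) *
          γ.fn.ofConv (antipodeInv A (c p s) ⊗ₜ[ℂ] c i p) := by
        rw [Finset.sum_comm]
        exact Finset.sum_congr rfl fun p _ => Finset.sum_comm
    _ = ∑ p, ∑ q, ∑ u, ∑ s, ∑ r, γ.fn.ofConv ((c q u * antipodeInv A (c s q)) ⊗ₜ[ℂ] c i r) *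
          γ.inv.ofConv (c u j ⊗ₜ[ℂ] (antipodeInv A (c p s) * c r p)) :=
        Finset.sum_congr rfl fun p _ => Finset.sum_congr rfl fun q _ =>
          γ.sum_inv_mul_fn hc hd hc q j q p i p
    _ = ∑ u, ∑ s, ∑ r, γ.fn.ofConv ((∑ q, c q u * antipodeInv A (c s q)) ⊗ₜ[ℂ] c i r) *
          γ.inv.ofConv (c u j ⊗ₜ[ℂ] (∑ p, antipodeInv A (c p s) * c r p)) := by
        simp only [TensorProduct.sum_tmul, TensorProduct.tmul_sum, map_sum, Finset.sum_mul_sum]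
        refine Finset.sum_comm_cycle.trans (Finset.sum_congr rfl fun u _ => ?_)
        refine Finset.sum_comm_cycle.trans (Finset.sum_congr rfl fun s _ => ?_)
        exact Finset.sum_comm_cycle.trans (Finset.sum_congr rfl fun r _ => Finset.sum_comm)
    _ = ∑ u, γ.fn.ofConv (1 ⊗ₜ[ℂ] c i u) * γ.inv.ofConv (c u j ⊗ₜ[ℂ] 1) := by
        simp only [hc.sum_mul_antipodeInv, hc.sum_antipodeInv_mul]
        refine Finset.sum_congr rfl fun u _ => ?_
        rw [Fintype.sum_eq_single u fun s hs => by simp [hs],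
          Fintype.sum_eq_single u fun r hr => by simp [hr]]
        simp
    _ = (1 : Conv A).ofConv (c i j) := by
        simp [fn_one_tmul, inv_tmul_one, hc.counit_eq, LinearMap.convOne_def]

/-- The relation between `V⁻¹` on a product and the product of the values of `V⁻¹`:
`γ⁻¹(S⁻¹(b₍₁₎) ⊗ S⁻¹(a₍₁₎)) V⁻¹(a₍₂₎b₍₂₎) = V⁻¹(a₍₁₎) V⁻¹(b₍₁₎) γ(a₍₂₎ ⊗ b₍₂₎)`. -/
theorem flipAntipode_mul_pull_Vinv :
    γ.flipAntipode * pull (Bialgebra.mulCoalgHom ℂ A) γ.Vinv = tens γ.Vinv γ.Vinv * γ.fn := by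
  suffices h : γ.flipAntipode * pull (Bialgebra.mulCoalgHom ℂ A) γ.Vinv * γ.inv =
      tens γ.Vinv γ.Vinv by
    rw [← h, mul_assoc, γ.inv_fn, mul_one]
  refine congrArg toConv (TensorProduct.ext (linearMap_ext_coefficient fun n c hc i j => ?_))
  refine linearMap_ext_coefficient fun n' d hd k l => ?_
  have hcd := hc.tmul hd
  have hc' := hc.antipodeInv
  have hd' := hd.antipodeInv
  let T := antipodeInv A
  let g : A → A → ℂ := fun a b => γ.inv.ofConv (a ⊗ₜ[ℂ] b)
  have hg1 : ∀ {m : ℕ} (f : Fin m → A) (b : A), ∑ x, g (f x) b = g (∑ x, f x) b := by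
    intro m f b; simp [g, TensorProduct.sum_tmul]
  have hg2 : ∀ {m : ℕ} (f : Fin m → A) (b : A), ∑ x, g b (f x) = g b (∑ x, f x) := by
    intro m f b; simp [g, TensorProduct.tmul_sum]
  have hg0 : ∀ b, g b 0 = 0 ∧ g 0 b = 0 := fun b => by simp [g]
  have hV : ∀ (p w : Fin n) (q x : Fin n'),
      (pull (Bialgebra.mulCoalgHom ℂ A) γ.Vinv).ofConv (c p w ⊗ₜ[ℂ] d q x) =
        ∑ u, ∑ v, g (c u w * d v x) (T (d q v) * T (c p u)) := by
    intro p w q x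
    refine (γ.Vinv_coefficient (hc.mul hd) (p, q) (w, x)).trans ?_
    simp [Fintype.sum_prod_type, antipodeInv_mul, g, T]
  have hL : ∀ (w : Fin n) (x : Fin n'),
      (γ.flipAntipode * pull (Bialgebra.mulCoalgHom ℂ A) γ.Vinv).ofConv (c i w ⊗ₜ[ℂ] d k x) =
        ∑ p, ∑ q, g (T (d k q)) (T (c i p)) *
          ∑ u, ∑ v, g (c u w * d v x) (T (d q v) * T (c p u)) := by
    intro w x
    refine (hcd.conv_apply _ _ (i, k) (w, x)).trans ?_
    rw [Fintype.sum_prod_type]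
    exact Finset.sum_congr rfl fun p _ => Finset.sum_congr rfl fun q _ => by rw [hV]; rfl
  -- two applications of the cocycle identity, each followed by a cancellation against `S⁻¹`
  have h1 : ∀ p q u, ∑ v, ∑ w, ∑ x, g (c u w * d v x) (T (d q v) * T (c p u)) * g (c w j) (d x l) =
      ∑ y, ∑ z, g (c u j) (T (c z u)) * g (d y l) (T (d q y) * T (c p z)) := by
    intro p q u
    calc ∑ v, ∑ w, ∑ x, g (c u w * d v x) (T (d q v) * T (c p u)) * g (c w j) (d x l)
        = ∑ v, ∑ x, ∑ y, ∑ z, g (c u j) (d v x * (T (d y v) * T (c z u))) *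
            g (d x l) (T (d q y) * T (c p z)) := by
          refine Finset.sum_congr rfl fun v _ => ?_
          have := γ.sum_inv_mul_inv hc hd (hd'.mul hc') u j v l (v, u) (q, p)
          simpa only [Fintype.sum_prod_type] using this
      _ = ∑ x, ∑ y, ∑ z, g (c u j) ((∑ v, d v x * T (d y v)) * T (c z u)) *
            g (d x l) (T (d q y) * T (c p z)) := by
          refine Finset.sum_comm.trans (Finset.sum_congr rfl fun x _ => ?_)
          refine Finset.sum_comm.trans (Finset.sum_congr rfl fun y _ => ?_)
          refine Finset.sum_comm.trans (Finset.sum_congr rfl fun z _ => ?_)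
          rw [← Finset.sum_mul, hg2, Finset.sum_mul]
          simp only [mul_assoc]
      _ = ∑ y, ∑ z, g (c u j) (T (c z u)) * g (d y l) (T (d q y) * T (c p z)) := by
          refine Finset.sum_congr rfl fun x _ => ?_
          rw [Fintype.sum_eq_single x]
          · simp [T, hd.sum_mul_antipodeInv]
          · intro y hy
            simp [T, hd.sum_mul_antipodeInv, hy, hg0]
  have h2 : ∀ z, ∑ y, ∑ q, ∑ p, g (d y l) (T (d q y) * T (c p z)) * g (T (d k q)) (T (c i p)) =
      if z = i then ∑ q, g (d q l) (T (d k q)) else 0 := by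
    intro z
    calc ∑ y, ∑ q, ∑ p, g (d y l) (T (d q y) * T (c p z)) * g (T (d k q)) (T (c i p))
        = ∑ y, ∑ s, ∑ q, g (d y s * T (d q y)) (T (c i z)) * g (d s l) (T (d k q)) :=
          Finset.sum_congr rfl fun y _ => (γ.sum_inv_mul_inv hd hd' hc' y l y k z i).symm
      _ = ∑ s, ∑ q, g (∑ y, d y s * T (d q y)) (T (c i z)) * g (d s l) (T (d k q)) := by
          refine Finset.sum_comm.trans (Finset.sum_congr rfl fun s _ => ?_)
          refine Finset.sum_comm.trans (Finset.sum_congr rfl fun q _ => ?_)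
          rw [← Finset.sum_mul, hg1]
      _ = ∑ q, g 1 (T (c i z)) * g (d q l) (T (d k q)) := by
          refine Finset.sum_congr rfl fun s _ => ?_
          rw [Fintype.sum_eq_single s]
          · simp [T, hd.sum_mul_antipodeInv]
          · intro q hq
            simp [T, hd.sum_mul_antipodeInv, hq, hg0]
      _ = if z = i then ∑ q, g (d q l) (T (d k q)) else 0 := by
          simp only [g, T, γ.inv_one_tmul, hc'.counit_eq]
          split_ifs <;> simp
  refine (hcd.conv_apply _ γ.inv (i, k) (j, l)).trans ?_
  rw [Fintype.sum_prod_type]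
  calc ∑ w, ∑ x, (γ.flipAntipode * pull (Bialgebra.mulCoalgHom ℂ A) γ.Vinv).ofConv
          (c i w ⊗ₜ[ℂ] d k x) * g (c w j) (d x l)
      = ∑ p, ∑ q, ∑ u, g (T (d k q)) (T (c i p)) * ∑ v, ∑ w, ∑ x,
          g (c u w * d v x) (T (d q v) * T (c p u)) * g (c w j) (d x l) := by
        simp only [hL, Finset.sum_mul, Finset.mul_sum]
        refine Finset.sum_comm_cycle.trans (Finset.sum_congr rfl fun p _ => ?_)
        refine Finset.sum_comm_cycle.trans (Finset.sum_congr rfl fun q _ => ?_)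
        refine Finset.sum_comm_cycle.trans (Finset.sum_congr rfl fun u _ => ?_)
        refine Finset.sum_comm_cycle.trans (Finset.sum_congr rfl fun v _ => ?_)
        simp only [mul_assoc]
    _ = ∑ u, ∑ z, g (c u j) (T (c z u)) *
          ∑ y, ∑ q, ∑ p, g (d y l) (T (d q y) * T (c p z)) * g (T (d k q)) (T (c i p)) := by
        simp only [h1, Finset.mul_sum]
        refine Finset.sum_comm_cycle.trans (Finset.sum_congr rfl fun u _ => ?_)
        refine (Finset.sum_congr rfl fun p _ => Finset.sum_comm_cycle).trans
          (Finset.sum_comm.trans (Finset.sum_congr rfl fun z _ => ?_))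
        refine Finset.sum_comm_cycle.trans (Finset.sum_congr rfl fun y _ => ?_)
        refine Finset.sum_comm.trans (Finset.sum_congr rfl fun q _ =>
          Finset.sum_congr rfl fun p _ => ?_)
        ring
    _ = (∑ u, g (c u j) (T (c i u))) * ∑ q, g (d q l) (T (d k q)) := by
        simp [h2, Finset.sum_mul]
    _ = γ.Vinv.ofConv (c i j) * γ.Vinv.ofConv (d k l) := by
        rw [γ.Vinv_coefficient hc, γ.Vinv_coefficient hd]
    _ = (tens γ.Vinv γ.Vinv).ofConv (c i j ⊗ₜ[ℂ] d k l) := by simp [tens]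

end TwoCocycle

/-! ### Conjugation of functionals and of comodules -/

section StarModules
variable {A : Type*} [Ring A] [HopfAlgebra ℂ A] [StarRing A] [StarModule ℂ A]
  {M N : Type*} [AddCommGroup M] [Module ℂ M] [LeftComodule A M]
  [AddCommGroup N] [Module ℂ N] [LeftComodule A N]
  {σ : M →ₛₗ[starRingEnd ℂ] M} {τ : N →ₛₗ[starRingEnd ℂ] N}

variable (A) in
/-- A conjugate linear map `σ` on a comodule is compatible with the `*`-operation of `A` if
`δ(σ(m)) = (* ⊗ σ) δ(m)`. -/
def IsStarCompatible (σ : M →ₛₗ[starRingEnd ℂ] M) : Prop :=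
  ∀ m, coact (C := A) (σ m) =
    TensorProduct.map (starLinearEquiv ℂ (A := A)).toLinearMap σ (coact (C := A) m)

/-- The functional `a ↦ conj (φ(a*))`. -/
def conjStar (φ : Conv A) : Conv A :=
  toConv ((starLinearEquiv ℂ (A := ℂ)).toLinearMap ∘ₛₗ φ.ofConv ∘ₛₗ
    (starLinearEquiv ℂ (A := A)).toLinearMap)

theorem conjStar_apply (φ : Conv A) (a : A) :
    (conjStar φ).ofConv a = star (φ.ofConv (star a)) := rfl

/-- The functional `a ⊗ b ↦ conj (φ(b* ⊗ a*))`. -/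
def conjFlip (φ : Conv (A ⊗[ℂ] A)) : Conv (A ⊗[ℂ] A) :=
  toConv ((starLinearEquiv ℂ (A := ℂ)).toLinearMap ∘ₛₗ φ.ofConv ∘ₛₗ
    (starLinearEquiv ℂ (A := A ⊗[ℂ] A)).toLinearMap ∘ₛₗ (TensorProduct.comm ℂ A A).toLinearMap)

theorem conjFlip_tmul (φ : Conv (A ⊗[ℂ] A)) (a b : A) :
    (conjFlip φ).ofConv (a ⊗ₜ[ℂ] b) = star (φ.ofConv (star b ⊗ₜ[ℂ] star a)) := rfl

/-- The conjugate linear map `m ⊗ n ↦ τ(n) ⊗ σ(m)`. -/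
def dagger (σ : M →ₛₗ[starRingEnd ℂ] M) (τ : N →ₛₗ[starRingEnd ℂ] N) :
    M ⊗[ℂ] N →ₛₗ[starRingEnd ℂ] N ⊗[ℂ] M :=
  (TensorProduct.comm ℂ M N).toLinearMap ∘ₛₗ TensorProduct.map σ τ

theorem dagger_tmul (m : M) (n : N) : dagger σ τ (m ⊗ₜ[ℂ] n) = τ n ⊗ₜ[ℂ] σ m := rfl

theorem IsStarCompatible.act_apply (hσ : IsStarCompatible A σ) (φ : Conv A) (m : M) :
    act φ (σ m) = σ (act (conjStar φ) m) := by
  simp only [act, LinearMap.comp_apply, hσ m, LinearEquiv.coe_coe]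
  hopf_tensor_induction coact (C := A) m with a n
  simp [conjStar_apply]

theorem act_dagger (hσ : IsStarCompatible A σ) (hτ : IsStarCompatible A τ)
    (φ : Conv (A ⊗[ℂ] A)) (z : M ⊗[ℂ] N) :
    act φ (dagger σ τ z) = dagger σ τ (act (conjFlip φ) z) := by
  induction z with
  | zero => simp
  | add x y hx hy => simp only [map_add, hx, hy]
  | tmul m n =>
    have h1 := hσ m
    have h2 := hτ n
    simp only [act, LinearMap.comp_apply, LinearEquiv.coe_coe, coact, dagger_tmul,
      TensorProduct.map_tmul] at h1 h2 ⊢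
    rw [h1, h2]
    hopf_tensor_induction coact (C := A) m with a m'
    hopf_tensor_induction coact (C := A) n with b n'
    simp [conjFlip_tmul, dagger_tmul]

end StarModules

namespace TwoCocycle
variable {A : Type*} [Ring A] [HopfAlgebra ℂ A] [StarRing A] [StarModule ℂ A]
  {γ : TwoCocycle A}

theorem IsUnitary.conjStar_V [HopfStarAlgebra A] (hγ : γ.IsUnitary) : conjStar γ.V = γ.Vinv := by
  refine congrArg toConv (linearMap_ext_coefficient fun n c hc i j => ?_)
  change star (γ.V.ofConv (star (c i j))) = γ.Vinv.ofConv (c i j)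
  rw [γ.V_coefficient hc.star, γ.Vinv_coefficient hc, star_sum]
  refine Finset.sum_congr rfl fun p _ => (hγ _ _).trans ?_
  rw [← antipodeInv_apply]
  congr 2
  conv_rhs => rw [← antipodeInv_antipode (c p j)]
  simp [antipodeInv_apply]

/-- Unitarity of `γ` in the form in which it is used to move `*` past the action of `γ`. -/
theorem IsUnitary.conjFlip_flipAntipode (hγ : γ.IsUnitary) : conjFlip γ.flipAntipode = γ.fn := by
  refine congrArg toConv (TensorProduct.ext' fun a b => ?_)
  change star (γ.inv.ofConv (antipodeInv A (star a) ⊗ₜ[ℂ] antipodeInv A (star b))) = _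
  rw [antipodeInv_apply, antipodeInv_apply, star_star, star_star, ← hγ a b]
  exact star_star _

end TwoCocycle

namespace CovariantCalculus
variable {A Ω : Type*} [Ring A] [HopfAlgebra ℂ A] [StarRing A] [Ring Ω]
  [Algebra ℂ Ω] [Star Ω] [ComoduleAlgebra A Ω]
  {C : CovariantCalculus A Ω}

/-- The `*`-operation of a `*`-differential calculus as a conjugate linear map. -/
def IsStarCalculus.starMap (hC : C.IsStarCalculus) : Ω →ₛₗ[starRingEnd ℂ] Ω where
  toFun := star
  map_add' := hC.star_add
  map_smul' := hC.star_smul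

theorem IsStarCalculus.starMap_apply (hC : C.IsStarCalculus) (x : Ω) : hC.starMap x = star x := rfl

/-- The restriction of the `*`-operation to the `k`-forms. -/
def IsStarCalculus.starForm (hC : C.IsStarCalculus) (k : ℕ) :
    C.Form k →ₛₗ[starRingEnd ℂ] C.Form k where
  toFun x := C.mkForm (hC.star_mem (C.incl_mem x))
  map_add' x y := C.incl_injective k (hC.star_add (C.incl k x) (C.incl k y))
  map_smul' r x := C.incl_injective k (hC.star_smul r (C.incl k x))

theorem IsStarCalculus.incl_starForm (hC : C.IsStarCalculus) {k : ℕ} (x : C.Form k) :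
    C.incl k (hC.starForm k x) = star (C.incl k x) := rfl

variable [StarModule ℂ A]

theorem IsStarCalculus.isStarCompatible_starMap (hC : C.IsStarCalculus) :
    IsStarCompatible A hC.starMap := by
  intro x
  obtain ⟨n, a, y, h⟩ := TensorProduct.exists_sum_tmul_eq (coact (C := A) x)
  rw [h, hC.starMap_apply, hC.coact_star x n a y h, map_sum]
  rfl

theorem IsStarCalculus.isStarCompatible_starForm (hC : C.IsStarCalculus) (k : ℕ) :
    IsStarCompatible A (hC.starForm k) := by
  intro x
  apply C.lTensor_incl_injective k
  rw [lTensor_incl_coact, hC.incl_starForm, ← hC.starMap_apply, hC.isStarCompatible_starMap,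
    ← lTensor_incl_coact]
  generalize coact (C := A) x = z
  induction z with
  | zero => simp
  | add x y hx hy => simp only [map_add, hx, hy]
  | tmul a y => rfl

end CovariantCalculus

/-! ### The `*`-operation on the deformed calculus -/

namespace CovariantCalculus

section Action
variable {A Ω : Type*} [Ring A] [Bialgebra ℂ A] [Ring Ω] [Algebra ℂ Ω] [ComoduleAlgebra A Ω]
  (C : CovariantCalculus A Ω)

theorem act_d (φ : Conv A) (x : Ω) : act φ (C.d x) = C.d (act φ x) :=
  act_nat (C := A) (D := A) LinearMap.id C.d C.coact_d φ x

theorem act_wedge {i j k : ℕ} (h : i + j = k) (φ : Conv A)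
    (z : C.Form i ⊗[ℂ] C.Form j) :
    act φ (C.wedge i j k h z) =
      C.wedge i j k h (act (pull (Bialgebra.mulCoalgHom ℂ A) φ) z) :=
  act_nat (C := A ⊗[ℂ] A) (D := A) (Bialgebra.mulCoalgHom ℂ A).toLinearMap (C.wedge i j k h)
    (C.coact_wedge h) φ z

theorem incl_act {k : ℕ} (φ : Conv A) (x : C.Form k) :
    C.incl k (act φ x) = act φ (C.incl k x) :=
  (act_nat (C := A) (D := A) LinearMap.id (C.incl k)
    (fun m => (C.lTensor_incl_coact m).symm) φ x).symm

end Action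

variable {A Ω : Type*} [Ring A] [HopfAlgebra ℂ A] [StarRing A] [Ring Ω] [Algebra ℂ Ω] [Star Ω]
  [ComoduleAlgebra A Ω] {C : CovariantCalculus A Ω} {γ : TwoCocycle A}

theorem IsStarCalculus.starForm_wedge (hC : C.IsStarCalculus) {i j k : ℕ} (h : i + j = k)
    (h' : j + i = k) (z : C.Form i ⊗[ℂ] C.Form j) :
    hC.starForm k (C.wedge i j k h z) =
      (-1 : ℂ) ^ (i * j) • C.wedge j i k h' (dagger (hC.starForm i) (hC.starForm j) z) := by
  induction z with
  | zero => simp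
  | add x y hx hy => simp only [map_add, hx, hy, smul_add]
  | tmul x y => exact C.incl_injective k (hC.star_mul (C.incl_mem x) (C.incl_mem y))

variable [StarModule ℂ A] [HopfStarAlgebra A]

/-- The `*`-operation on deformed forms reverses the deformed product: both sides arise from
`y* ⊗ x*` by the action of a functional, and the two functionals agree by
`TwoCocycle.flipAntipode_mul_pull_Vinv`. -/
theorem IsStarCalculus.act_Vinv_starForm_wedge (hC : C.IsStarCalculus) (hγ : γ.IsUnitary)
    {i j k : ℕ} (h : i + j = k) (h' : j + i = k) (x : C.Form i) (y : C.Form j) :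
    act γ.Vinv (hC.starForm k (C.wedge i j k h (act γ.fn (x ⊗ₜ[ℂ] y)))) =
      (-1 : ℂ) ^ (i * j) • C.wedge j i k h' (act γ.fn
        (act γ.Vinv (hC.starForm j y) ⊗ₜ[ℂ] act γ.Vinv (hC.starForm i x))) := by
  rw [hC.starForm_wedge h h', map_smul, act_wedge, ← hγ.conjFlip_flipAntipode,
    ← act_dagger (hC.isStarCompatible_starForm i) (hC.isStarCompatible_starForm j), ← act_mul,
    γ.flipAntipode_mul_pull_Vinv, hγ.conjFlip_flipAntipode, act_mul, dagger_tmul, act_tens]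

/-- The involution property and the covariance of `*` rest on `V * V⁻¹ = 1`, the
antimultiplicativity on `IsStarCalculus.act_Vinv_starForm_wedge`. -/
theorem IsStarCalculus.twist (hC : C.IsStarCalculus) (hγ : γ.IsUnitary) :
    (C.twist γ).IsStarCalculus where
  star_add x y := by
    have h : act γ.Vinv (hC.starMap ((γ.ofDeform Ω).symm x + (γ.ofDeform Ω).symm y)) =
        act γ.Vinv (hC.starMap ((γ.ofDeform Ω).symm x)) +
          act γ.Vinv (hC.starMap ((γ.ofDeform Ω).symm y)) := by
      rw [map_add, map_add]
    exact h
  star_smul r x := by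
    have h : act γ.Vinv (hC.starMap (r • (γ.ofDeform Ω).symm x)) =
        starRingEnd ℂ r • act γ.Vinv (hC.starMap ((γ.ofDeform Ω).symm x)) := by
      rw [map_smulₛₗ, map_smul]
    exact h
  star_star x := by
    have h : act γ.Vinv (hC.starMap (act γ.Vinv (hC.starMap ((γ.ofDeform Ω).symm x)))) =
        (γ.ofDeform Ω).symm x := by
      conv_lhs => enter [2, 2]; rw [← hγ.conjStar_V]
      rw [← hC.isStarCompatible_starMap.act_apply, ← act_mul, γ.V_mul_Vinv, act_one]
      exact hC.star_star _
    exact h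
  star_mem {k x} hx := act_mem (C.isSubcomodule k) γ.Vinv (hC.star_mem hx)
  star_d x := by
    have h : act γ.Vinv (star (C.d ((γ.ofDeform Ω).symm x))) =
        C.d (act γ.Vinv (star ((γ.ofDeform Ω).symm x))) := by
      rw [hC.star_d, act_d]
    exact h
  star_mul {k l x y} hx hy := by
    have h := congrArg (C.incl (k + l))
      (hC.act_Vinv_starForm_wedge hγ rfl (add_comm l k) (C.mkForm hx) (C.mkForm hy))
    rw [incl_act, map_smul, incl_starForm, incl_wedge, incl_wedge, ← act_map_incl, ← act_map_incl]
      at h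
    simp only [TensorProduct.map_tmul, incl_act] at h
    exact h
  coact_star x n a y h := by
    have h1 : coact (C := A) (star ((γ.ofDeform Ω).symm x)) =
        ∑ i, star ((HopfTwist.of γ).symm (a i)) ⊗ₜ[ℂ] star ((γ.ofDeform Ω).symm (y i)) :=
      hC.coact_star _ n _ _ h
    have h2 := Deform.map_mulMap_coact (C := A) LinearMap.id LinearMap.id γ.V γ.Vinv γ.V_mul_Vinv
      (star ((γ.ofDeform Ω).symm x))
    rw [TensorProduct.map_id, LinearMap.id_apply, h1, map_sum] at h2
    refine h2.symm.trans (Finset.sum_congr rfl fun i _ => ?_)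
    rw [TensorProduct.map_tmul, LinearMap.comp_apply, LinearMap.comp_apply, LinearMap.comp_apply,
      convL_convR]
    rfl

end CovariantCalculus

/-! ### Deformation of mixed associativity laws -/

section Naturality
variable {C D E M N P : Type*} [AddCommGroup C] [Module ℂ C] [Coalgebra ℂ C]
  [AddCommGroup D] [Module ℂ D] [Coalgebra ℂ D] [AddCommGroup E] [Module ℂ E] [Coalgebra ℂ E]
  [AddCommGroup M] [Module ℂ M] [AddCommGroup N] [Module ℂ N] [AddCommGroup P] [Module ℂ P]
  [LeftComodule C M]

/-- A quotient of a comodule, with the coaction pushed forward along a morphism of coalgebras. -/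
@[reducible] def LeftComodule.ofSurjective (h : C →ₗc[ℂ] D) (f : M →ₗ[ℂ] N)
    (hf : Function.Surjective f) (δ : N →ₗ[ℂ] D ⊗[ℂ] N)
    (hδ : ∀ m, δ (f m) = TensorProduct.map h.toLinearMap f (coact (C := C) m)) :
    LeftComodule D N where
  coact := δ
  coassoc n := by
    obtain ⟨m, rfl⟩ := hf n
    have h1 := congr(TensorProduct.map h.toLinearMap (TensorProduct.map h.toLinearMap f)
      $(LeftComodule.coassoc (C := C) m))
    rw [hδ]
    refine Eq.trans ?_ (h1.trans ?_)
    · hopf_tensor_induction coact (C := C) m with c m'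
      have h2 : TensorProduct.map h.toLinearMap h.toLinearMap (comul (R := ℂ) c) =
          comul (R := ℂ) (h.toLinearMap c) := CoalgHomClass.map_comp_comul_apply h c
      simp only [TensorProduct.map_tmul, LinearMap.rTensor_tmul]
      rw [← h2]
      hopf_tensor_induction comul (R := ℂ) c with c₁ c₂
      simp
    · hopf_tensor_induction coact (C := C) m with c m'
      simp [hδ]
  counit_coact n := by
    obtain ⟨m, rfl⟩ := hf n
    conv_rhs => rw [← LeftComodule.counit_coact (C := C) m]
    rw [hδ]
    hopf_tensor_induction coact (C := C) m with c m'
    simp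

variable [LeftComodule D N] [LeftComodule E P]

theorem act_rTensor (h : C →ₗc[ℂ] D) (f : M →ₗ[ℂ] N)
    (hf : ∀ m, coact (C := D) (f m) = TensorProduct.map h.toLinearMap f (coact (C := C) m))
    (φ : Conv (D ⊗[ℂ] E)) (w : M ⊗[ℂ] P) :
    act φ (f.rTensor P w) =
      f.rTensor P (act (pull (Coalgebra.TensorProduct.map h (CoalgHom.id ℂ E)) φ) w) :=
  act_nat (Coalgebra.TensorProduct.map h (CoalgHom.id ℂ E)).toLinearMap (f.rTensor P)
    (coact_rTensor h.toLinearMap f hf) φ w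

theorem act_lTensor (h : C →ₗc[ℂ] D) (f : M →ₗ[ℂ] N)
    (hf : ∀ m, coact (C := D) (f m) = TensorProduct.map h.toLinearMap f (coact (C := C) m))
    (φ : Conv (E ⊗[ℂ] D)) (w : P ⊗[ℂ] M) :
    act φ (f.lTensor P w) =
      f.lTensor P (act (pull (Coalgebra.TensorProduct.map (CoalgHom.id ℂ E) h) φ) w) :=
  act_nat (Coalgebra.TensorProduct.map (CoalgHom.id ℂ E) h).toLinearMap (f.lTensor P)
    (coact_lTensor h.toLinearMap f hf) φ w

end Naturality

section DeformAssoc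
variable {A : Type*} [Ring A] [Bialgebra ℂ A] (γ : TwoCocycle A)
  {M N P U V W : Type*} [AddCommGroup M] [Module ℂ M] [LeftComodule A M]
  [AddCommGroup N] [Module ℂ N] [LeftComodule A N] [AddCommGroup P] [Module ℂ P] [LeftComodule A P]
  [AddCommGroup U] [Module ℂ U] [LeftComodule A U] [AddCommGroup V] [Module ℂ V] [LeftComodule A V]
  [AddCommGroup W] [Module ℂ W]

/-- The deformation of bilinear operations preserves mixed associativity laws: if
`(m · n) · p = m · (n · p)`, where the inner operations are covariant, then the same law holds for
the operations precomposed with the action of `γ`. -/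
theorem TwoCocycle.deform_assoc {f₁ : M ⊗[ℂ] N →ₗ[ℂ] U} {g₁ : U ⊗[ℂ] P →ₗ[ℂ] W}
    {f₂ : N ⊗[ℂ] P →ₗ[ℂ] V} {g₂ : M ⊗[ℂ] V →ₗ[ℂ] W}
    (hf₁ : ∀ z, coact (C := A) (f₁ z) =
      TensorProduct.map (LinearMap.mul' ℂ A) f₁ (coact (C := A ⊗[ℂ] A) z))
    (hf₂ : ∀ z, coact (C := A) (f₂ z) =
      TensorProduct.map (LinearMap.mul' ℂ A) f₂ (coact (C := A ⊗[ℂ] A) z))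
    (h : ∀ m n p, g₁ (f₁ (m ⊗ₜ[ℂ] n) ⊗ₜ[ℂ] p) = g₂ (m ⊗ₜ[ℂ] f₂ (n ⊗ₜ[ℂ] p)))
    (m : M) (n : N) (p : P) :
    g₁ (act γ.fn (f₁ (act γ.fn (m ⊗ₜ[ℂ] n)) ⊗ₜ[ℂ] p)) =
      g₂ (act γ.fn (m ⊗ₜ[ℂ] f₂ (act γ.fn (n ⊗ₜ[ℂ] p)))) := by
  have hg : ∀ w, g₁ (f₁.rTensor P w) = g₂ (f₂.lTensor M (TensorProduct.assoc ℂ M N P w)) := by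
    intro w
    have : g₁ ∘ₗ f₁.rTensor P =
        g₂ ∘ₗ f₂.lTensor M ∘ₗ (TensorProduct.assoc ℂ M N P).toLinearMap := by
      ext m n p; exact h m n p
    exact congr($this w)
  have ha : ∀ (φ : Conv (A ⊗[ℂ] (A ⊗[ℂ] A))) w, act φ (TensorProduct.assoc ℂ M N P w) =
      TensorProduct.assoc ℂ M N P (act (pull (Coalgebra.TensorProduct.assoc ℂ ℂ A A A :
        (A ⊗[ℂ] A) ⊗[ℂ] A →ₗc[ℂ] A ⊗[ℂ] (A ⊗[ℂ] A)) φ) w) := fun φ w =>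
    act_nat (C := (A ⊗[ℂ] A) ⊗[ℂ] A) (D := A ⊗[ℂ] (A ⊗[ℂ] A))
      (Coalgebra.TensorProduct.assoc ℂ ℂ A A A :
        (A ⊗[ℂ] A) ⊗[ℂ] A →ₗc[ℂ] A ⊗[ℂ] (A ⊗[ℂ] A)).toLinearMap
      (TensorProduct.assoc ℂ M N P).toLinearMap (fun w => coact_assoc w) φ w
  have h1 : f₁ (act γ.fn (m ⊗ₜ[ℂ] n)) ⊗ₜ[ℂ] p =
      f₁.rTensor P (act (tens γ.fn (1 : Conv A)) ((m ⊗ₜ[ℂ] n) ⊗ₜ[ℂ] p)) := by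
    rw [act_tens, act_one]; rfl
  have h2 : m ⊗ₜ[ℂ] f₂ (act γ.fn (n ⊗ₜ[ℂ] p)) = f₂.lTensor M (act (tens (1 : Conv A) γ.fn)
      (TensorProduct.assoc ℂ M N P ((m ⊗ₜ[ℂ] n) ⊗ₜ[ℂ] p))) := by
    rw [TensorProduct.assoc_tmul, act_tens, act_one]; rfl
  rw [h1, h2, act_rTensor (Bialgebra.mulCoalgHom ℂ A) f₁ hf₁,
    act_lTensor (Bialgebra.mulCoalgHom ℂ A) f₂ hf₂, hg, ← act_mul, ← act_mul, ha, γ.conv_cocycle]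

theorem TwoCocycle.act_fn_coinvariant_tmul {m : M} (hm : coact (C := A) m = 1 ⊗ₜ[ℂ] m) (n : N) :
    act γ.fn (m ⊗ₜ[ℂ] n) = m ⊗ₜ[ℂ] n := by
  conv_rhs => rw [← LeftComodule.counit_coact (C := A) n]
  have h : coact (C := A ⊗[ℂ] A) (m ⊗ₜ[ℂ] n) = TensorProduct.tensorTensorTensorComm ℂ A M A N
    (coact (C := A) m ⊗ₜ[ℂ] coact (C := A) n) := rfl
  simp only [act, LinearMap.comp_apply, LinearEquiv.coe_coe, h, hm]
  hopf_tensor_induction coact (C := A) n with a n'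
  simp [γ.fn_one_tmul]

theorem TwoCocycle.act_fn_tmul_coinvariant (m : M) {n : N} (hn : coact (C := A) n = 1 ⊗ₜ[ℂ] n) :
    act γ.fn (m ⊗ₜ[ℂ] n) = m ⊗ₜ[ℂ] n := by
  conv_rhs => rw [← LeftComodule.counit_coact (C := A) m]
  have h : coact (C := A ⊗[ℂ] A) (m ⊗ₜ[ℂ] n) = TensorProduct.tensorTensorTensorComm ℂ A M A N
    (coact (C := A) m ⊗ₜ[ℂ] coact (C := A) n) := rfl
  simp only [act, LinearMap.comp_apply, LinearEquiv.coe_coe, h, hn]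
  hopf_tensor_induction coact (C := A) m with a m'
  simp [γ.fn_tmul_one, TensorProduct.smul_tmul']

end DeformAssoc

/-! ### The comodule of two-tensors of one-forms -/

namespace CovariantCalculus
variable {A Ω : Type*} [Ring A] [Bialgebra ℂ A] [Ring Ω] [Algebra ℂ Ω] [ComoduleAlgebra A Ω]
  (C : CovariantCalculus A Ω)

instance : LeftComodule A C.FormTensor :=
  LeftComodule.ofSurjective (Bialgebra.mulCoalgHom ℂ A) C.balance.mkQ C.balance.mkQ_surjective
    C.coactForms fun _ => rfl

theorem coact_mkQ (z : C.Form 1 ⊗[ℂ] C.Form 1) :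
    coact (C := A) (C.balance.mkQ z) =
      TensorProduct.map (LinearMap.mul' ℂ A) C.balance.mkQ (coact (C := A ⊗[ℂ] A) z) := rfl

theorem wedge_assoc {i j k ij jk n : ℕ} (h₁ : i + j = ij) (h₂ : ij + k = n) (h₃ : j + k = jk)
    (h₄ : i + jk = n) (x : C.Form i) (y : C.Form j) (z : C.Form k) :
    C.wedge ij k n h₂ (C.wedge i j ij h₁ (x ⊗ₜ[ℂ] y) ⊗ₜ[ℂ] z) =
      C.wedge i jk n h₄ (x ⊗ₜ[ℂ] C.wedge j k jk h₃ (y ⊗ₜ[ℂ] z)) :=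
  C.incl_injective n (mul_assoc (C.incl i x) (C.incl j y) (C.incl k z))

section Lift
variable {X W : Type*} [AddCommGroup X] [Module ℂ X] [AddCommGroup W] [Module ℂ W]

/-- Linear maps on `X ⊗ (Ω¹ ⊗ Ω¹)` that are balanced over `B` descend to `X ⊗ (Ω¹ ⊗_B Ω¹)`. -/
theorem exists_lift_tmul_mkQ (L : X ⊗[ℂ] (C.Form 1 ⊗[ℂ] C.Form 1) →ₗ[ℂ] W)
    (h : ∀ x η b ζ, L (x ⊗ₜ[ℂ] (C.wedge 1 0 1 rfl (η ⊗ₜ[ℂ] b) ⊗ₜ[ℂ] ζ)) =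
      L (x ⊗ₜ[ℂ] (η ⊗ₜ[ℂ] C.wedge 0 1 1 rfl (b ⊗ₜ[ℂ] ζ)))) :
    ∃ G : X ⊗[ℂ] C.FormTensor →ₗ[ℂ] W, ∀ x t, G (x ⊗ₜ[ℂ] C.balance.mkQ t) = L (x ⊗ₜ[ℂ] t) := by
  refine ⟨TensorProduct.lift (C.balance.liftQ (TensorProduct.curry L).flip
    (C.balance_le_ker _ fun w => ?_)).flip, fun x t => rfl⟩
  have : (TensorProduct.curry L).flip ∘ₗ C.mulMid = (TensorProduct.curry L).flip ∘ₗ C.midMul ∘ₗ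
      (TensorProduct.assoc ℂ (C.Form 1) (C.Form 0) (C.Form 1)).toLinearMap := by
    ext η b ζ x; exact h x η b ζ
  exact congr($this w)

/-- Linear maps on `(Ω¹ ⊗ Ω¹) ⊗ X` that are balanced over `B` descend to `(Ω¹ ⊗_B Ω¹) ⊗ X`. -/
theorem exists_lift_mkQ_tmul (L : (C.Form 1 ⊗[ℂ] C.Form 1) ⊗[ℂ] X →ₗ[ℂ] W)
    (h : ∀ x η b ζ, L ((C.wedge 1 0 1 rfl (η ⊗ₜ[ℂ] b) ⊗ₜ[ℂ] ζ) ⊗ₜ[ℂ] x) =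
      L ((η ⊗ₜ[ℂ] C.wedge 0 1 1 rfl (b ⊗ₜ[ℂ] ζ)) ⊗ₜ[ℂ] x)) :
    ∃ G : C.FormTensor ⊗[ℂ] X →ₗ[ℂ] W, ∀ x t, G (C.balance.mkQ t ⊗ₜ[ℂ] x) = L (t ⊗ₜ[ℂ] x) := by
  refine ⟨TensorProduct.lift (C.balance.liftQ (TensorProduct.curry L)
    (C.balance_le_ker _ fun w => ?_)), fun x t => rfl⟩
  have : TensorProduct.curry L ∘ₗ C.mulMid = TensorProduct.curry L ∘ₗ C.midMul ∘ₗ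
      (TensorProduct.assoc ℂ (C.Form 1) (C.Form 0) (C.Form 1)).toLinearMap := by
    ext η b ζ x; exact h x η b ζ
  exact congr($this w)

end Lift

section Metric
variable {C} {g : C.FormTensor} {p : C.FormTensor →ₗ[ℂ] C.Form 0}

theorem contractLeft_tmul (ω η ζ : C.Form 1) :
    C.contractLeft p ω (η ⊗ₜ[ℂ] ζ) = C.wedge 0 1 1 rfl (p (C.tmul ω η) ⊗ₜ[ℂ] ζ) := rfl

theorem contractRight_tmul (ω η ζ : C.Form 1) :
    C.contractRight p ω (η ⊗ₜ[ℂ] ζ) = C.wedge 1 0 1 rfl (η ⊗ₜ[ℂ] p (C.tmul ζ ω)) := rfl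

theorem leftMul_tmul (b : C.Form 0) (ω η : C.Form 1) :
    C.leftMul b (C.tmul ω η) = C.tmul (C.wedge 0 1 1 rfl (b ⊗ₜ[ℂ] ω)) η := rfl

theorem tmul_wedge (ω : C.Form 1) (b : C.Form 0) (η : C.Form 1) :
    C.tmul (C.wedge 1 0 1 rfl (ω ⊗ₜ[ℂ] b)) η = C.tmul ω (C.wedge 0 1 1 rfl (b ⊗ₜ[ℂ] η)) :=
  C.mkQ_mulMid ((ω ⊗ₜ[ℂ] b) ⊗ₜ[ℂ] η)

/-- The contraction `ω ⊗ (η ⊗ ζ) ↦ (ω, η)ζ` is well defined on `Ω¹ ⊗ (Ω¹ ⊗_B Ω¹)`, by right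
linearity of the pairing. -/
theorem IsMetric.exists_contractLeft (h : C.IsMetric g p) :
    ∃ G : C.Form 1 ⊗[ℂ] C.FormTensor →ₗ[ℂ] C.Form 1, ∀ ω t,
      G (ω ⊗ₜ[ℂ] C.balance.mkQ t) = C.contractLeft p ω t := by
  obtain ⟨G, hG⟩ := C.exists_lift_tmul_mkQ (C.wedge 0 1 1 rfl ∘ₗ
    (p ∘ₗ C.balance.mkQ).rTensor (C.Form 1) ∘ₗ (TensorProduct.assoc ℂ _ _ _).symm.toLinearMap)
    fun ω η b ζ => by
      change C.wedge 0 1 1 rfl (p (C.tmul ω (C.wedge 1 0 1 rfl (η ⊗ₜ[ℂ] b))) ⊗ₜ[ℂ] ζ) =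
        C.wedge 0 1 1 rfl (p (C.tmul ω η) ⊗ₜ[ℂ] C.wedge 0 1 1 rfl (b ⊗ₜ[ℂ] ζ))
      rw [h.right_linear, C.wedge_assoc]
  refine ⟨G, fun ω t => (hG ω t).trans ?_⟩
  induction t with
  | zero => simp
  | add x y hx hy => simp only [TensorProduct.tmul_add, map_add, hx, hy]
  | tmul η ζ => rfl

/-- The contraction `(η ⊗ ζ) ⊗ ω ↦ η(ζ, ω)` is well defined on `(Ω¹ ⊗_B Ω¹) ⊗ Ω¹`, by left linearity
of the pairing. -/
theorem IsMetric.exists_contractRight (h : C.IsMetric g p) :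
    ∃ G : C.FormTensor ⊗[ℂ] C.Form 1 →ₗ[ℂ] C.Form 1, ∀ ω t,
      G (C.balance.mkQ t ⊗ₜ[ℂ] ω) = C.contractRight p ω t := by
  obtain ⟨G, hG⟩ := C.exists_lift_mkQ_tmul (C.wedge 1 0 1 rfl ∘ₗ
    (p ∘ₗ C.balance.mkQ).lTensor (C.Form 1) ∘ₗ (TensorProduct.assoc ℂ _ _ _).toLinearMap)
    fun ω η b ζ => by
      change C.wedge 1 0 1 rfl (C.wedge 1 0 1 rfl (η ⊗ₜ[ℂ] b) ⊗ₜ[ℂ] p (C.tmul ζ ω)) =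
        C.wedge 1 0 1 rfl (η ⊗ₜ[ℂ] p (C.tmul (C.wedge 0 1 1 rfl (b ⊗ₜ[ℂ] ζ)) ω))
      rw [h.left_linear, C.wedge_assoc]
  refine ⟨G, fun ω t => (hG ω t).trans ?_⟩
  induction t with
  | zero => simp
  | add x y hx hy => simp only [TensorProduct.add_tmul, map_add, hx, hy]
  | tmul η ζ => rfl

variable (C) in
theorem exists_leftMul :
    ∃ G : C.Form 0 ⊗[ℂ] C.FormTensor →ₗ[ℂ] C.FormTensor, ∀ b t, G (b ⊗ₜ[ℂ] t) = C.leftMul b t := by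
  obtain ⟨G, hG⟩ := C.exists_lift_tmul_mkQ (C.balance.mkQ ∘ₗ
    (C.wedge 0 1 1 rfl).rTensor (C.Form 1) ∘ₗ (TensorProduct.assoc ℂ _ _ _).symm.toLinearMap)
    fun b η c ζ => by
      change C.tmul (C.wedge 0 1 1 rfl (b ⊗ₜ[ℂ] C.wedge 1 0 1 rfl (η ⊗ₜ[ℂ] c))) ζ =
        C.tmul (C.wedge 0 1 1 rfl (b ⊗ₜ[ℂ] η)) (C.wedge 0 1 1 rfl (c ⊗ₜ[ℂ] ζ))
      rw [← tmul_wedge, C.wedge_assoc]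
  refine ⟨G, fun b t => ?_⟩
  obtain ⟨t, rfl⟩ := C.balance.mkQ_surjective t
  refine (hG b t).trans ?_
  induction t with
  | zero => simp
  | add x y hx hy => simp only [TensorProduct.tmul_add, map_add, hx, hy]
  | tmul η ζ => rfl

theorem IsCovariantMetric.coact_pairing (h : C.IsCovariantMetric g p)
    (z : C.Form 1 ⊗[ℂ] C.Form 1) : coact (C := A) ((p ∘ₗ C.balance.mkQ) z) =
      TensorProduct.map (LinearMap.mul' ℂ A) (p ∘ₗ C.balance.mkQ) (coact (C := A ⊗[ℂ] A) z) := by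
  refine (h.pairing_covariant (C.balance.mkQ z)).trans ?_
  change p.lTensor A (coact (C := A) (C.balance.mkQ z)) = _
  rw [coact_mkQ, ← LinearMap.comp_apply, LinearMap.lTensor_comp_map]

/-- The metric tensor is coinvariant, being the image of `1 ∈ B` under `coev`. -/
theorem IsCovariantMetric.coact_tensor (h : C.IsCovariantMetric g p) :
    coact (C := A) g = 1 ⊗ₜ[ℂ] g := by
  have h1 : C.coev g (C.mkForm C.one_mem) = g := by
    change C.leftMul (C.mkForm C.one_mem) g = g
    obtain ⟨t, rfl⟩ := C.balance.mkQ_surjective g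
    clear h
    induction t with
    | zero => simp
    | add x y hx hy => simp only [map_add, hx, hy]
    | tmul η ζ =>
      refine (leftMul_tmul _ _ _).trans (congrArg (C.tmul · ζ) ?_)
      exact C.incl_injective 1 (one_mul (C.incl 1 η))
  have h2 : coact (C := A) (C.mkForm C.one_mem) = 1 ⊗ₜ[ℂ] C.mkForm C.one_mem := by
    apply C.lTensor_incl_injective 0
    rw [lTensor_incl_coact]
    exact ComoduleAlgebra.coact_one
  have h3 := h.coev_covariant (C.mkForm C.one_mem)
  rw [h2, LinearMap.lTensor_tmul, h1] at h3
  exact h3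

end Metric
end CovariantCalculus

/-! ### The deformed metric -/

namespace CovariantCalculus
variable {A Ω : Type*} [Ring A] [Bialgebra ℂ A] [Ring Ω] [Algebra ℂ Ω] [ComoduleAlgebra A Ω]
  (C : CovariantCalculus A Ω) (γ : TwoCocycle A)

theorem toTwist₂_tmul {i j : ℕ} (x : C.Form i) (y : C.Form j) :
    C.toTwist₂ γ i j (x ⊗ₜ[ℂ] y) = C.toTwist γ i x ⊗ₜ[ℂ] C.toTwist γ j y := rfl

theorem untwistForms_mkQ (z : C.Form 1 ⊗[ℂ] C.Form 1) :
    C.untwistForms γ ((C.twist γ).balance.mkQ (C.toTwist₂ γ 1 1 z)) =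
      C.balance.mkQ (act γ.fn z) := by
  change C.balance.mkQ (act γ.fn ((C.toTwist₂ γ 1 1).symm (C.toTwist₂ γ 1 1 z))) = _
  rw [LinearEquiv.symm_apply_apply]

theorem untwistForms_tmul (x y : C.Form 1) :
    C.untwistForms γ ((C.twist γ).tmul (C.toTwist γ 1 x) (C.toTwist γ 1 y)) =
      C.balance.mkQ (act γ.fn (x ⊗ₜ[ℂ] y)) := C.untwistForms_mkQ γ (x ⊗ₜ[ℂ] y)

theorem twistForms_mkQ (z : C.Form 1 ⊗[ℂ] C.Form 1) :
    C.twistForms γ (C.balance.mkQ z) =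
      (C.twist γ).balance.mkQ (C.toTwist₂ γ 1 1 (act γ.inv z)) := rfl

theorem untwistForms_twistForms (t : C.FormTensor) :
    C.untwistForms γ (C.twistForms γ t) = t := by
  obtain ⟨z, rfl⟩ := C.balance.mkQ_surjective t
  rw [twistForms_mkQ, untwistForms_mkQ, ← act_mul, γ.inv_fn, act_one]
  rfl

theorem twistForms_untwistForms (t : (C.twist γ).FormTensor) :
    C.twistForms γ (C.untwistForms γ t) = t := by
  obtain ⟨z, rfl⟩ := (C.twist γ).balance.mkQ_surjective t
  obtain ⟨z, rfl⟩ := (C.toTwist₂ γ 1 1).surjective z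
  rw [untwistForms_mkQ, twistForms_mkQ, ← act_mul, γ.fn_inv, act_one]
  rfl

theorem twist_wedge_tmul {i j k : ℕ} (h : i + j = k) (x : C.Form i) (y : C.Form j) :
    (C.twist γ).wedge i j k h (C.toTwist γ i x ⊗ₜ[ℂ] C.toTwist γ j y) =
      C.toTwist γ k (C.wedge i j k h (act γ.fn (x ⊗ₜ[ℂ] y))) :=
  C.twist_wedge γ h (x ⊗ₜ[ℂ] y)

theorem coact_toTwist (k : ℕ) (x : C.Form k) :
    coact (C := HopfTwist γ) (C.toTwist γ k x) =
      TensorProduct.map (HopfTwist.of γ).toLinearMap (C.toTwist γ k).toLinearMap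
        (coact (C := A) x) :=
  congr($((TensorProduct.map_id (R := ℂ) (M := A) (N := C.Form k)).symm) (coact (C := A) x))

/-- The isomorphism `φ` is a morphism of comodules. -/
theorem coactForms_untwistForms (t : (C.twist γ).FormTensor) :
    C.coactForms (C.untwistForms γ t) =
      TensorProduct.map (HopfTwist.of γ).symm.toLinearMap (C.untwistForms γ)
        ((C.twist γ).coactForms t) := by
  obtain ⟨z, rfl⟩ := (C.twist γ).balance.mkQ_surjective t
  obtain ⟨z, rfl⟩ := (C.toTwist₂ γ 1 1).surjective z
  rw [untwistForms_mkQ]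
  refine (Deform.map_mulMap_coact (C := A ⊗[ℂ] A) (LinearMap.mul' ℂ A) C.balance.mkQ γ.inv γ.fn
    γ.inv_fn z).symm.trans ?_
  have h : (C.twist γ).coactForms ((C.twist γ).balance.mkQ (C.toTwist₂ γ 1 1 z)) =
      TensorProduct.map ((HopfTwist.of γ).toLinearMap ∘ₗ HopfTwist.mulMap γ)
        ((C.twist γ).balance.mkQ ∘ₗ (C.toTwist₂ γ 1 1).toLinearMap)
        (coact (C := A ⊗[ℂ] A) z) := by
    induction z with
    | zero => simp
    | add x y hx hy => simp only [map_add, hx, hy]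
    | tmul x y =>
      have h1 : (C.twist γ).coactForms ((C.twist γ).balance.mkQ
            (C.toTwist γ 1 x ⊗ₜ[ℂ] C.toTwist γ 1 y)) =
          TensorProduct.map (LinearMap.mul' ℂ (HopfTwist γ)) (C.twist γ).balance.mkQ
            (TensorProduct.tensorTensorTensorComm ℂ (HopfTwist γ) ((C.twist γ).Form 1)
              (HopfTwist γ) ((C.twist γ).Form 1)
              (coact (C := HopfTwist γ) (C.toTwist γ 1 x) ⊗ₜ[ℂ]
                coact (C := HopfTwist γ) (C.toTwist γ 1 y))) := rfl
      have h2 : coact (C := A ⊗[ℂ] A) (x ⊗ₜ[ℂ] y) = TensorProduct.tensorTensorTensorComm ℂ A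
        (C.Form 1) A (C.Form 1) (coact (C := A) x ⊗ₜ[ℂ] coact (C := A) y) := rfl
      rw [toTwist₂_tmul, h1, h2, coact_toTwist, coact_toTwist]
      hopf_tensor_induction coact (C := A) x with a x'
      hopf_tensor_induction coact (C := A) y with b y'
      simp only [TensorProduct.map_tmul, TensorProduct.tensorTensorTensorComm_tmul,
        LinearMap.comp_apply, LinearMap.mul'_apply, LinearEquiv.coe_coe, HopfTwist.of_mul,
        toTwist₂_tmul]
  rw [h]
  hopf_tensor_induction coact (C := A ⊗[ℂ] A) z with c v
  simp only [TensorProduct.map_tmul, LinearMap.comp_apply, LinearEquiv.coe_coe, untwistForms_mkQ,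
    LinearEquiv.symm_apply_apply]
  rfl

section Metric
variable {C} {g : C.FormTensor} {p : C.FormTensor →ₗ[ℂ] C.Form 0}

theorem twistPairing_tmul (x y : C.Form 1) :
    C.twistPairing γ p ((C.twist γ).tmul (C.toTwist γ 1 x) (C.toTwist γ 1 y)) =
      C.toTwist γ 0 ((p ∘ₗ C.balance.mkQ) (act γ.fn (x ⊗ₜ[ℂ] y))) := rfl

/-- Each identity for the deformed metric is a mixed associativity law, in which one of the
operations may be the pairing or the quotient map onto `Ω¹ ⊗_B Ω¹`, so that
`TwoCocycle.deform_assoc` derives it from the identity for the original metric. In the contraction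
identities a factor `γ` acting on `ω ⊗ g` or `g ⊗ ω` remains; it is trivial since `g` is
coinvariant. -/
theorem IsCovariantMetric.isMetric_twist (h : C.IsCovariantMetric g p) :
    (C.twist γ).IsMetric (C.twistTensor γ g) (C.twistPairing γ p) where
  left_linear b ω η := by
    obtain ⟨b, rfl⟩ := (C.toTwist γ 0).surjective b
    obtain ⟨ω, rfl⟩ := (C.toTwist γ 1).surjective ω
    obtain ⟨η, rfl⟩ := (C.toTwist γ 1).surjective η
    rw [twist_wedge_tmul, twistPairing_tmul, twistPairing_tmul, twist_wedge_tmul]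
    exact congrArg (C.toTwist γ 0) (γ.deform_assoc (C.coact_wedge _) h.coact_pairing
      h.left_linear b ω η)
  right_linear b ω η := by
    obtain ⟨b, rfl⟩ := (C.toTwist γ 0).surjective b
    obtain ⟨ω, rfl⟩ := (C.toTwist γ 1).surjective ω
    obtain ⟨η, rfl⟩ := (C.toTwist γ 1).surjective η
    rw [twist_wedge_tmul, twistPairing_tmul, twistPairing_tmul, twist_wedge_tmul]
    exact congrArg (C.toTwist γ 0) (γ.deform_assoc h.coact_pairing (C.coact_wedge _)
      (fun ω η b => (h.right_linear b ω η).symm) ω η b).symm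
  contract_left t ht ω := by
    obtain ⟨ω, rfl⟩ := (C.toTwist γ 1).surjective ω
    obtain ⟨t, rfl⟩ := (C.toTwist₂ γ 1 1).surjective t
    obtain ⟨G, hG⟩ := h.exists_contractLeft
    have hg : C.balance.mkQ (act γ.fn t) = g := by
      rw [← untwistForms_mkQ, ht, twistTensor, untwistForms_twistForms]
    have key : ∀ t, (C.twist γ).contractLeft (C.twistPairing γ p) (C.toTwist γ 1 ω)
        (C.toTwist₂ γ 1 1 t) =
          C.toTwist γ 1 (G (act γ.fn (ω ⊗ₜ[ℂ] C.balance.mkQ (act γ.fn t)))) := by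
      intro t
      induction t with
      | zero => simp
      | add x y hx hy => simp only [map_add, TensorProduct.tmul_add, hx, hy]
      | tmul η ζ =>
        rw [toTwist₂_tmul, contractLeft_tmul, twistPairing_tmul, twist_wedge_tmul]
        exact congrArg (C.toTwist γ 1) (γ.deform_assoc h.coact_pairing C.coact_mkQ
          (fun ω η ζ => (hG ω (η ⊗ₜ[ℂ] ζ)).symm) ω η ζ)
    rw [key, hg, γ.act_fn_tmul_coinvariant ω h.coact_tensor, ← hg, hG, h.contract_left _ hg]
  contract_right t ht ω := by
    obtain ⟨ω, rfl⟩ := (C.toTwist γ 1).surjective ω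
    obtain ⟨t, rfl⟩ := (C.toTwist₂ γ 1 1).surjective t
    obtain ⟨G, hG⟩ := h.exists_contractRight
    have hg : C.balance.mkQ (act γ.fn t) = g := by
      rw [← untwistForms_mkQ, ht, twistTensor, untwistForms_twistForms]
    have key : ∀ t, (C.twist γ).contractRight (C.twistPairing γ p) (C.toTwist γ 1 ω)
        (C.toTwist₂ γ 1 1 t) =
          C.toTwist γ 1 (G (act γ.fn (C.balance.mkQ (act γ.fn t) ⊗ₜ[ℂ] ω))) := by
      intro t
      induction t with
      | zero => simp
      | add x y hx hy => simp only [map_add, TensorProduct.add_tmul, hx, hy]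
      | tmul η ζ =>
        rw [toTwist₂_tmul, contractRight_tmul, twistPairing_tmul, twist_wedge_tmul]
        exact congrArg (C.toTwist γ 1) (γ.deform_assoc C.coact_mkQ h.coact_pairing
          (fun η ζ ω => hG ω (η ⊗ₜ[ℂ] ζ)) η ζ ω).symm
    rw [key, hg, γ.act_fn_coinvariant_tmul h.coact_tensor, ← hg, hG, h.contract_right _ hg]

/-- Under `φ` the map `coev` of the deformed metric corresponds to that of the original one, because
`γ` acts trivially on `b ⊗ g`. -/
theorem IsCovariantMetric.untwistForms_coev (h : C.IsCovariantMetric g p) (b : C.Form 0) :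
    C.untwistForms γ ((C.twist γ).coev (C.twistTensor γ g) (C.toTwist γ 0 b)) = C.coev g b := by
  obtain ⟨G, hG⟩ := C.exists_leftMul
  have key : ∀ t, C.untwistForms γ ((C.twist γ).leftMul (C.toTwist γ 0 b) t) =
      G (act γ.fn (b ⊗ₜ[ℂ] C.untwistForms γ t)) := by
    intro t
    obtain ⟨t, rfl⟩ := (C.twist γ).balance.mkQ_surjective t
    obtain ⟨t, rfl⟩ := (C.toTwist₂ γ 1 1).surjective t
    rw [untwistForms_mkQ]
    clear h
    induction t with
    | zero => simp
    | add x y hx hy => simp only [map_add, TensorProduct.tmul_add, hx, hy]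
    | tmul η ζ =>
      rw [toTwist₂_tmul]
      refine (congrArg (C.untwistForms γ) (leftMul_tmul _ _ _)).trans ?_
      rw [twist_wedge_tmul, untwistForms_tmul]
      exact γ.deform_assoc (C.coact_wedge _) C.coact_mkQ
        (fun b η ζ => (hG b (C.tmul η ζ)).symm) b η ζ
  refine (key _).trans ?_
  rw [twistTensor, untwistForms_twistForms, γ.act_fn_tmul_coinvariant b h.coact_tensor, hG]
  rfl

theorem IsCovariantMetric.twist (h : C.IsCovariantMetric g p) :
    (C.twist γ).IsCovariantMetric (C.twistTensor γ g) (C.twistPairing γ p) where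
  toIsMetric := h.isMetric_twist γ
  pairing_covariant t := by
    have h1 : coact (C := HopfTwist γ) (C.twistPairing γ p t) =
        TensorProduct.map (HopfTwist.of γ).toLinearMap (C.toTwist γ 0).toLinearMap
          (coact (C := A) (p (C.untwistForms γ t))) :=
      C.coact_toTwist γ 0 _
    rw [h1, h.pairing_covariant, coactForms_untwistForms]
    hopf_tensor_induction (C.twist γ).coactForms t with a s
    rfl
  coev_covariant b := by
    obtain ⟨b, rfl⟩ := (C.toTwist γ 0).surjective b
    have hinj : Function.Injective (TensorProduct.map (HopfTwist.of γ).symm.toLinearMap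
        (C.untwistForms γ)) := by
      refine Function.LeftInverse.injective (g := TensorProduct.map (HopfTwist.of γ).toLinearMap
        (C.twistForms γ)) fun z => ?_
      hopf_tensor_induction z with a s
      simp [twistForms_untwistForms]
    apply hinj
    rw [← coactForms_untwistForms, h.untwistForms_coev, h.coev_covariant, coact_toTwist]
    hopf_tensor_induction coact (C := A) b with a b'
    simp only [TensorProduct.map_tmul, LinearMap.lTensor_tmul, LinearEquiv.coe_coe,
      LinearEquiv.symm_apply_apply, h.untwistForms_coev]

end Metric
end CovariantCalculus

/-! ### Reality of the deformed metric -/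

namespace CovariantCalculus
variable {A Ω : Type*} [Ring A] [HopfAlgebra ℂ A] [StarRing A] [Ring Ω] [Algebra ℂ Ω] [Star Ω]
  [ComoduleAlgebra A Ω] {C : CovariantCalculus A Ω} {γ : TwoCocycle A}

/-- Reality in terms of an arbitrary representative of `g` in `Ω¹ ⊗ Ω¹`. -/
theorem IsReal.mkQ_dagger {g : C.FormTensor} (hg : C.IsReal g) (hC : C.IsStarCalculus)
    (t : C.Form 1 ⊗[ℂ] C.Form 1) (ht : C.balance.mkQ t = g) :
    C.balance.mkQ (dagger (hC.starForm 1) (hC.starForm 1) t) = g := by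
  obtain ⟨n, ω, η, rfl⟩ := TensorProduct.exists_sum_tmul_eq t
  obtain ⟨ω', η', hω, hη, h⟩ := hg n ω η (by rw [← ht, map_sum]; rfl)
  have hω' : ∀ i, ω' i = hC.starForm 1 (ω i) := fun i => C.incl_injective 1 (hω i)
  have hη' : ∀ i, η' i = hC.starForm 1 (η i) := fun i => C.incl_injective 1 (hη i)
  rw [h, map_sum, map_sum]
  exact Finset.sum_congr rfl fun i _ => by rw [hω', hη']; rfl

variable [StarModule ℂ A]

theorem act_Vinv_coinvariant {M : Type*} [AddCommGroup M] [Module ℂ M] [LeftComodule A M] {m : M}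
    (hm : coact (C := A) m = 1 ⊗ₜ[ℂ] m) : act γ.Vinv m = m := by
  have h : γ.Vinv.ofConv 1 = 1 := by
    simp [TwoCocycle.Vinv, Bialgebra.comul_one, Algebra.TensorProduct.one_def, antipodeInv_one,
      TwoCocycle.inv_one_tmul]
  simp [act, hm, h]

/-- The image under `φ` of the conjugate of `g_γ` is `V⁻¹` acting on the conjugate of `g`, and `V⁻¹`
acts trivially on the coinvariant element `g`. -/
theorem IsReal.twist [HopfStarAlgebra A] {g : C.FormTensor} (hg : C.IsReal g)
    (hC : C.IsStarCalculus) (hγ : γ.IsUnitary) (hco : coact (C := A) g = 1 ⊗ₜ[ℂ] g) :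
    (C.twist γ).IsReal (C.twistTensor γ g) := by
  intro n ω η h
  let s := fun x : C.Form 1 => act γ.Vinv (hC.starForm 1 x)
  refine ⟨fun i => C.toTwist γ 1 (s ((C.toTwist γ 1).symm (ω i))),
    fun i => C.toTwist γ 1 (s ((C.toTwist γ 1).symm (η i))),
    fun i => C.incl_act γ.Vinv (hC.starForm 1 ((C.toTwist γ 1).symm (ω i))),
    fun i => C.incl_act γ.Vinv (hC.starForm 1 ((C.toTwist γ 1).symm (η i))), ?_⟩
  let t : C.Form 1 ⊗[ℂ] C.Form 1 :=
    ∑ i, (C.toTwist γ 1).symm (ω i) ⊗ₜ[ℂ] (C.toTwist γ 1).symm (η i)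
  have ht : C.balance.mkQ (act γ.fn t) = g := by
    rw [← C.untwistForms_twistForms γ g]
    refine Eq.trans ?_ (congrArg (C.untwistForms γ) h.symm)
    simp only [t, map_sum]
    rfl
  have h1 := hg.mkQ_dagger hC _ ht
  have h2 := congr(act γ.Vinv $h1)
  rw [act_Vinv_coinvariant hco, act_nat (C := A ⊗[ℂ] A) (D := A)
    (Bialgebra.mulCoalgHom ℂ A).toLinearMap C.balance.mkQ C.coact_mkQ] at h2
  change C.balance.mkQ (act (pull (Bialgebra.mulCoalgHom ℂ A) γ.Vinv) _) = g at h2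
  rw [← hγ.conjFlip_flipAntipode, ← act_dagger (hC.isStarCompatible_starForm 1)
    (hC.isStarCompatible_starForm 1), ← act_mul, γ.flipAntipode_mul_pull_Vinv, act_mul,
    ← untwistForms_mkQ] at h2
  rw [twistTensor, ← h2, twistForms_untwistForms]
  simp only [t, map_sum, dagger_tmul, act_tens]
  rfl

end CovariantCalculus

end

theorem mainTheorem6 {A Ω : Type*} [Ring A] [HopfAlgebra ℂ A] [StarRing A] [StarModule ℂ A]
    [HopfStarAlgebra A] [Ring Ω] [Algebra ℂ Ω] [Star Ω] [ComoduleAlgebra A Ω]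
    (C : CovariantCalculus A Ω) (hC : C.IsStarCalculus)
    (g : C.FormTensor) (p : C.FormTensor →ₗ[ℂ] C.Form 0)
    (hg : C.IsCovariantMetric g p) (hreal : C.IsReal g)
    (γ : TwoCocycle A) (hγ : γ.IsUnitary) :
    (C.twist γ).IsStarCalculus ∧
      (C.twist γ).IsCovariantMetric (C.twistTensor γ g) (C.twistPairing γ p) ∧
      (C.twist γ).IsReal (C.twistTensor γ g) :=
  ⟨hC.twist hγ, hg.twist γ, hreal.twist hC hγ hg.coact_tensor⟩
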